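/- **Setting.** Let $\mathbb H^N$ be the quaternionic vector space with complex structures $I_1,I_2,I_3$ given by left multiplication, and write $\xi\in\mathbb H^N$ as $\xi=z+wI_2$ with $(z,w)\in\mathbb C^N\times\mathbb C^N$. The torus $T^N=\{\zeta\in\mathbb C^N: |\zeta_i|=1\}$ acts by $(z,w)\zeta=(z\zeta,w\zeta^{-1})$. Let $K\subset T^N$ be a connected subtorus (a closed connected subgroup) with Lie algebra $k\subset t^N=\mathbb R^N$, let $K_{\mathbb C}=K\exp(\sqrt{-1}k)$ be its complexification, let $n=N-\dim K$, and let $\iota^*u_i\in k^*$ be the restriction of the $i$-th coordinate to $k$. The hyperkähler moment map $\mu=(\mu_1,\mu_{\mathbb C})\colon\mathbb H^N\to k^*\times k^*_{\mathbb C}\cong k^*\otimes\mathbb R^3$, $\mu_{\mathbb C}=\mu_2+\sqrt{-1}\mu_3$, is $$\mu_1(z,w)=\pi\sum_i(|z_i|^2-|w_i|^2)\,\iota^*u_i,\qquad \mu_{\mathbb C}(z,w)=-2\pi\sqrt{-1}\sum_i z_iw_i\,\iota^*u_i .$$ Let $X(\alpha,\beta)=\mu^{-1}(\alpha,\beta)/K$.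 Let $(k^*\times k^*_{\mathbb C})_{reg}$ be the set of regular values of $\mu$. Let $H_1,\dots,H_l$ be the one-dimensional subgroups of $K$ that are isotropy subgroups $K_{(z,w)}$ of points of $\mathbb H^N$, and let $W_s=\{v\in k^*:\langle v,\mathrm{Lie}\,H_s\rangle=0\}$, $W_{s\mathbb C}=W_s\otimes\mathbb C$. For $(\alpha,\beta)\in k^*\times k^*_{\mathbb C}$ the semistable locus $\mu_{\mathbb C}^{-1}(\beta)^{\alpha\text{-}ss}$ is the set of $(z,w)\in\mu_{\mathbb C}^{-1}(\beta)$ with $\alpha\in\sum_i\mathbb R_{\ge0}|z_i|^2\iota^*u_i+\sum_i\mathbb R_{\ge0}|w_i|^2(-\iota^*u_i)$. Its categorical quotient $\mu_{\mathbb C}^{-1}(\beta)^{\alpha\text{-}ss}/\!/K_{\mathbb C}$ identifies two points if and only if the closures of their $K_{\mathbb C}$-orbits in the semistable locus meet; the inclusion $\mu^{-1}(\alpha,\beta)\subset\mu_{\mathbb C}^{-1}(\beta)^{\alpha\text{-}ss}$ induces a natural map $X(\alpha,\beta)\to\mu_{\mathbb C}^{-1}(\beta)^{\alpha\text{-}ss}/\!/K_{\mathbb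 C}$. If $\mu_{\mathbb C}^{-1}(\beta)^{\alpha\text{-}ss}\subset\mu_{\mathbb C}^{-1}(\beta)^{\alpha'\text{-}ss}$, a map $X(\alpha,\beta)\to X(\alpha',\beta)$ is called the natural morphism (with respect to $I_1$) if it is compatible, under these natural maps, with the map of categorical quotients induced by the inclusion. For $\alpha'=0$, where the inclusion always holds, it is denoted by $\pi_1\colon X(\alpha,\beta)\to X(0,\beta)$. Natural morphisms with respect to $I_2$ and $I_3$ (which change only the component $\alpha_2$, respectively $\alpha_3$, of a parameter $(\alpha_1,\alpha_2,\alpha_3)$, $(\alpha,\beta)=(\alpha_1,\alpha_2+\sqrt{-1}\alpha_3)$) are defined in the same way after rotating $I_1,I_2,I_3$ cyclically. **Statement.** 1. $(k^*\times k^*_{\mathbb C})_{reg}=(k^*\times k^*_{\mathbb C})\setminus\bigcup_{s=1}^l W_s\times W_{s\mathbb C}$. 2. If $(\alpha,\beta)\in(k^*\times k^*_{\mathbb C})_{reg}$, then $X(\alpha,\beta)$ is a (smooth, effective) orbifold of real dimension $4n$: it is Hausdorff and second countable, and the local uniformizing charts induced by smooth slices of the $K$-action on $\mu^{-1}(\alpha,\beta)$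 cover it and are compatible with each other. 3. If $(0,\beta)\in(k^*\times k^*_{\mathbb C})_{reg}$, then for every $\alpha\in k^*$ the natural morphism $\pi_1\colon(X(\alpha,\beta),I_1)\to(X(0,\beta),I_1)$ exists, is unique, and is a biholomorphic map of complex orbifolds. 4. If $(\alpha,\beta)\in(k^*\times k^*_{\mathbb C})_{reg}$, then every $K_{\mathbb C}$-orbit in $\mu_{\mathbb C}^{-1}(\beta)^{\alpha\text{-}ss}$ is closed in $\mu_{\mathbb C}^{-1}(\beta)^{\alpha\text{-}ss}$, and the categorical quotient is a geometric quotient: the canonical map $\mu_{\mathbb C}^{-1}(\beta)^{\alpha\text{-}ss}/K_{\mathbb C}\to\mu_{\mathbb C}^{-1}(\beta)^{\alpha\text{-}ss}/\!/K_{\mathbb C}$ from the orbit space is a homeomorphism. 5. For any two parameters $(\alpha,\beta),(\alpha',\beta')\in(k^*\times k^*_{\mathbb C})_{reg}$ the orbifolds $X(\alpha,\beta)$ and $X(\alpha',\beta')$ are diffeomorphic, by a diffeomorphism which is a composition of diffeomorphisms each of which is a natural morphism (with respect to $I_1$, $I_2$ or $I_3$) or the inverse of one. -/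

import Mathlib

open scoped ContDiff

noncomputable section

/-! ### Orbifolds through local uniformizing charts -/

/-- A local uniformizing chart of a topological space `X`: a connected open set `source` of `𝕜ᵐ`,
a finite group acting effectively on it by `C^∞` maps over `𝕜` (that is, smooth maps for `𝕜 = ℝ`,
holomorphic maps for `𝕜 = ℂ`), and a map to `X` which induces a homeomorphism of `source / group`
onto an open subset of `X`. The values of `toFun` and of the group outside `source` are
irrelevant. -/
structure OrbifoldChart (𝕜 : Type) [NontriviallyNormedField 𝕜] (m : ℕ)
    (X : Type) [TopologicalSpace X] where
  source : Set (Fin m → 𝕜)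
  isOpen_source : IsOpen source
  isConnected_source : IsConnected source
  group : Subgroup (Equiv.Perm (Fin m → 𝕜))
  finite_group : Finite group
  mapsTo_source : ∀ g ∈ group, Set.MapsTo g source source
  contDiffOn_group : ∀ g ∈ group, ContDiffOn 𝕜 ∞ g source
  effective : ∀ g ∈ group, (∀ u ∈ source, g u = u) → g = 1
  toFun : (Fin m → 𝕜) → X
  continuousOn_toFun : ContinuousOn toFun source
  isOpen_image : ∀ V ⊆ source, IsOpen V → IsOpen (toFun '' V)
  toFun_eq_iff : ∀ u ∈ source, ∀ v ∈ source, toFun u = toFun v ↔ ∃ g ∈ group, g u = v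

/-- The map `f` lifts, near any two points of the charts `c` and `d` that correspond to each other
under `f`, to a local `C^∞` diffeomorphism over `𝕜` between the uniformizing domains. -/
def LiftsToCharts {𝕜 : Type} [NontriviallyNormedField 𝕜] {m : ℕ}
    {X Y : Type} [TopologicalSpace X] [TopologicalSpace Y]
    (f : X → Y) (c : OrbifoldChart 𝕜 m X) (d : OrbifoldChart 𝕜 m Y) : Prop :=
  ∀ u ∈ c.source, ∀ v ∈ d.source, f (c.toFun u) = d.toFun v →
    ∃ e : OpenPartialHomeomorph (Fin m → 𝕜) (Fin m → 𝕜),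
      u ∈ e.source ∧ e u = v ∧ e.source ⊆ c.source ∧ e.target ⊆ d.source ∧
      ContDiffOn 𝕜 ∞ e e.source ∧ ContDiffOn 𝕜 ∞ e.symm e.target ∧
      ∀ x ∈ e.source, f (c.toFun x) = d.toFun (e x)

/-- The set of charts `A` makes `X` an orbifold (a smooth one for `𝕜 = ℝ`, a complex one for
`𝕜 = ℂ`): `X` is Hausdorff and second countable, and the charts cover `X` and are pairwise
compatible. -/
structure IsOrbifold {𝕜 : Type} [NontriviallyNormedField 𝕜] {m : ℕ}
    {X : Type} [TopologicalSpace X] (A : Set (OrbifoldChart 𝕜 m X)) : Prop where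
  t2 : T2Space X
  secondCountable : SecondCountableTopology X
  covers : ∀ x : X, ∃ c ∈ A, ∃ u ∈ c.source, c.toFun u = x
  compatible : ∀ c ∈ A, ∀ d ∈ A, LiftsToCharts id c d

/-- Isomorphisms of orbifolds: diffeomorphisms for `𝕜 = ℝ`, biholomorphic maps for `𝕜 = ℂ`. -/
structure IsOrbifoldIso {𝕜 : Type} [NontriviallyNormedField 𝕜] {m : ℕ}
    {X Y : Type} [TopologicalSpace X] [TopologicalSpace Y]
    (A : Set (OrbifoldChart 𝕜 m X)) (B : Set (OrbifoldChart 𝕜 m Y)) (f : X → Y) : Prop where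
  isOrbifold_source : IsOrbifold A
  isOrbifold_target : IsOrbifold B
  isHomeomorph : IsHomeomorph f
  lifts : ∀ c ∈ A, ∀ d ∈ B, LiftsToCharts f c d

namespace ToricHK

/-! ### The quaternions `ℍ ∋ ξ = z + w I₂` -/

/-- The quaternions `I₁, I₂, I₃` (indexed by `0, 1, 2`). The complex structures of `ℍᴺ` are the
left multiplications by them. -/
def imUnit (j : Fin 3) : Quaternion ℝ :=
  ⟨0, if j = 0 then 1 else 0, if j = 1 then 1 else 0, if j = 2 then 1 else 0⟩

theorem re_imUnit (j : Fin 3) : (imUnit j).re = 0 := rfl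

theorem imI_imUnit (j : Fin 3) : (imUnit j).imI = if j = 0 then 1 else 0 := rfl

theorem imJ_imUnit (j : Fin 3) : (imUnit j).imJ = if j = 1 then 1 else 0 := rfl

theorem imK_imUnit (j : Fin 3) : (imUnit j).imK = if j = 2 then 1 else 0 := rfl

/-- The coordinate `z` of `ξ = z + w I₂`. -/
def zCoord (ξ : Quaternion ℝ) : ℂ := ⟨ξ.re, ξ.imI⟩

/-- The coordinate `w` of `ξ = z + w I₂`. -/
def wCoord (ξ : Quaternion ℝ) : ℂ := ⟨ξ.imJ, ξ.imK⟩

theorem eq_zCoord_add_wCoord (ξ : Quaternion ℝ) :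
    ξ = (zCoord ξ : Quaternion ℝ) + (wCoord ξ : Quaternion ℝ) * imUnit 1 := by
  ext <;> simp [zCoord, wCoord, re_imUnit, imI_imUnit, imJ_imUnit, imK_imUnit]

/-- The `z`-part of `ξ` with respect to the complex structure `I_j`: the component on which
`I_j ξ = ξ I₁`. For `j = 0` it is `z`. -/
def zPart (j : Fin 3) (ξ : Quaternion ℝ) : Quaternion ℝ :=
  (1 / 2 : ℝ) • (ξ - imUnit j * ξ * imUnit 0)

/-- The `w`-part of `ξ` with respect to the complex structure `I_j`: the component on which
`I_j ξ = -ξ I₁`. For `j = 0` it is `w I₂`. -/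
def wPart (j : Fin 3) (ξ : Quaternion ℝ) : Quaternion ℝ :=
  (1 / 2 : ℝ) • (ξ + imUnit j * ξ * imUnit 0)

theorem zPart_zero (ξ : Quaternion ℝ) : zPart 0 ξ = (zCoord ξ : Quaternion ℝ) := by
  ext <;> simp [zPart, zCoord, re_imUnit, imI_imUnit, imJ_imUnit, imK_imUnit] <;> ring

theorem wPart_zero (ξ : Quaternion ℝ) :
    wPart 0 ξ = (wCoord ξ : Quaternion ℝ) * imUnit 1 := by
  ext <;> simp [wPart, wCoord, re_imUnit, imI_imUnit, imJ_imUnit, imK_imUnit] <;> ring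

theorem zPart_add_wPart (j : Fin 3) (ξ : Quaternion ℝ) : zPart j ξ + wPart j ξ = ξ := by
  rw [zPart, wPart, ← smul_add, sub_add_add_cancel, ← two_smul ℝ ξ, smul_smul]
  norm_num

/-- The hyperkähler moment map `(π (|z|² - |w|²), -2π√-1 z w)` of the circle action on `ℍ`. -/
def momentCoord (ξ : Quaternion ℝ) : Fin 3 → ℝ :=
  ![Real.pi * (‖zCoord ξ‖ ^ 2 - ‖wCoord ξ‖ ^ 2),
    (-2 * Real.pi * Complex.I * zCoord ξ * wCoord ξ).re,
    (-2 * Real.pi * Complex.I * zCoord ξ * wCoord ξ).im]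

theorem momentCoord_eq (j : Fin 3) (ξ : Quaternion ℝ) :
    momentCoord ξ j = Real.pi * (‖zPart j ξ‖ ^ 2 - ‖wPart j ξ‖ ^ 2) := by
  have h : ∀ q : Quaternion ℝ, ‖q‖ ^ 2 = q.re ^ 2 + q.imI ^ 2 + q.imJ ^ 2 + q.imK ^ 2 := by
    intro q
    rw [sq, ← Quaternion.normSq_eq_norm_mul_self, Quaternion.normSq_def']
  have h' : ∀ q : ℂ, ‖q‖ ^ 2 = q.re ^ 2 + q.im ^ 2 := by
    intro q
    rw [← Complex.normSq_eq_norm_sq, Complex.normSq_apply]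
    ring
  fin_cases j <;> simp [momentCoord, h, h', zPart, wPart, re_imUnit, imI_imUnit, imJ_imUnit, imK_imUnit,
    zCoord, wCoord] <;> ring

/-! ### Subtori, isotropy subgroups and walls -/

variable {N : ℕ}

/-- The quaternionic vector space `ℍᴺ`. -/
abbrev HN (N : ℕ) : Type := Fin N → Quaternion ℝ

/-- The exponential map `ℝᴺ = tᴺ → Tᴺ`, whose kernel is `ℤᴺ`. -/
def torusExp (X : Fin N → ℝ) : Fin N → Circle := fun i => Circle.exp (2 * Real.pi * X i)

/-- The Lie algebra of a subgroup of `Tᴺ`. -/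
def lieAlg (H : Subgroup (Fin N → Circle)) : Submodule ℝ (Fin N → ℝ) where
  carrier := {X | ∀ t : ℝ, torusExp (t • X) ∈ H}
  zero_mem' := by
    intro t
    have : torusExp (t • (0 : Fin N → ℝ)) = 1 := by
      funext i
      simp [torusExp]
    rw [this]
    exact H.one_mem
  add_mem' := by
    intro X Y hX hY t
    have : torusExp (t • (X + Y)) = torusExp (t • X) * torusExp (t • Y) := by
      funext i
      simp [torusExp, mul_add, Circle.exp_add]
    rw [this]
    exact H.mul_mem (hX t) (hY t)
  smul_mem' := by
    intro c X hX t
    have := hX (t * c)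
    rwa [mul_smul] at this

/-- The action of `Tᴺ` on `ℍᴺ`; in coordinates it is `(z, w) ↦ (z ζ, w ζ⁻¹)`. -/
def torusAct (ζ : Fin N → Circle) (ξ : HN N) : HN N :=
  fun i => ξ i * ((ζ i : ℂ) : Quaternion ℝ)

theorem torusAct_one (ξ : HN N) : torusAct 1 ξ = ξ := by
  funext i
  simp [torusAct]

theorem torusAct_mul (ζ η : Fin N → Circle) (ξ : HN N) :
    torusAct (ζ * η) ξ = torusAct η (torusAct ζ ξ) := by
  funext i
  simp [torusAct, mul_assoc]

theorem torusAct_coord (ζ : Fin N → Circle) (ξ : HN N) (i : Fin N) :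
    zCoord (torusAct ζ ξ i) = zCoord (ξ i) * ζ i ∧
      wCoord (torusAct ζ ξ i) = wCoord (ξ i) * (ζ i : ℂ)⁻¹ := by
  rw [← Circle.coe_inv, Circle.coe_inv_eq_conj]
  constructor <;> apply Complex.ext <;> simp [torusAct, zCoord, wCoord]

/-- The isotropy subgroup `K_ξ`. -/
def isotropy (K : Subgroup (Fin N → Circle)) (ξ : HN N) : Subgroup (Fin N → Circle) where
  carrier := {ζ | ζ ∈ K ∧ torusAct ζ ξ = ξ}
  one_mem' := ⟨K.one_mem, torusAct_one ξ⟩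
  mul_mem' := by
    rintro ζ η ⟨h1, h2⟩ ⟨h3, h4⟩
    exact ⟨K.mul_mem h1 h3, by rw [torusAct_mul, h2, h4]⟩
  inv_mem' := by
    rintro ζ ⟨h1, h2⟩
    refine ⟨K.inv_mem h1, ?_⟩
    calc torusAct ζ⁻¹ ξ = torusAct ζ⁻¹ (torusAct ζ ξ) := by rw [h2]
      _ = ξ := by rw [← torusAct_mul, mul_inv_cancel, torusAct_one]

/-- The dual `k*` of the Lie algebra of `K`. -/
abbrev kDual (K : Subgroup (Fin N → Circle)) : Type := StrongDual ℝ (lieAlg K)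

/-- The parameter space `k* ⊗ ℝ³ ≅ k* × k_ℂ*`: a parameter `a` stands for
`(α, β) = (a 0, a 1 + √-1 a 2)`. -/
abbrev Param (K : Subgroup (Fin N → Circle)) : Type := Fin 3 → kDual K

/-- `ι* u_i`, the restriction to `k` of the `i`-th coordinate of `tᴺ`. -/
def iotaStar (K : Subgroup (Fin N → Circle)) (i : Fin N) : kDual K :=
  (ContinuousLinearMap.proj (R := ℝ) (φ := fun _ : Fin N => ℝ) i).comp (lieAlg K).subtypeL

/-- `Λ⁽¹⁾`, the set of one-dimensional isotropy subgroups. -/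
def oneDimIsotropy (K : Subgroup (Fin N → Circle)) : Set (Subgroup (Fin N → Circle)) :=
  {H | (∃ ξ : HN N, H = isotropy K ξ) ∧ Module.finrank ℝ (lieAlg H) = 1}

/-- The wall `W = {v ∈ k* | ⟨v, Lie H⟩ = 0}`. -/
def wall (K H : Subgroup (Fin N → Circle)) : Set (kDual K) :=
  {v | ∀ X : lieAlg K, (X : Fin N → ℝ) ∈ lieAlg H → v X = 0}

/-- The hyperkähler moment map `μ = (μ₁, μ₂, μ₃)`. -/
def momentMap (K : Subgroup (Fin N → Circle)) (ξ : HN N) : Param K :=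
  fun j => ∑ i, momentCoord (ξ i) j • iotaStar K i

/-- The set of regular values of the hyperkähler moment map. -/
def regularValues (K : Subgroup (Fin N → Circle)) : Set (Param K) :=
  {a | ∀ ξ : HN N, momentMap K ξ = a → Function.Surjective (fderiv ℝ (momentMap K) ξ)}

/-- The quaternionic dimension `n = N - dim K` of the quotients. -/
def quotDim (K : Subgroup (Fin N → Circle)) : ℕ := N - Module.finrank ℝ (lieAlg K)

/-! ### The hyperkähler quotient -/

/-- The level set `μ⁻¹(a)`. -/
abbrev LevelSet (K : Subgroup (Fin N → Circle)) (a : Param K) : Type :=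
  {ξ : HN N // momentMap K ξ = a}

/-- The relation of lying in the same `K`-orbit. -/
def orbitSetoid (K : Subgroup (Fin N → Circle)) (a : Param K) : Setoid (LevelSet K a) where
  r x y := ∃ ζ ∈ K, y.1 = torusAct ζ x.1
  iseqv :=
    { refl := fun x => ⟨1, K.one_mem, (torusAct_one x.1).symm⟩
      symm := by
        rintro x y ⟨ζ, hζ, h⟩
        refine ⟨ζ⁻¹, K.inv_mem hζ, ?_⟩
        rw [h, ← torusAct_mul, mul_inv_cancel, torusAct_one]
      trans := by
        rintro x y z ⟨ζ, hζ, h⟩ ⟨η, hη, h'⟩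
        exact ⟨ζ * η, K.mul_mem hζ hη, by rw [h', h, torusAct_mul]⟩ }

/-- The toric hyperkähler variety `X(a) = μ⁻¹(a) / K`, with the quotient topology. -/
abbrev Variety (K : Subgroup (Fin N → Circle)) (a : Param K) : Type :=
  Quotient (orbitSetoid K a)

/-- The value at `ξ` of the vector field on `ℍᴺ` induced by `X ∈ tᴺ`. -/
def infAct (X : Fin N → ℝ) (ξ : HN N) : HN N :=
  fun i => (2 * Real.pi * X i) • (ξ i * imUnit 0)

/-- The complex structure `I_j` of `ℍᴺ`. -/
def complexStr (j : Fin 3) (ξ : HN N) : HN N := fun i => imUnit j * ξ i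

/-- `σ` is a smooth lift to `μ⁻¹(a)` of the map `φ : s → X(a)`, and `σ` is an immersion transverse
to the `K`-orbits (when `a` is regular and `dim E = 4 n`, its derivative then maps `E`
isomorphically onto the normal space of the orbit in `μ⁻¹(a)`). -/
def IsSlice (K : Subgroup (Fin N → Circle)) (a : Param K) {E : Type} [NormedAddCommGroup E]
    [NormedSpace ℝ E] (s : Set E) (φ : E → Variety K a) (σ : E → HN N) : Prop :=
  ContDiffOn ℝ ∞ σ s ∧
  (∀ u ∈ s, ∃ h : momentMap K (σ u) = a, φ u = Quotient.mk (orbitSetoid K a) ⟨σ u, h⟩) ∧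
  ∀ u ∈ s, ∀ v : E, (∃ X ∈ lieAlg K, fderiv ℝ σ u v = infAct X (σ u)) → v = 0

/-- The natural smooth orbifold charts of `X(a) = μ⁻¹(a) / K`: those induced by smooth slices of
the `K`-action on `μ⁻¹(a)`. -/
def smoothAtlas (K : Subgroup (Fin N → Circle)) (a : Param K) :
    Set (OrbifoldChart ℝ (4 * quotDim K) (Variety K a)) :=
  {c | ∃ σ : (Fin (4 * quotDim K) → ℝ) → HN N, IsSlice K a c.source c.toFun σ}

/-- The natural holomorphic orbifold charts of `(X(a), I_j)`. The tangent space of `X(a)` at the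
class of `p` is the orthogonal complement of `k p` in `T_p μ⁻¹(a)`, which is an `I_j`-complex
subspace complementary to `k p + I_j k p` in `T_p μ⁻¹(a) + I_j k p`. Hence a slice `σ` induces an
`I_j`-holomorphic map if and only if its derivative is `I_j`-linear modulo `k p + I_j k p`. -/
def holomorphicAtlas (K : Subgroup (Fin N → Circle)) (j : Fin 3) (a : Param K) :
    Set (OrbifoldChart ℂ (2 * quotDim K) (Variety K a)) :=
  {c | ∃ σ : (Fin (2 * quotDim K) → ℂ) → HN N, IsSlice K a c.source c.toFun σ ∧
    ∀ u ∈ c.source, ∀ v, ∃ X ∈ lieAlg K, ∃ Y ∈ lieAlg K,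
      fderiv ℝ σ u (Complex.I • v) - complexStr j (fderiv ℝ σ u v) =
        infAct X (σ u) + complexStr j (infAct Y (σ u))}

/-! ### Semistable points and GIT quotients -/

/-- The complexification `K_ℂ = K · Exp(√-1 k)` of `K` in `(ℂˣ)ᴺ`. -/
def complexification (K : Subgroup (Fin N → Circle)) : Set (Fin N → ℂ) :=
  {ζ | ∃ κ ∈ K, ∃ X ∈ lieAlg K, ∀ i, ζ i = κ i * Real.exp (-2 * Real.pi * X i)}

/-- The action of `ζ ∈ (ℂˣ)ᴺ` on `ℍᴺ` which is holomorphic with respect to `I_j` and extends the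
action of `Tᴺ`. For `j = 0` it is `(z, w) ↦ (z ζ, w ζ⁻¹)`, see `complexAct_coord`; the cases
`j = 1, 2` arise by cyclic rotation of `I₁, I₂, I₃`. -/
def complexAct (j : Fin 3) (ζ : Fin N → ℂ) (ξ : HN N) : HN N :=
  fun i => zPart j (ξ i) * (ζ i : Quaternion ℝ) +
    wPart j (ξ i) * (((starRingEnd ℂ (ζ i))⁻¹ : ℂ) : Quaternion ℝ)

theorem complexAct_coord (ζ : Fin N → ℂ) (ξ : HN N) (i : Fin N) :
    zCoord (complexAct 0 ζ ξ i) = zCoord (ξ i) * ζ i ∧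
      wCoord (complexAct 0 ζ ξ i) = wCoord (ξ i) * (ζ i)⁻¹ := by
  rw [complexAct, zPart_zero, wPart_zero, ← map_inv₀]
  constructor <;> apply Complex.ext <;> simp [zCoord, wCoord, re_imUnit, imI_imUnit, imJ_imUnit, imK_imUnit]
  all_goals ring

theorem complexAct_circle (j : Fin 3) (κ : Fin N → Circle) (ξ : HN N) :
    complexAct j (fun i => (κ i : ℂ)) ξ = torusAct κ ξ := by
  funext i
  rw [complexAct, torusAct, ← Circle.coe_inv_eq_conj, Circle.coe_inv, inv_inv, ← add_mul,
    zPart_add_wPart]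

/-- The `K_ℂ`-orbit of `ξ`, with respect to `I_j`. -/
def complexOrbit (K : Subgroup (Fin N → Circle)) (j : Fin 3) (ξ : HN N) : Set (HN N) :=
  {η | ∃ ζ ∈ complexification K, η = complexAct j ζ ξ}

theorem torusAct_mem_complexOrbit (K : Subgroup (Fin N → Circle)) (j : Fin 3) (ξ : HN N)
    {κ : Fin N → Circle} (hκ : κ ∈ K) : torusAct κ ξ ∈ complexOrbit K j ξ :=
  ⟨fun i => (κ i : ℂ), ⟨κ, hκ, 0, (lieAlg K).zero_mem, by simp⟩, (complexAct_circle j κ ξ).symm⟩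

theorem self_mem_complexOrbit (K : Subgroup (Fin N → Circle)) (j : Fin 3) (ξ : HN N) :
    ξ ∈ complexOrbit K j ξ := by
  simpa only [torusAct_one] using torusAct_mem_complexOrbit K j ξ K.one_mem

/-- The semistable locus with respect to `I_j` and the parameter `a`. For `j = 0` and
`a = (α, β)` it is `μ_ℂ⁻¹(β)^{α-ss}`, the set of points `(z, w)` of `μ_ℂ⁻¹(β)` with
`α ∈ ∑ ℝ_{≥0} |z_i|² ι*u_i + ∑ ℝ_{≥0} |w_i|² (-ι*u_i)`. -/
def semistable (K : Subgroup (Fin N → Circle)) (j : Fin 3) (a : Param K) : Set (HN N) :=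
  {ξ | (∀ l, l ≠ j → momentMap K ξ l = a l) ∧
    ∃ s t : Fin N → ℝ, (∀ i, 0 ≤ s i) ∧ (∀ i, 0 ≤ t i) ∧
      a j = ∑ i, (s i * ‖zPart j (ξ i)‖ ^ 2) • iotaStar K i +
        ∑ i, (t i * ‖wPart j (ξ i)‖ ^ 2) • (-iotaStar K i)}

theorem levelSet_subset_semistable (K : Subgroup (Fin N → Circle)) (j : Fin 3) (a : Param K)
    {ξ : HN N} (h : momentMap K ξ = a) : ξ ∈ semistable K j a := by
  refine ⟨fun l _ => by rw [h], fun _ => Real.pi, fun _ => Real.pi,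
    fun _ => Real.pi_pos.le, fun _ => Real.pi_pos.le, ?_⟩
  rw [← h, ← Finset.sum_add_distrib]
  refine Finset.sum_congr rfl fun i _ => ?_
  rw [momentCoord_eq]
  module

/-- Two semistable points have the same image in the categorical quotient if and only if the
closures of their `K_ℂ`-orbits in the semistable locus meet. -/
def gitRel (K : Subgroup (Fin N → Circle)) (j : Fin 3) (a : Param K) (x y : semistable K j a) :
    Prop :=
  (closure (complexOrbit K j x.1) ∩ closure (complexOrbit K j y.1) ∩ semistable K j a).Nonempty

/-- The categorical quotient `semistable // K_ℂ`, with the quotient topology. -/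
abbrev GITQuotient (K : Subgroup (Fin N → Circle)) (j : Fin 3) (a : Param K) : Type :=
  Quot (gitRel K j a)

/-- The orbit space `semistable / K_ℂ`, with the quotient topology. -/
abbrev ComplexOrbitSpace (K : Subgroup (Fin N → Circle)) (j : Fin 3) (a : Param K) : Type :=
  Quot (fun x y : semistable K j a => y.1 ∈ complexOrbit K j x.1)

/-- The canonical map `semistable / K_ℂ → semistable // K_ℂ`. The categorical quotient is a
geometric quotient when this map is a homeomorphism. -/
def orbitSpaceToGIT (K : Subgroup (Fin N → Circle)) (j : Fin 3) (a : Param K) :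
    ComplexOrbitSpace K j a → GITQuotient K j a :=
  Quot.map id fun _ y h =>
    ⟨y.1, ⟨subset_closure h, subset_closure (self_mem_complexOrbit K j y.1)⟩, y.2⟩

/-- The natural map `X(a) → semistable // K_ℂ` induced by `μ⁻¹(a) ⊆ semistable`. -/
def varietyToGIT (K : Subgroup (Fin N → Circle)) (j : Fin 3) (a : Param K) :
    Variety K a → GITQuotient K j a :=
  Quotient.lift
    (fun x : LevelSet K a =>
      Quot.mk (gitRel K j a) ⟨x.1, levelSet_subset_semistable K j a x.2⟩)
    (by
      rintro x y ⟨ζ, hζ, h⟩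
      refine Quot.sound ⟨y.1, ⟨subset_closure ?_, subset_closure (self_mem_complexOrbit K j y.1)⟩,
        levelSet_subset_semistable K j a y.2⟩
      rw [h]
      exact torusAct_mem_complexOrbit K j x.1 hζ)

/-- The map of categorical quotients induced by an inclusion of semistable loci. -/
def gitMap (K : Subgroup (Fin N → Circle)) (j : Fin 3) {a b : Param K}
    (h : semistable K j a ⊆ semistable K j b) : GITQuotient K j a → GITQuotient K j b :=
  Quot.map (Set.inclusion h) fun _ _ ⟨p, hp, hps⟩ => ⟨p, hp, h hps⟩

/-- `f : X(a) → X(b)` is the natural morphism with respect to `I_j`, where `a` and `b` differ at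
most in the component `j`: under the natural maps to the categorical quotients, `f` corresponds to
the map induced by the inclusion of the semistable locus for `a` in the one for `b`. For
`b = Function.update a j 0` this is the morphism `π_{j+1}`. -/
def IsNaturalMorphism (K : Subgroup (Fin N → Circle)) (j : Fin 3) {a b : Param K}
    (f : Variety K a → Variety K b) : Prop :=
  (∀ l, l ≠ j → a l = b l) ∧
  ∃ h : semistable K j a ⊆ semistable K j b,
    ∀ x, varietyToGIT K j b (f x) = gitMap K j h (varietyToGIT K j a x)

/-- The compositions of diffeomorphisms each of which is a natural morphism or the inverse of
one. -/
inductive IsNaturalComposite (K : Subgroup (Fin N → Circle)) :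
    ∀ {a b : Param K}, (Variety K a ≃ₜ Variety K b) → Prop
  | refl (a : Param K) : IsNaturalComposite K (Homeomorph.refl (Variety K a))
  | natural {a b : Param K} (j : Fin 3) (e : Variety K a ≃ₜ Variety K b)
      (h : IsNaturalMorphism K j e) (h' : IsOrbifoldIso (smoothAtlas K a) (smoothAtlas K b) e) :
      IsNaturalComposite K e
  | symm {a b : Param K} (e : Variety K a ≃ₜ Variety K b) (h : IsNaturalComposite K e) :
      IsNaturalComposite K e.symm
  | trans {a b c : Param K} (e : Variety K a ≃ₜ Variety K b) (f : Variety K b ≃ₜ Variety K c)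
      (he : IsNaturalComposite K e) (hf : IsNaturalComposite K f) :
      IsNaturalComposite K (e.trans f)

end ToricHK

end

open ToricHK

/-! Regularity is linear algebra. The moment map `ℍ → ℝ³` of one circle is onto, and a submersion
away from `0`. Hence `dμ` is onto at `ξ` exactly when the weights `ι*u_i` with `ξ_i ≠ 0` span `k*`
(`momentDeriv_surjective_iff`), and a parameter is regular exactly when no proper span of weights
contains all three of its components (`mem_regularValues_iff`). The maximal proper spans of weights
are walls of one-dimensional isotropy groups, which gives the description of the regular values.

Quotients are compared by a Kempf–Ness argument. Along `Exp(√-1 k) ξ` there is a convex function of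
`Y ∈ k`, a sum of exponentials plus a linear term, whose critical points are the `Y` that bring `ξ`
to the level `α` of `μ_j`. For a regular parameter and a semistable `ξ` it is proper and its
critical point is unique (`exists_momentMap_scaleAct_eq`, `momentMap_scaleAct_injective`), and the
critical point depends smoothly on `ξ` (`contDiffAt_retractParam`). The result is a smooth
retraction `retract` of the semistable locus onto `μ⁻¹(a)` which sends each `K_ℂ`-orbit into a
single `K`-orbit. Compactness of `K`-orbits makes `K_ℂ`-orbits closed in the semistable locus, so
the categorical quotient is the orbit space. The natural morphisms are induced by `retract`, and
they are unique because `X(b)` injects into the categorical quotient.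

Charts come from frames, that is, sets of weights which form a basis of `k*`. Where one of `z_i`,
`w_i` is nonzero for each `i` in the frame, `K_ℂ` normalizes it to `1`; the equation `μ_ℂ = β`
determines its partner, and the other `2n` complex coordinates are free. This is a holomorphic slice
which meets `K_ℂ`-orbits in orbits of the finite group fixing the frame. The normalization
`Frame.proj` is holomorphic and its derivative kills exactly the orbit directions in `μ_ℂ⁻¹(β)`.
Viewed through it, any two slices through the same orbit differ by a local diffeomorphism, by the
inverse function theorem. This yields the compatibility of charts, and also the lifts of natural
morphisms, because `retract` turns slices at `a` into slices at `b`.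

Variation of `α`: if `(0, β)` is regular, the weights with `z_i w_i ≠ 0` already span `k*` on
`μ_ℂ⁻¹(β)`, so every point is semistable for every `α` (`mem_semistable_iff_of_update`) and the
natural morphisms are invertible. In general the semistable locus is locally constant at a regular
parameter (`eventually_semistable_eq`), so one component can be made generic. A generic component
keeps the parameter regular whatever the others are, so the components can be moved one at a time to
a common value `(η, η, η)`. -/

noncomputable section

/-! ### Smoothness over `ℂ` -/

/-- A map between complex vector spaces which is smooth over `ℝ` and complex differentiable is
smooth over `ℂ`. -/
theorem ContDiffOn.complex_of_real {E F : Type*} [NormedAddCommGroup E] [NormedSpace ℂ E]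
    [FiniteDimensional ℂ E] [NormedAddCommGroup F] [NormedSpace ℂ F] {s : Set E} (hs : IsOpen s)
    {f : E → F} (hf : ContDiffOn ℝ ∞ f s) (hd : DifferentiableOn ℂ f s) :
    ContDiffOn ℂ ∞ f s := by
  rw [contDiffOn_infty]
  intro n
  induction n generalizing f with
  | zero => exact contDiffOn_zero.2 hd.continuousOn
  | succ n ih =>
    rw [Nat.cast_succ, contDiffOn_succ_iff_fderiv_of_isOpen hs]
    refine ⟨hd, fun h => absurd h (by simp), contDiffOn_clm_apply.2 fun y => ?_⟩
    have hR : ∀ x ∈ s, fderiv ℝ f x = (fderiv ℂ f x).restrictScalars ℝ := fun x hx =>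
      ((hd.differentiableAt (hs.mem_nhds hx)).hasFDerivAt.restrictScalars ℝ).fderiv
    have hf' : ContDiffOn ℝ ∞ (fderiv ℝ f) s :=
      hf.fderiv_of_isOpen hs (by simp)
    have heq : ∀ v, ∀ x ∈ s, fderiv ℂ f x v = fderiv ℝ f x v := fun v x hx => by rw [hR x hx]; rfl
    have hsm : ∀ v, ContDiffOn ℝ ∞ (fun x => fderiv ℂ f x v) s := fun v =>
      (hf'.clm_apply contDiffOn_const).congr (heq v)
    refine ih (hsm y) fun x hx => ?_
    have hxs := hs.mem_nhds hx
    have h2 : HasFDerivAt (fderiv ℝ f) (fderiv ℝ (fderiv ℝ f) x) x :=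
      ((hf'.differentiableOn (by simp)).differentiableAt hxs).hasFDerivAt
    have hv : ∀ v, HasFDerivAt (fun x => fderiv ℂ f x v)
        ((fderiv ℝ (fderiv ℝ f) x).flip v) x := fun v => by
      have h3 := h2.clm_apply (hasFDerivAt_const v x)
      refine (h3.congr_of_eventuallyEq ?_).congr_fderiv ?_
      · filter_upwards [hxs] with z hz using heq v z hz
      · ext w; simp
    have hsymm : ∀ v w, fderiv ℝ (fderiv ℝ f) x v w = fderiv ℝ (fderiv ℝ f) x w v := fun v w =>
      ((hf.contDiffAt hxs).isSymmSndFDerivAt (by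
        rw [minSmoothness_of_isRCLikeNormedField]
        exact WithTop.coe_le_coe.2 (le_top : (2 : ℕ∞) ≤ ⊤))) v w
    refine (DifferentiableAt.differentiableWithinAt ?_)
    rw [differentiableAt_iff_restrictScalars ℝ (hv y).differentiableAt, (hv y).fderiv]
    -- Symmetry of the real second derivative moves `c • v` to the slot of the first differential,
    -- which is already complex linear. So `x ↦ df(x) y` is again complex differentiable and the
    -- induction continues.
    have hlin : ∀ (c : ℂ) (v : E), fderiv ℝ (fderiv ℝ f) x (c • v) y =
        c • fderiv ℝ (fderiv ℝ f) x v y := by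
      intro c v
      rw [hsymm, hsymm v]
      have h4 : HasFDerivAt (fun x => fderiv ℂ f x (c • v))
          (c • (fderiv ℝ (fderiv ℝ f) x).flip v) x := by
        simp only [map_smul]
        exact (hv v).const_smul c
      have := (hv (c • v)).unique h4
      simpa using DFunLike.congr_fun this y
    refine ⟨⟨⟨⟨fun v => fderiv ℝ (fderiv ℝ f) x v y, ?_⟩, ?_⟩, ?_⟩, ?_⟩
    · intro v w; simp
    · intro c v; simpa using hlin c v
    · exact ((fderiv ℝ (fderiv ℝ f) x).flip y).continuous
    · ext v; rfl

/-! ### Isomorphisms of orbifolds -/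

section Orbifold

variable {𝕜 : Type} [NontriviallyNormedField 𝕜] {m : ℕ} {X Y Z : Type} [TopologicalSpace X]
  [TopologicalSpace Y] [TopologicalSpace Z] {A : Set (OrbifoldChart 𝕜 m X)}
  {B : Set (OrbifoldChart 𝕜 m Y)} {C : Set (OrbifoldChart 𝕜 m Z)}

theorem IsOrbifoldIso.symm {e : X ≃ₜ Y} (h : IsOrbifoldIso A B e) : IsOrbifoldIso B A e.symm := by
  refine ⟨h.2, h.1, e.symm.isHomeomorph, fun c hc d hd u hu v hv huv => ?_⟩
  obtain ⟨g, h1, h2, h3, h4, h5, h6, h7⟩ := h.lifts d hd c hc v hv u hu (by simp [← huv])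
  refine ⟨g.symm, ?_, ?_, h4, h3, h6, h5, fun x hx => ?_⟩
  · rw [← h2]; exact g.map_source h1
  · rw [← h2]; exact g.left_inv h1
  · rw [Homeomorph.symm_apply_eq, h7 _ (g.map_target hx), g.right_inv hx]

theorem IsOrbifoldIso.trans {e : X ≃ₜ Y} {f : Y ≃ₜ Z} (h : IsOrbifoldIso A B e)
    (h' : IsOrbifoldIso B C f) : IsOrbifoldIso A C (e.trans f) := by
  refine ⟨h.1, h'.2, (e.trans f).isHomeomorph, fun c hc d hd u hu v hv huv => ?_⟩
  -- The local lift of the composite passes through any chart of `B` around the intermediate point.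
  obtain ⟨b, hb, y, hy, hyu⟩ := h.isOrbifold_target.covers (e (c.toFun u))
  obtain ⟨g, h1, h2, h3, h4, h5, h6, h7⟩ := h.lifts c hc b hb u hu y hy hyu.symm
  obtain ⟨g', h1', h2', h3', h4', h5', h6', h7'⟩ := h'.lifts b hb d hd y hy v hv (by
    rw [hyu]; exact huv)
  refine ⟨g.trans g', ?_, ?_, ?_, ?_, ?_, ?_, ?_⟩
  · simp [h1, h2, h1']
  · simp [h2, h2']
  · intro x hx
    simp only [OpenPartialHomeomorph.trans_source] at hx
    exact h3 hx.1
  · intro x hx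
    simp only [OpenPartialHomeomorph.trans_target] at hx
    exact h4' hx.1
  · rw [OpenPartialHomeomorph.trans_source]
    exact h5'.comp (h5.mono Set.inter_subset_left) fun x hx => hx.2
  · rw [OpenPartialHomeomorph.trans_target]
    exact h6.comp (h6'.mono Set.inter_subset_left) fun x hx => hx.2
  · intro x hx
    simp only [OpenPartialHomeomorph.trans_source] at hx
    simp [h7 x hx.1, h7' _ hx.2]

end Orbifold

/-! ### Inverse function theorem and charts from linear actions -/

/-- A smooth map with injective derivative between spaces of the same dimension is locally a
diffeomorphism. -/
theorem exists_openPartialHomeomorph_of_injective {𝕜 : Type*} [RCLike 𝕜] {E F : Type*}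
    [NormedAddCommGroup E] [NormedSpace 𝕜 E] [FiniteDimensional 𝕜 E]
    [NormedAddCommGroup F] [NormedSpace 𝕜 F] [FiniteDimensional 𝕜 F]
    (hEF : Module.finrank 𝕜 E = Module.finrank 𝕜 F) {s : Set E} (hs : IsOpen s) {f : E → F}
    (hf : ContDiffOn 𝕜 ∞ f s) (hinj : ∀ x ∈ s, ∀ v, fderiv 𝕜 f x v = 0 → v = 0) {u : E}
    (hu : u ∈ s) :
    ∃ e : OpenPartialHomeomorph E F, u ∈ e.source ∧ e.source ⊆ s ∧ (∀ x, e x = f x) ∧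
      ContDiffOn 𝕜 ∞ e e.source ∧ ContDiffOn 𝕜 ∞ e.symm e.target := by
  have := FiniteDimensional.complete 𝕜 E
  have := FiniteDimensional.complete 𝕜 F
  have hequiv : ∀ x ∈ s, ∃ f' : E ≃L[𝕜] F, HasFDerivAt f (f' : E →L[𝕜] F) x := by
    intro x hx
    have hi : Function.Injective (fderiv 𝕜 f x : E →ₗ[𝕜] F) :=
      (injective_iff_map_eq_zero _).2 fun v hv => hinj x hx v hv
    refine ⟨(LinearEquiv.ofInjectiveOfFinrankEq _ hi hEF).toContinuousLinearEquiv, ?_⟩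
    convert ((hf.contDiffAt (hs.mem_nhds hx)).differentiableAt (by simp)).hasFDerivAt using 1
    ext v
    rfl
  obtain ⟨f', hf'⟩ := hequiv u hu
  have hc := hf.contDiffAt (hs.mem_nhds hu)
  let e₀ := hc.toOpenPartialHomeomorph f hf' (by simp)
  -- After restriction to `s` the derivative is invertible at every point of the source, so the
  -- inverse is smooth on the whole target and not only near `f u`.
  let e := e₀.restrOpen s hs
  have he : ∀ x, e x = f x := fun x => rfl
  have hes : e.source ⊆ s := fun x hx => hx.2
  have hsm : ContDiffOn 𝕜 ∞ e e.source := hf.mono hes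
  refine ⟨e, ⟨hc.mem_toOpenPartialHomeomorph_source hf' (by simp), hu⟩, hes, he, hsm, ?_⟩
  intro y hy
  obtain ⟨g', hg'⟩ := hequiv _ (hes (e.map_target hy))
  exact (e.contDiffAt_symm hy hg' (hf.contDiffAt (hs.mem_nhds (hes (e.map_target hy))))).contDiffWithinAt

/-- Two local diffeomorphisms with a common value differ by a local diffeomorphism. -/
theorem exists_openPartialHomeomorph_comp {𝕜 : Type*} [RCLike 𝕜] {E F : Type*}
    [NormedAddCommGroup E] [NormedSpace 𝕜 E] [FiniteDimensional 𝕜 E]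
    [NormedAddCommGroup F] [NormedSpace 𝕜 F] [FiniteDimensional 𝕜 F]
    (hEF : Module.finrank 𝕜 E = Module.finrank 𝕜 F) {s t : Set E} (hs : IsOpen s) (ht : IsOpen t)
    {f g : E → F} (hf : ContDiffOn 𝕜 ∞ f s) (hg : ContDiffOn 𝕜 ∞ g t)
    (hfi : ∀ x ∈ s, ∀ v, fderiv 𝕜 f x v = 0 → v = 0)
    (hgi : ∀ x ∈ t, ∀ v, fderiv 𝕜 g x v = 0 → v = 0) {u v : E} (hu : u ∈ s) (hv : v ∈ t)
    (huv : f u = g v) :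
    ∃ e : OpenPartialHomeomorph E E, u ∈ e.source ∧ e u = v ∧ e.source ⊆ s ∧ e.target ⊆ t ∧
      ContDiffOn 𝕜 ∞ e e.source ∧ ContDiffOn 𝕜 ∞ e.symm e.target ∧
      ∀ x ∈ e.source, f x = g (e x) := by
  obtain ⟨a, ha1, ha2, ha3, ha4, ha5⟩ := exists_openPartialHomeomorph_of_injective hEF hs hf hfi hu
  obtain ⟨b, hb1, hb2, hb3, hb4, hb5⟩ := exists_openPartialHomeomorph_of_injective hEF ht hg hgi hv
  have hub : a u = b v := by rw [ha3, hb3, huv]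
  refine ⟨a.trans b.symm, ?_, ?_, ?_, ?_, ?_, ?_, ?_⟩
  · simp [ha1, hub, hb1]
  · simp [hub, hb1]
  · intro x hx
    rw [OpenPartialHomeomorph.trans_source] at hx
    exact ha2 hx.1
  · intro x hx
    rw [OpenPartialHomeomorph.trans_target] at hx
    exact hb2 hx.1
  · rw [OpenPartialHomeomorph.trans_source]
    exact hb5.comp (ha4.mono Set.inter_subset_left) fun x hx => hx.2
  · rw [OpenPartialHomeomorph.trans_target]
    exact ha5.comp (hb4.mono Set.inter_subset_left) fun x hx => hx.2
  · intro x hx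
    rw [OpenPartialHomeomorph.trans_source] at hx
    have h := b.right_inv hx.2
    rw [← ha3, ← h, hb3]; rfl

/-- The orbifold chart of `X` induced by a map `φ` on an open subset `s` of a vector space, whose
fibres are the orbits of a linear action of a finite group. -/
def OrbifoldChart.ofLinearAction {𝕜 : Type} [NontriviallyNormedField 𝕜] [CompleteSpace 𝕜] {m : ℕ}
    {X : Type} [TopologicalSpace X] {F : Type*} [NormedAddCommGroup F] [NormedSpace 𝕜 F]
    (L : (Fin m → 𝕜) ≃L[𝕜] F) {s : Set F} (hs : IsOpen s) (hsc : IsConnected s)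
    {G : Type*} [Group G] [Finite G] (ρ : G →* (F ≃L[𝕜] F)) (hρ : ∀ g, Set.MapsTo (ρ g) s s)
    {φ : F → X} (hφ : ContinuousOn φ s) (hφo : ∀ V ⊆ s, IsOpen V → IsOpen (φ '' V))
    (hφf : ∀ u ∈ s, ∀ v ∈ s, φ u = φ v ↔ ∃ g, ρ g u = v) : OrbifoldChart 𝕜 m X where
  source := L ⁻¹' s
  isOpen_source := hs.preimage L.continuous
  isConnected_source := L.toHomeomorph.isConnected_preimage.2 hsc
  -- The image in the permutation group is used instead of `G`, which removes any kernel of `ρ`.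
  group := MonoidHom.range ({
    toFun := fun g => (L.toEquiv.trans (ρ g).toEquiv).trans L.symm.toEquiv
    map_one' := by
      ext1 x
      change L.symm (ρ 1 (L x)) = x
      rw [map_one]
      exact L.symm_apply_apply x
    map_mul' := by
      intro g h
      ext1 x
      change L.symm (ρ (g * h) (L x)) = L.symm (ρ g (L (L.symm (ρ h (L x)))))
      rw [map_mul, L.apply_symm_apply]
      rfl } : G →* Equiv.Perm (Fin m → 𝕜))
  finite_group := Set.finite_range _
  mapsTo_source := by
    rintro _ ⟨g, rfl⟩ u hu
    simpa using hρ g hu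
  contDiffOn_group := by
    rintro _ ⟨g, rfl⟩
    exact ((L.trans (ρ g)).trans L.symm).contDiff.contDiffOn
  effective := by
    rintro _ ⟨g, rfl⟩ h
    obtain ⟨u, hu⟩ := (L.toHomeomorph.isConnected_preimage.2 hsc).nonempty
    let T : (Fin m → 𝕜) →L[𝕜] (Fin m → 𝕜) :=
      ((L.trans (ρ g)).trans L.symm).toContinuousLinearMap
    -- A linear map is its own derivative, so one which is the identity on a nonempty open set is
    -- the identity everywhere.
    have h1 : T = ContinuousLinearMap.id 𝕜 _ := by
      have h2 : HasFDerivAt T T u := T.hasFDerivAt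
      have h3 : HasFDerivAt T (ContinuousLinearMap.id 𝕜 _) u := by
        refine (hasFDerivAt_id u).congr_of_eventuallyEq ?_
        filter_upwards [(hs.preimage L.continuous).mem_nhds hu] with x hx using h x hx
      exact h2.unique h3
    ext1 x
    exact DFunLike.congr_fun h1 x
  toFun := φ ∘ L
  continuousOn_toFun := hφ.comp L.continuous.continuousOn fun _ hx => hx
  isOpen_image := by
    intro V hV hVo
    rw [Set.image_comp]
    refine hφo _ ?_ (L.toHomeomorph.isOpenMap V hVo)
    rintro _ ⟨x, hx, rfl⟩
    exact hV hx
  toFun_eq_iff := by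
    intro u hu v hv
    refine (hφf _ hu _ hv).trans ⟨?_, ?_⟩
    · rintro ⟨g, hg⟩
      exact ⟨_, ⟨g, rfl⟩, by simp [hg]⟩
    · rintro ⟨_, ⟨g, rfl⟩, hg⟩
      exact ⟨g, by simp [← hg]⟩

namespace ToricHK

variable {N : ℕ}

/-! ### Quaternionic linear algebra -/

theorem zPart_zPart (j : Fin 3) (q : Quaternion ℝ) : zPart j (zPart j q) = zPart j q := by
  fin_cases j <;> ext <;> simp [zPart, re_imUnit, imI_imUnit, imJ_imUnit, imK_imUnit] <;> ring

theorem wPart_wPart (j : Fin 3) (q : Quaternion ℝ) : wPart j (wPart j q) = wPart j q := by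
  fin_cases j <;> ext <;> simp [wPart, re_imUnit, imI_imUnit, imJ_imUnit, imK_imUnit] <;> ring

theorem zPart_add (j : Fin 3) (p q : Quaternion ℝ) : zPart j (p + q) = zPart j p + zPart j q := by
  simp only [zPart, mul_add, add_mul]; module

theorem wPart_add (j : Fin 3) (p q : Quaternion ℝ) : wPart j (p + q) = wPart j p + wPart j q := by
  simp only [wPart, mul_add, add_mul]; module

theorem zPart_smul (j : Fin 3) (c : ℝ) (q : Quaternion ℝ) : zPart j (c • q) = c • zPart j q := by
  simp only [zPart, mul_smul_comm, smul_mul_assoc]; module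

theorem wPart_smul (j : Fin 3) (c : ℝ) (q : Quaternion ℝ) : wPart j (c • q) = c • wPart j q := by
  simp only [wPart, mul_smul_comm, smul_mul_assoc]; module

theorem zPart_wPart (j : Fin 3) (q : Quaternion ℝ) : zPart j (wPart j q) = 0 := by
  have h := congrArg (zPart j) (zPart_add_wPart j q)
  rwa [zPart_add, zPart_zPart, add_eq_left] at h

theorem wPart_zPart (j : Fin 3) (q : Quaternion ℝ) : wPart j (zPart j q) = 0 := by
  have h := congrArg (wPart j) (zPart_add_wPart j q)
  rwa [wPart_add, wPart_wPart, add_eq_right] at h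

theorem zPart_mul_complex (j : Fin 3) (q : Quaternion ℝ) (c : ℂ) :
    zPart j (q * (c : Quaternion ℝ)) = zPart j q * (c : Quaternion ℝ) := by
  fin_cases j <;> ext <;> simp [zPart, re_imUnit, imI_imUnit, imJ_imUnit, imK_imUnit] <;> ring

theorem wPart_mul_complex (j : Fin 3) (q : Quaternion ℝ) (c : ℂ) :
    wPart j (q * (c : Quaternion ℝ)) = wPart j q * (c : Quaternion ℝ) := by
  fin_cases j <;> ext <;> simp [wPart, re_imUnit, imI_imUnit, imJ_imUnit, imK_imUnit] <;> ring

theorem imUnit_mul_self (j : Fin 3) : imUnit j * imUnit j = -1 := by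
  fin_cases j <;> ext <;> simp [re_imUnit, imI_imUnit, imJ_imUnit, imK_imUnit] <;> rfl

/-- The quaternion `z + w I₂`. -/
def mkQ (z w : ℂ) : Quaternion ℝ := ⟨z.re, z.im, w.re, w.im⟩

theorem re_mkQ (z w : ℂ) : (mkQ z w).re = z.re := rfl

theorem imI_mkQ (z w : ℂ) : (mkQ z w).imI = z.im := rfl

theorem imJ_mkQ (z w : ℂ) : (mkQ z w).imJ = w.re := rfl

theorem imK_mkQ (z w : ℂ) : (mkQ z w).imK = w.im := rfl

/-- `zPart j` as a continuous linear map. -/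
def zPartL (j : Fin 3) : Quaternion ℝ →L[ℝ] Quaternion ℝ :=
  LinearMap.toContinuousLinearMap
    { toFun := zPart j, map_add' := zPart_add j, map_smul' := zPart_smul j }

/-- `wPart j` as a continuous linear map. -/
def wPartL (j : Fin 3) : Quaternion ℝ →L[ℝ] Quaternion ℝ :=
  LinearMap.toContinuousLinearMap
    { toFun := wPart j, map_add' := wPart_add j, map_smul' := wPart_smul j }

theorem zPartL_apply (j : Fin 3) (q : Quaternion ℝ) : zPartL j q = zPart j q := rfl

theorem wPartL_apply (j : Fin 3) (q : Quaternion ℝ) : wPartL j q = wPart j q := rfl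

/-- The symmetric bilinear form whose quadratic form is the moment map of the circle. -/
def momentBilin (j : Fin 3) : Quaternion ℝ →L[ℝ] Quaternion ℝ →L[ℝ] ℝ :=
  LinearMap.toContinuousLinearMap ((LinearMap.toContinuousLinearMap (𝕜 := ℝ)
    (E := Quaternion ℝ) (F' := ℝ)).toLinearMap ∘ₗ LinearMap.mk₂ ℝ
    (fun p q => ![Real.pi * (p.re * q.re + p.imI * q.imI - p.imJ * q.imJ - p.imK * q.imK),
      Real.pi * (p.re * q.imK + p.imK * q.re + p.imI * q.imJ + p.imJ * q.imI),
      Real.pi * (p.imI * q.imK + p.imK * q.imI - p.re * q.imJ - p.imJ * q.re)] j)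
    (by intro p p' q; fin_cases j <;> simp <;> ring) (by intro c p q; fin_cases j <;> simp <;> ring)
    (by intro p q q'; fin_cases j <;> simp <;> ring) (by intro c p q; fin_cases j <;> simp <;> ring))

theorem momentBilin_apply (j : Fin 3) (p q : Quaternion ℝ) :
    momentBilin j p q =
      ![Real.pi * (p.re * q.re + p.imI * q.imI - p.imJ * q.imJ - p.imK * q.imK),
        Real.pi * (p.re * q.imK + p.imK * q.re + p.imI * q.imJ + p.imJ * q.imI),
        Real.pi * (p.imI * q.imK + p.imK * q.imI - p.re * q.imJ - p.imJ * q.re)] j := rfl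

theorem momentCoord_eq_bilin (j : Fin 3) (q : Quaternion ℝ) :
    momentCoord q j = momentBilin j q q := by
  have h' : ∀ q : ℂ, ‖q‖ ^ 2 = q.re ^ 2 + q.im ^ 2 := by
    intro q
    rw [← Complex.normSq_eq_norm_sq, Complex.normSq_apply]
    ring
  rw [momentBilin_apply]
  fin_cases j <;> simp [momentCoord, h', zCoord, wCoord] <;> ring

theorem momentBilin_comm (j : Fin 3) (p q : Quaternion ℝ) :
    momentBilin j p q = momentBilin j q p := by
  simp only [momentBilin_apply]
  fin_cases j <;> simp <;> ring

theorem quaternion_norm_sq (q : Quaternion ℝ) :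
    ‖q‖ ^ 2 = q.re ^ 2 + q.imI ^ 2 + q.imJ ^ 2 + q.imK ^ 2 := by
  rw [sq, ← Quaternion.normSq_eq_norm_mul_self, Quaternion.normSq_def']

theorem momentBilin_mul_imUnit (l : Fin 3) (q : Quaternion ℝ) :
    momentBilin l q (q * imUnit 0) = 0 := by
  rw [momentBilin_apply]
  fin_cases l <;> simp [re_imUnit, imI_imUnit, imJ_imUnit, imK_imUnit] <;> ring

theorem momentBilin_imUnit_mul (j : Fin 3) (q : Quaternion ℝ) :
    momentBilin j q (imUnit j * (q * imUnit 0)) = -(Real.pi * ‖q‖ ^ 2) := by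
  rw [momentBilin_apply, quaternion_norm_sq]
  fin_cases j <;> simp [re_imUnit, imI_imUnit, imJ_imUnit, imK_imUnit] <;> ring

theorem norm_sq_zPart_add_wPart (j : Fin 3) (q : Quaternion ℝ) :
    ‖zPart j q‖ ^ 2 + ‖wPart j q‖ ^ 2 = ‖q‖ ^ 2 := by
  simp only [quaternion_norm_sq]
  fin_cases j <;> simp [zPart, wPart, re_imUnit, imI_imUnit, imJ_imUnit, imK_imUnit] <;> ring

theorem sum_momentCoord_sq (q : Quaternion ℝ) :
    ∑ l, momentCoord q l ^ 2 = (Real.pi * ‖q‖ ^ 2) ^ 2 := by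
  simp only [momentCoord_eq_bilin, momentBilin_apply, quaternion_norm_sq, Fin.sum_univ_three]
  simp
  ring

/-- The vector `momentCoord q` has length `π ‖q‖²`. If one part of `q` for `I_j` vanishes, the
`j`-th component alone already has this absolute value, so nothing is left for the others. -/
theorem momentCoord_eq_zero {j l : Fin 3} (hl : l ≠ j) {q : Quaternion ℝ}
    (h : zPart j q = 0 ∨ wPart j q = 0) : momentCoord q l = 0 := by
  have h1 := sum_momentCoord_sq q
  have h2 : momentCoord q j ^ 2 = (Real.pi * ‖q‖ ^ 2) ^ 2 := by
    rw [momentCoord_eq, ← norm_sq_zPart_add_wPart j q]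
    rcases h with h | h <;> rw [h] <;> simp
  have h3 : momentCoord q l ^ 2 + momentCoord q j ^ 2 ≤ ∑ l, momentCoord q l ^ 2 := by
    rw [← Finset.sum_pair (f := fun l => momentCoord q l ^ 2) hl]
    exact Finset.sum_le_sum_of_subset_of_nonneg (Finset.subset_univ _) fun _ _ _ => sq_nonneg _
  have h4 : momentCoord q l ^ 2 ≤ 0 := by linarith
  exact pow_eq_zero_iff two_ne_zero |>.1 (le_antisymm h4 (sq_nonneg _))

/-- The length of `v` must be `R = π (|z|² + |w|²)`, while `v 0 = π (|z|² - |w|²)`. This fixes `|z|`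
and `|w|`, and the phase of `z` is free. -/
theorem exists_momentCoord_eq (v : Fin 3 → ℝ) : ∃ q : Quaternion ℝ, momentCoord q = v := by
  have hpi := Real.pi_pos
  set R := Real.sqrt (v 0 ^ 2 + v 1 ^ 2 + v 2 ^ 2) with hR
  have hR2 : R ^ 2 = v 0 ^ 2 + v 1 ^ 2 + v 2 ^ 2 := Real.sq_sqrt (by positivity)
  have hR0 : |v 0| ≤ R := Real.abs_le_sqrt (by nlinarith [sq_nonneg (v 1), sq_nonneg (v 2)])
  have hx : 0 ≤ v 0 + R := by linarith [neg_abs_le (v 0)]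
  rcases hx.eq_or_lt with hx | hx
  -- The boundary case `v 0 = -R`: here `z = 0`, and `v 1`, `v 2` vanish.
  · have h0 : 0 ≤ -v 0 / Real.pi := div_nonneg (by linarith [abs_nonneg (v 0)]) hpi.le
    have hR' : R = -v 0 := by linarith
    have h12 : v 1 ^ 2 + v 2 ^ 2 = 0 := by rw [hR'] at hR2; linarith
    have h1 : v 1 = 0 := by nlinarith [sq_nonneg (v 1), sq_nonneg (v 2)]
    have h2 : v 2 = 0 := by nlinarith [sq_nonneg (v 1), sq_nonneg (v 2)]
    refine ⟨mkQ 0 ⟨Real.sqrt (-v 0 / Real.pi), 0⟩, funext fun j => ?_⟩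
    rw [momentCoord_eq_bilin, momentBilin_apply]
    simp only [re_mkQ, imI_mkQ, imJ_mkQ, imK_mkQ]
    fin_cases j
    · simp [Real.mul_self_sqrt h0]; field_simp
    · simp [h1]
    · simp [h2]
  · have hx' : 0 < (v 0 + R) / (2 * Real.pi) := by positivity
    -- This is `|z|`, since `2 π |z|² = v 0 + R`. With `z = a > 0` the equation `-2π√-1 z w = v 1 +
    -- √-1 v 2` is solved for `w`.
    set a := Real.sqrt ((v 0 + R) / (2 * Real.pi)) with ha
    have ha0 : 0 < a := Real.sqrt_pos.2 hx'
    have ha2 : a ^ 2 = (v 0 + R) / (2 * Real.pi) := Real.sq_sqrt hx'.le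
    refine ⟨mkQ ⟨a, 0⟩ ⟨-v 2 / (2 * Real.pi * a), v 1 / (2 * Real.pi * a)⟩, funext fun j => ?_⟩
    rw [momentCoord_eq_bilin, momentBilin_apply]
    simp only [re_mkQ, imI_mkQ, imJ_mkQ, imK_mkQ]
    fin_cases j
    · simp
      field_simp
      have h4 : a ^ 4 = ((v 0 + R) / (2 * Real.pi)) ^ 2 := by rw [← ha2]; ring
      rw [h4, ha2]
      field_simp
      linear_combination hR2
    · simp
      field_simp
      ring
    · simp
      field_simp
      ring

theorem exists_momentBilin_eq {q : Quaternion ℝ} (hq : q ≠ 0) (v : Fin 3 → ℝ) :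
    ∃ h : Quaternion ℝ, ∀ j, momentBilin j q h = v j := by
  have hn : 0 < q.re ^ 2 + q.imI ^ 2 + q.imJ ^ 2 + q.imK ^ 2 := by
    rw [← quaternion_norm_sq]; positivity
  have hpi := Real.pi_pos.ne'
  -- The vectors `-(I_j q I₁)` are dual to the three forms up to the factor `π ‖q‖²`: the `l`-th
  -- form pairs `q` with the `j`-th vector to zero unless `l = j`.
  refine ⟨((Real.pi * ‖q‖ ^ 2)⁻¹) • ∑ j, v j • -(imUnit j * (q * imUnit 0)), fun l => ?_⟩
  rw [quaternion_norm_sq, momentBilin_apply]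
  fin_cases l <;> simp [Fin.sum_univ_three, re_imUnit, imI_imUnit, imJ_imUnit, imK_imUnit] <;>
    field_simp <;> ring

/-! ### The action of `Exp(√-1 k)` -/

/-- The action of the real number `e ^ (-2 π y)` on `ℍ` which is holomorphic for `I_j`. -/
def scaleQ (j : Fin 3) (y : ℝ) (q : Quaternion ℝ) : Quaternion ℝ :=
  Real.exp (-2 * Real.pi * y) • zPart j q + Real.exp (2 * Real.pi * y) • wPart j q

theorem zPart_scaleQ (j : Fin 3) (y : ℝ) (q : Quaternion ℝ) :
    zPart j (scaleQ j y q) = Real.exp (-2 * Real.pi * y) • zPart j q := by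
  simp [scaleQ, zPart_add, zPart_smul, zPart_zPart, zPart_wPart]

theorem wPart_scaleQ (j : Fin 3) (y : ℝ) (q : Quaternion ℝ) :
    wPart j (scaleQ j y q) = Real.exp (2 * Real.pi * y) • wPart j q := by
  simp [scaleQ, wPart_add, wPart_smul, wPart_zPart, wPart_wPart]

theorem scaleQ_scaleQ (j : Fin 3) (x y : ℝ) (q : Quaternion ℝ) :
    scaleQ j x (scaleQ j y q) = scaleQ j (x + y) q := by
  rw [scaleQ, zPart_scaleQ, wPart_scaleQ, scaleQ, smul_smul, smul_smul, ← Real.exp_add,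
    ← Real.exp_add, mul_add, mul_add]

theorem scaleQ_zero (j : Fin 3) (q : Quaternion ℝ) : scaleQ j 0 q = q := by
  simp [scaleQ, zPart_add_wPart]

theorem scaleQ_mul_complex (j : Fin 3) (y : ℝ) (q : Quaternion ℝ) (c : ℂ) :
    scaleQ j y (q * (c : Quaternion ℝ)) = scaleQ j y q * (c : Quaternion ℝ) := by
  simp [scaleQ, zPart_mul_complex, wPart_mul_complex, add_mul]

theorem momentCoord_scaleQ_self (j : Fin 3) (y : ℝ) (q : Quaternion ℝ) :
    momentCoord (scaleQ j y q) j = Real.pi * (Real.exp (-4 * Real.pi * y) * ‖zPart j q‖ ^ 2 -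
      Real.exp (4 * Real.pi * y) * ‖wPart j q‖ ^ 2) := by
  rw [momentCoord_eq, zPart_scaleQ, wPart_scaleQ, norm_smul, norm_smul, mul_pow, mul_pow,
    Real.norm_eq_abs, Real.norm_eq_abs, sq_abs, sq_abs, ← Real.exp_nat_mul, ← Real.exp_nat_mul]
  congr 4 <;> push_cast <;> ring_nf

/-- The components `l ≠ j` form the complex moment map for `I_j`. Their bilinear forms vanish on
each of the two parts and only pair the `z`-part with the `w`-part, where the two scale factors
cancel. -/
theorem momentCoord_scaleQ_of_ne {j l : Fin 3} (h : l ≠ j) (y : ℝ) (q : Quaternion ℝ) :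
    momentCoord (scaleQ j y q) l = momentCoord q l := by
  have hr : Real.exp (-2 * Real.pi * y) * Real.exp (2 * Real.pi * y) = 1 := by
    rw [← Real.exp_add]; simp
  rw [momentCoord_eq_bilin, momentCoord_eq_bilin, scaleQ]
  generalize Real.exp (-2 * Real.pi * y) = r at *
  generalize Real.exp (2 * Real.pi * y) = s at *
  have hz : momentBilin l (zPart j q) (zPart j q) = 0 := by
    rw [← momentCoord_eq_bilin]
    exact momentCoord_eq_zero h (Or.inr (wPart_zPart j q))
  have hw : momentBilin l (wPart j q) (wPart j q) = 0 := by
    rw [← momentCoord_eq_bilin]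
    exact momentCoord_eq_zero h (Or.inl (zPart_wPart j q))
  conv_rhs => rw [← zPart_add_wPart j q]
  simp only [map_add, map_smul, add_apply, smul_apply, smul_eq_mul, hz, hw]
  rw [momentBilin_comm l (wPart j q)]
  linear_combination (2 * momentBilin l (zPart j q) (wPart j q)) * hr

/-- Up to the factor `2π` this is the velocity of `y ↦ scaleQ j y q` at `0`. It shows that the
scaling is generated by `I_j` times the infinitesimal circle action. -/
theorem zPart_sub_wPart (j : Fin 3) (q : Quaternion ℝ) :
    wPart j q - zPart j q = imUnit j * (q * imUnit 0) := by
  rw [zPart, wPart, mul_assoc]; module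

theorem scaleQ_imUnit_mul (j : Fin 3) (y : ℝ) (q : Quaternion ℝ) :
    scaleQ j y (imUnit j * q) = imUnit j * scaleQ j y q := by
  have h1 : zPart j (imUnit j * q) = imUnit j * zPart j q := by
    simp only [zPart, mul_smul_comm, mul_sub, mul_assoc]
  have h2 : wPart j (imUnit j * q) = imUnit j * wPart j q := by
    simp only [wPart, mul_smul_comm, mul_add, mul_assoc]
  rw [scaleQ, h1, h2, scaleQ, mul_add, mul_smul_comm, mul_smul_comm]

theorem scaleQ_mul_imUnit (j : Fin 3) (y : ℝ) (q : Quaternion ℝ) :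
    scaleQ j y (q * imUnit 0) = scaleQ j y q * imUnit 0 := by
  have : imUnit 0 = ((Complex.I : ℂ) : Quaternion ℝ) := by
    ext <;> simp [re_imUnit, imI_imUnit, imJ_imUnit, imK_imUnit]
  rw [this, scaleQ_mul_complex]

/-! ### Shortcut instances -/

instance instNormedAddCommGroupLieAlg (K : Subgroup (Fin N → Circle)) :
    NormedAddCommGroup (lieAlg K) := inferInstance

instance instNormedSpaceLieAlg (K : Subgroup (Fin N → Circle)) :
    NormedSpace ℝ (lieAlg K) := inferInstance

instance instNormedAddCommGroupKDual (K : Subgroup (Fin N → Circle)) :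
    NormedAddCommGroup (kDual K) := inferInstance

instance instNormedSpaceKDual (K : Subgroup (Fin N → Circle)) :
    NormedSpace ℝ (kDual K) := inferInstance

/-! ### The spans of the restricted coordinates -/

theorem iotaStar_apply (K : Subgroup (Fin N → Circle)) (i : Fin N) (X : lieAlg K) :
    iotaStar K i X = X.1 i := rfl

/-- The span in `k*` of the `ι*u_i` with `i ∈ S`. -/
def coordSpan (K : Subgroup (Fin N → Circle)) (S : Set (Fin N)) : Submodule ℝ (kDual K) :=
  Submodule.span ℝ (iotaStar K '' S)

theorem coordSpan_mono (K : Subgroup (Fin N → Circle)) {S T : Set (Fin N)} (h : S ⊆ T) :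
    coordSpan K S ≤ coordSpan K T := Submodule.span_mono (Set.image_mono h)

theorem coordSpan_top_mono {K : Subgroup (Fin N → Circle)} {S T : Set (Fin N)} (h : S ⊆ T)
    (hS : coordSpan K S = ⊤) : coordSpan K T = ⊤ := top_le_iff.1 (hS ▸ coordSpan_mono K h)

theorem sum_smul_iotaStar_mem (K : Subgroup (Fin N → Circle)) {S : Set (Fin N)} {c : Fin N → ℝ}
    (hc : ∀ i, i ∉ S → c i = 0) : ∑ i, c i • iotaStar K i ∈ coordSpan K S := by
  refine Submodule.sum_mem _ fun i _ => ?_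
  by_cases hi : i ∈ S
  · exact Submodule.smul_mem _ _ (Submodule.subset_span ⟨i, hi, rfl⟩)
  · rw [hc i hi, zero_smul]
    exact Submodule.zero_mem _

theorem mem_coordSpan_iff {K : Subgroup (Fin N → Circle)} {S : Set (Fin N)} {v : kDual K} :
    v ∈ coordSpan K S ↔ ∃ c : Fin N → ℝ, (∀ i, i ∉ S → c i = 0) ∧ v = ∑ i, c i • iotaStar K i := by
  constructor
  · intro hv
    refine Submodule.span_induction ?_ ?_ ?_ ?_ hv
    · rintro _ ⟨i, hi, rfl⟩
      classical
      refine ⟨Pi.single i 1, fun l hl => Pi.single_eq_of_ne (by rintro rfl; exact hl hi) _, ?_⟩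
      simp [Pi.single_apply]
    · exact ⟨0, by simp, by simp⟩
    · rintro _ _ _ _ ⟨c, hc, rfl⟩ ⟨d, hd, rfl⟩
      refine ⟨c + d, fun i hi => by simp [hc i hi, hd i hi], ?_⟩
      simp [add_smul, Finset.sum_add_distrib]
    · rintro r _ _ ⟨c, hc, rfl⟩
      refine ⟨r • c, fun i hi => by simp [hc i hi], ?_⟩
      simp [mul_smul, Finset.smul_sum]
  · rintro ⟨c, hc, rfl⟩
    exact sum_smul_iotaStar_mem K hc

/-- Reflexivity of the finite-dimensional space `k`. Evaluation is injective because the coordinates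
`ι*u_i` separate points. -/
theorem exists_eval_of_dual (K : Subgroup (Fin N → Circle)) (f : Module.Dual ℝ (kDual K)) :
    ∃ X : lieAlg K, ∀ v : kDual K, f v = v X := by
  let ev : lieAlg K →ₗ[ℝ] Module.Dual ℝ (kDual K) :=
    { toFun := fun X =>
        { toFun := fun v => v X, map_add' := fun _ _ => rfl, map_smul' := fun _ _ => rfl }
      map_add' := fun X Y => by ext v; simp
      map_smul' := fun c X => by ext v; simp }
  have hinj : Function.Injective ev := by
    refine (injective_iff_map_eq_zero _).2 fun X hX => ?_
    ext i
    exact DFunLike.congr_fun hX (iotaStar K i)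
  have hfr : Module.finrank ℝ (lieAlg K) = Module.finrank ℝ (Module.Dual ℝ (kDual K)) := by
    rw [Subspace.dual_finrank_eq,
      ← (LinearMap.toContinuousLinearMap (𝕜 := ℝ) (E := lieAlg K) (F' := ℝ)).finrank_eq]
    exact Subspace.dual_finrank_eq.symm
  obtain ⟨X, hX⟩ := (LinearMap.injective_iff_surjective_of_finrank_eq_finrank hfr).1 hinj f
  exact ⟨X, fun v => by rw [← hX]; rfl⟩

/-- A subspace of `k*` is the annihilator of its annihilator in `k`. This translates spans of
weights into statements about isotropy algebras. -/
theorem mem_coordSpan_iff_forall {K : Subgroup (Fin N → Circle)} {S : Set (Fin N)} {v : kDual K} :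
    v ∈ coordSpan K S ↔ ∀ X : lieAlg K, (∀ i ∈ S, X.1 i = 0) → v X = 0 := by
  constructor
  · intro hv X hX
    obtain ⟨c, hc, rfl⟩ := mem_coordSpan_iff.1 hv
    rw [sum_apply]
    refine Finset.sum_eq_zero fun i _ => ?_
    by_cases hi : i ∈ S
    · simp [iotaStar_apply, hX i hi]
    · simp [hc i hi]
  · intro h
    by_contra hv
    obtain ⟨f, hf, hfv⟩ := Submodule.exists_le_ker_of_notMem hv
    obtain ⟨X, hX⟩ := exists_eval_of_dual K f
    refine hf ?_
    rw [hX]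
    refine h X fun i hi => ?_
    rw [← iotaStar_apply, ← hX]
    exact hfv (Submodule.subset_span ⟨i, hi, rfl⟩)

theorem coordSpan_eq_top_iff {K : Subgroup (Fin N → Circle)} {S : Set (Fin N)} :
    coordSpan K S = ⊤ ↔ ∀ X : lieAlg K, (∀ i ∈ S, X.1 i = 0) → X = 0 := by
  constructor
  · intro h X hX
    ext i
    exact mem_coordSpan_iff_forall.1 (h ▸ Submodule.mem_top : iotaStar K i ∈ coordSpan K S) X hX
  · intro h
    refine eq_top_iff.2 fun v _ => mem_coordSpan_iff_forall.2 fun X hX => ?_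
    rw [h X hX, map_zero]

theorem coordSpan_univ (K : Subgroup (Fin N → Circle)) : coordSpan K Set.univ = ⊤ :=
  coordSpan_eq_top_iff.2 fun X hX => by ext i; exact hX i trivial

/-! ### Regular values -/

/-- The set of the nonzero quaternionic coordinates of a point. -/
def coordSupport (ξ : HN N) : Set (Fin N) := {i | ξ i ≠ 0}

/-- The derivative of the moment map. -/
def momentDeriv (K : Subgroup (Fin N → Circle)) (ξ : HN N) : HN N →L[ℝ] Param K :=
  ContinuousLinearMap.pi fun j => ∑ i, (((2 : ℝ) • momentBilin j (ξ i)).comp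
    (ContinuousLinearMap.proj (R := ℝ) (φ := fun _ : Fin N => Quaternion ℝ) i)).smulRight
      (iotaStar K i)

theorem momentDeriv_apply (K : Subgroup (Fin N → Circle)) (ξ h : HN N) (j : Fin 3) :
    momentDeriv K ξ h j = ∑ i, (2 * momentBilin j (ξ i) (h i)) • iotaStar K i := by
  simp [momentDeriv]

theorem hasFDerivAt_momentMap (K : Subgroup (Fin N → Circle)) (ξ : HN N) :
    HasFDerivAt (momentMap K) (momentDeriv K ξ) ξ := by
  refine hasFDerivAt_pi.2 fun j => ?_
  have h : ∀ i ∈ (Finset.univ : Finset (Fin N)), HasFDerivAt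
      (fun η : HN N => momentCoord (η i) j • iotaStar K i)
      ((((2 : ℝ) • momentBilin j (ξ i)).comp
        (ContinuousLinearMap.proj (R := ℝ) (φ := fun _ : Fin N => Quaternion ℝ) i)).smulRight
          (iotaStar K i)) ξ := by
    intro i _
    have h1 : HasFDerivAt (fun η : HN N => η i)
        (ContinuousLinearMap.proj (R := ℝ) (φ := fun _ : Fin N => Quaternion ℝ) i) ξ :=
      hasFDerivAt_apply i ξ
    have h2 := (momentBilin j).hasFDerivAt_of_bilinear h1 h1
    simp only [momentCoord_eq_bilin]
    refine (h2.congr_fderiv ?_).smul_const (iotaStar K i)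
    ext v
    simp [momentBilin_comm j (v i) (ξ i)]
    ring
  exact HasFDerivAt.fun_sum h

theorem contDiff_momentMap (K : Subgroup (Fin N → Circle)) : ContDiff ℝ ∞ (momentMap K) := by
  refine contDiff_pi.2 fun j => ?_
  simp only [momentMap, momentCoord_eq_bilin]
  refine ContDiff.sum fun i _ => ContDiff.fun_smul ?_ contDiff_const
  have : ContDiff ℝ ∞ fun ξ : HN N => ξ i := contDiff_apply ℝ (Quaternion ℝ) i
  exact ((momentBilin j).contDiff.comp this).clm_apply this

/-- A zero coordinate contributes nothing to the derivative, while at a nonzero one the three linear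
forms take arbitrary values independently. The image is therefore the span of the weights in the
support, once for each of the three components. -/
theorem momentDeriv_surjective_iff (K : Subgroup (Fin N → Circle)) (ξ : HN N) :
    Function.Surjective (momentDeriv K ξ) ↔ coordSpan K (coordSupport ξ) = ⊤ := by
  constructor
  · intro h
    refine eq_top_iff.2 fun v _ => ?_
    obtain ⟨η, hη⟩ := h fun _ => v
    rw [← congrFun hη 0, momentDeriv_apply]
    refine sum_smul_iotaStar_mem K fun i hi => ?_
    have : ξ i = 0 := not_not.1 hi
    simp [this]
  · intro h a
    have h1 : ∀ j, ∃ c : Fin N → ℝ, (∀ i, i ∉ coordSupport ξ → c i = 0) ∧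
        a j = ∑ i, c i • iotaStar K i := fun j =>
      mem_coordSpan_iff.1 (h ▸ Submodule.mem_top)
    choose c hc hac using h1
    have h2 : ∀ i, ∃ q : Quaternion ℝ, ∀ j, momentBilin j (ξ i) q = c j i / 2 := by
      intro i
      by_cases hi : ξ i = 0
      · exact ⟨0, fun j => by simp [hc j i (not_not.2 hi)]⟩
      · exact exists_momentBilin_eq hi fun j => c j i / 2
    choose η hη using h2
    refine ⟨η, funext fun j => ?_⟩
    rw [momentDeriv_apply, hac]
    refine Finset.sum_congr rfl fun i _ => ?_
    rw [hη, mul_div_cancel₀ _ two_ne_zero]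

theorem momentMap_mem_coordSpan (K : Subgroup (Fin N → Circle)) (ξ : HN N) (j : Fin 3) :
    momentMap K ξ j ∈ coordSpan K (coordSupport ξ) := by
  refine sum_smul_iotaStar_mem K fun i hi => ?_
  have : ξ i = 0 := not_not.1 hi
  rw [this, momentCoord_eq_bilin]
  simp

/-- The moment map of each circle is onto `ℝ³`, so the three coefficients of a weight can be
prescribed together by one quaternion. -/
theorem exists_momentMap_eq {K : Subgroup (Fin N → Circle)} {S : Set (Fin N)} {a : Param K}
    (h : ∀ j, a j ∈ coordSpan K S) : ∃ ξ : HN N, coordSupport ξ ⊆ S ∧ momentMap K ξ = a := by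
  choose c hc hac using fun j => mem_coordSpan_iff.1 (h j)
  have h2 : ∀ i, ∃ q : Quaternion ℝ, (i ∉ S → q = 0) ∧ momentCoord q = fun j => c j i := by
    intro i
    by_cases hi : i ∈ S
    · obtain ⟨q, hq⟩ := exists_momentCoord_eq fun j => c j i
      exact ⟨q, fun h => absurd hi h, hq⟩
    · refine ⟨0, fun _ => rfl, funext fun j => ?_⟩
      rw [hc j i hi, momentCoord_eq_bilin]
      simp
  choose ξ hξ hξc using h2
  refine ⟨ξ, fun i hi => by_contra fun h => hi (hξ i h), funext fun j => ?_⟩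
  rw [hac]
  exact Finset.sum_congr rfl fun i _ => by rw [hξc]

/-- A parameter is regular if and only if it lies in no proper coordinate subspace. -/
theorem mem_regularValues_iff {K : Subgroup (Fin N → Circle)} {a : Param K} :
    a ∈ regularValues K ↔
      ∀ S : Set (Fin N), (∀ j, a j ∈ coordSpan K S) → coordSpan K S = ⊤ := by
  constructor
  · intro ha S hS
    -- Regularity is tested at a point of the fibre supported in `S`: its support spans, hence so
    -- does `S`.
    obtain ⟨ξ, hξ, hξa⟩ := exists_momentMap_eq hS
    have := ha ξ hξa
    rw [(hasFDerivAt_momentMap K ξ).fderiv, momentDeriv_surjective_iff] at this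
    exact coordSpan_top_mono hξ this
  · intro h ξ hξ
    rw [(hasFDerivAt_momentMap K ξ).fderiv, momentDeriv_surjective_iff]
    exact h _ fun j => hξ ▸ momentMap_mem_coordSpan K ξ j

theorem coordSpan_coordSupport_of_regular {K : Subgroup (Fin N → Circle)} {a : Param K}
    (ha : a ∈ regularValues K) {ξ : HN N} (hξ : momentMap K ξ = a) :
    coordSpan K (coordSupport ξ) = ⊤ :=
  mem_regularValues_iff.1 ha _ fun j => hξ ▸ momentMap_mem_coordSpan K ξ j

theorem quaternion_mul_circle_eq_iff {q : Quaternion ℝ} (hq : q ≠ 0) (ζ : Circle) :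
    q * ((ζ : ℂ) : Quaternion ℝ) = q ↔ ζ = 1 := by
  constructor
  · intro h
    have h1 : ((ζ : ℂ) : Quaternion ℝ) = 1 := mul_left_cancel₀ hq (by rw [h, mul_one])
    have h2 : (ζ : ℂ) = 1 := by
      apply Complex.ext
      · have := congrArg (fun q : Quaternion ℝ => q.re) h1
        simp only [Quaternion.re_coeComplex] at this
        exact this
      · have := congrArg (fun q : Quaternion ℝ => q.imI) h1
        simp only [Quaternion.imI_coeComplex] at this
        exact this
    exact Circle.coe_eq_one.1 h2
  · rintro rfl
    simp

theorem mem_isotropy_iff {K : Subgroup (Fin N → Circle)} {ξ : HN N} {ζ : Fin N → Circle} :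
    ζ ∈ isotropy K ξ ↔ ζ ∈ K ∧ ∀ i ∈ coordSupport ξ, ζ i = 1 := by
  refine and_congr_right fun _ => ?_
  rw [funext_iff]
  refine forall_congr' fun i => ?_
  by_cases hi : ξ i = 0
  · simp [torusAct, coordSupport, hi]
  · simp only [torusAct, quaternion_mul_circle_eq_iff hi]
    simp [coordSupport, hi]

theorem eq_zero_of_forall_circleExp {x : ℝ} (h : ∀ t : ℝ, Circle.exp (2 * Real.pi * (t * x)) = 1) :
    x = 0 := by
  by_contra hx
  -- This value of `t` gives `exp(√-1 π) = -1 ≠ 1`.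
  have h1 := h (1 / (2 * x))
  have h2 : 2 * Real.pi * (1 / (2 * x) * x) = Real.pi := by field_simp
  rw [h2] at h1
  have h3 := congrArg (fun c : Circle => (c : ℂ)) h1
  simp at h3
  norm_num at h3

/-- The subgroup of `K` fixing the coordinates in `S`. -/
def coordStab (K : Subgroup (Fin N → Circle)) (S : Set (Fin N)) : Subgroup (Fin N → Circle) where
  carrier := {ζ | ζ ∈ K ∧ ∀ i ∈ S, ζ i = 1}
  one_mem' := ⟨K.one_mem, fun _ _ => rfl⟩
  mul_mem' := fun hζ hη => ⟨K.mul_mem hζ.1 hη.1, fun i hi => by simp [hζ.2 i hi, hη.2 i hi]⟩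
  inv_mem' := fun hζ => ⟨K.inv_mem hζ.1, fun i hi => by simp [hζ.2 i hi]⟩

theorem mem_lieAlg_coordStab {K : Subgroup (Fin N → Circle)} {S : Set (Fin N)} {X : Fin N → ℝ} :
    X ∈ lieAlg (coordStab K S) ↔ X ∈ lieAlg K ∧ ∀ i ∈ S, X i = 0 := by
  constructor
  · intro h
    refine ⟨fun t => (h t).1, fun i hi => eq_zero_of_forall_circleExp fun t => ?_⟩
    exact (h t).2 i hi
  · rintro ⟨h1, h2⟩ t
    refine ⟨h1 t, fun i hi => ?_⟩
    simp [torusExp, h2 i hi]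

theorem isotropy_eq_coordStab (K : Subgroup (Fin N → Circle)) (ξ : HN N) :
    isotropy K ξ = coordStab K (coordSupport ξ) := by
  ext ζ
  exact mem_isotropy_iff

theorem mem_wall_isotropy_iff {K : Subgroup (Fin N → Circle)} {ξ : HN N} {v : kDual K} :
    v ∈ wall K (isotropy K ξ) ↔ v ∈ coordSpan K (coordSupport ξ) := by
  rw [mem_coordSpan_iff_forall, isotropy_eq_coordStab]
  refine forall_congr' fun X => imp_congr_left ?_
  rw [mem_lieAlg_coordStab]
  exact and_iff_right X.2

/-- The set of regular values is the complement of the union of the walls. -/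
theorem regularValues_eq (K : Subgroup (Fin N → Circle)) :
    regularValues K =
      Set.univ \ ⋃ H ∈ oneDimIsotropy K, {a : Param K | ∀ j, a j ∈ wall K H} := by
  ext a
  simp only [Set.mem_sdiff, Set.mem_univ, true_and, Set.mem_iUnion, not_exists]
  constructor
  · rintro ha _ ⟨⟨ξ, rfl⟩, h1⟩ haw
    -- If a regular parameter lay on the wall, the support of `ξ` would span `k*`, and the isotropy
    -- algebra would be zero instead of a line.
    have htop := mem_regularValues_iff.1 ha _ fun j => mem_wall_isotropy_iff.1 (haw j)
    obtain ⟨⟨X, hX2⟩, hX⟩ := Module.finrank_pos_iff_exists_ne_zero.1 (h1.symm ▸ one_pos)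
    rw [isotropy_eq_coordStab, mem_lieAlg_coordStab] at hX2
    have := coordSpan_eq_top_iff.1 htop ⟨X, hX2.1⟩ hX2.2
    exact hX (Subtype.ext (congrArg (fun Y => Y.1) this))
  · intro h
    by_contra ha
    rw [mem_regularValues_iff] at ha
    push Not at ha
    obtain ⟨S, haS, hS⟩ := ha
    -- Enlarging `S` to a maximal non-spanning set turns its span into a hyperplane, which is a
    -- wall.
    obtain ⟨T, hST, hT⟩ : ∃ T, S ⊆ T ∧ Maximal (fun T => coordSpan K T ≠ ⊤) T :=
      (Set.toFinite {T : Set (Fin N) | coordSpan K T ≠ ⊤}).exists_le_maximal hS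
    classical
    obtain ⟨i, hi⟩ : ∃ i, i ∉ T := by
      by_contra hc
      push Not at hc
      rw [Set.eq_univ_of_forall hc] at hT
      exact hT.prop (coordSpan_univ K)
    -- By maximality the weights in `T` together with `ι*u_i` span, so an element of the annihilator
    -- of `T` is determined by its `i`-th coordinate. The annihilator is thus at most a line.
    have hTi : ∀ X : lieAlg K, (∀ l ∈ T, X.1 l = 0) → X.1 i = 0 → X = 0 := by
      have h1 : coordSpan K (insert i T) = ⊤ := by
        by_contra hc
        exact hi (hT.le_of_ge (y := insert i T) hc (Set.subset_insert i T) (Set.mem_insert i T))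
      intro X hX hXi
      refine coordSpan_eq_top_iff.1 h1 X ?_
      rintro l (rfl | hl)
      exacts [hXi, hX l hl]
    obtain ⟨X, hXT, hX0⟩ : ∃ X : lieAlg K, (∀ l ∈ T, X.1 l = 0) ∧ X ≠ 0 := by
      have := hT.prop
      rw [Ne, coordSpan_eq_top_iff] at this
      push Not at this
      exact this
    -- A point with support exactly `T`; the Lie algebra of its isotropy group is the annihilator of
    -- `T`.
    let ξ : HN N := fun l => if l ∈ T then 1 else 0
    have hξ : coordSupport ξ = T := by
      ext l
      simp [coordSupport, ξ]
    refine h (isotropy K ξ) ⟨⟨ξ, rfl⟩, ?_⟩ fun j => ?_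
    · rw [isotropy_eq_coordStab, hξ]
      have hXi : X.1 i ≠ 0 := fun hc => hX0 (hTi X hXT hc)
      refine finrank_eq_one_iff'.2 ⟨⟨X.1, mem_lieAlg_coordStab.2 ⟨X.2, hXT⟩⟩, ?_, ?_⟩
      · intro hc
        exact hX0 (Subtype.ext (congrArg (fun Y => Y.1) hc))
      · rintro ⟨Y, hY⟩
        rw [mem_lieAlg_coordStab] at hY
        refine ⟨Y i / X.1 i, Subtype.ext ?_⟩
        have := hTi ((Y i / X.1 i) • X - ⟨Y, hY.1⟩) (fun l hl => by simp [hXT l hl, hY.2 l hl])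
          (by simp [hXi])
        exact congrArg (fun Y => Y.1) (sub_eq_zero.1 this)
    · rw [mem_wall_isotropy_iff, hξ]
      exact coordSpan_mono K hST (haS j)

/-! ### The orbits of the complexified torus -/

/-- The action of `Exp(√-1 Y)` on `ℍᴺ` which is holomorphic for `I_j`. -/
def scaleAct (j : Fin 3) (Y : Fin N → ℝ) (ξ : HN N) : HN N := fun i => scaleQ j (Y i) (ξ i)

theorem scaleAct_scaleAct (j : Fin 3) (X Y : Fin N → ℝ) (ξ : HN N) :
    scaleAct j X (scaleAct j Y ξ) = scaleAct j (X + Y) ξ :=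
  funext fun i => scaleQ_scaleQ j (X i) (Y i) (ξ i)

theorem scaleAct_zero (j : Fin 3) (ξ : HN N) : scaleAct j 0 ξ = ξ :=
  funext fun i => scaleQ_zero j (ξ i)

theorem scaleAct_torusAct (j : Fin 3) (Y : Fin N → ℝ) (κ : Fin N → Circle) (ξ : HN N) :
    scaleAct j Y (torusAct κ ξ) = torusAct κ (scaleAct j Y ξ) :=
  funext fun i => scaleQ_mul_complex j (Y i) (ξ i) (κ i)

theorem complexAct_eq (j : Fin 3) {ζ : Fin N → ℂ} {κ : Fin N → Circle} {X : Fin N → ℝ}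
    (h : ∀ i, ζ i = κ i * Real.exp (-2 * Real.pi * X i)) (ξ : HN N) :
    complexAct j ζ ξ = torusAct κ (scaleAct j X ξ) := by
  have hc : ∀ (q : Quaternion ℝ) (r : ℝ) (c : ℂ),
      q * ((c * (r : ℂ) : ℂ) : Quaternion ℝ) = (r • q) * (c : Quaternion ℝ) := by
    intro q r c
    ext <;> simp <;> ring
  funext i
  have h1 : (starRingEnd ℂ (ζ i))⁻¹ = (κ i : ℂ) * (Real.exp (2 * Real.pi * X i) : ℝ) := by
    rw [h i, map_mul, mul_inv, Complex.conj_ofReal, ← Circle.coe_inv_eq_conj, Circle.coe_inv,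
      inv_inv, ← Complex.ofReal_inv, ← Real.exp_neg]
    congr 4
    ring
  rw [complexAct, h1, h i, hc, hc, ← add_mul]
  rfl

theorem mem_complexOrbit_iff {K : Subgroup (Fin N → Circle)} {j : Fin 3} {ξ η : HN N} :
    η ∈ complexOrbit K j ξ ↔ ∃ κ ∈ K, ∃ X ∈ lieAlg K, η = torusAct κ (scaleAct j X ξ) := by
  constructor
  · rintro ⟨ζ, ⟨κ, hκ, X, hX, h⟩, rfl⟩
    exact ⟨κ, hκ, X, hX, complexAct_eq j h ξ⟩
  · rintro ⟨κ, hκ, X, hX, rfl⟩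
    exact ⟨_, ⟨κ, hκ, X, hX, fun _ => rfl⟩, (complexAct_eq j (fun _ => rfl) ξ).symm⟩

theorem scaleAct_mem_complexOrbit {K : Subgroup (Fin N → Circle)} (j : Fin 3) {X : Fin N → ℝ}
    (hX : X ∈ lieAlg K) (ξ : HN N) : scaleAct j X ξ ∈ complexOrbit K j ξ :=
  mem_complexOrbit_iff.2 ⟨1, K.one_mem, X, hX, (torusAct_one _).symm⟩

theorem complexOrbit_trans {K : Subgroup (Fin N → Circle)} {j : Fin 3} {ξ η θ : HN N}
    (h : η ∈ complexOrbit K j ξ) (h' : θ ∈ complexOrbit K j η) : θ ∈ complexOrbit K j ξ := by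
  obtain ⟨κ, hκ, X, hX, rfl⟩ := mem_complexOrbit_iff.1 h
  obtain ⟨κ', hκ', X', hX', rfl⟩ := mem_complexOrbit_iff.1 h'
  refine mem_complexOrbit_iff.2 ⟨κ * κ', K.mul_mem hκ hκ', X' + X, Submodule.add_mem _ hX' hX, ?_⟩
  rw [scaleAct_torusAct, scaleAct_scaleAct, torusAct_mul]

theorem complexOrbit_symm {K : Subgroup (Fin N → Circle)} {j : Fin 3} {ξ η : HN N}
    (h : η ∈ complexOrbit K j ξ) : ξ ∈ complexOrbit K j η := by
  obtain ⟨κ, hκ, X, hX, rfl⟩ := mem_complexOrbit_iff.1 h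
  refine mem_complexOrbit_iff.2 ⟨κ⁻¹, K.inv_mem hκ, -X, Submodule.neg_mem _ hX, ?_⟩
  rw [scaleAct_torusAct, scaleAct_scaleAct, ← torusAct_mul, neg_add_cancel, scaleAct_zero,
    mul_inv_cancel, torusAct_one]

theorem norm_mul_circle (q : Quaternion ℝ) (ζ : Circle) :
    ‖q * ((ζ : ℂ) : Quaternion ℝ)‖ = ‖q‖ := by
  have h : ‖((ζ : ℂ) : Quaternion ℝ)‖ ^ 2 = 1 := by
    have h1 := Circle.normSq_coe ζ
    rw [Complex.normSq_apply] at h1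
    rw [quaternion_norm_sq]
    simp
    linarith
  rw [norm_mul, (pow_eq_one_iff_of_nonneg (norm_nonneg _) two_ne_zero).1 h, mul_one]

theorem momentMap_torusAct (K : Subgroup (Fin N → Circle)) (κ : Fin N → Circle) (ξ : HN N) :
    momentMap K (torusAct κ ξ) = momentMap K ξ := by
  funext j
  refine Finset.sum_congr rfl fun i _ => ?_
  rw [momentCoord_eq, momentCoord_eq, torusAct, zPart_mul_complex, wPart_mul_complex,
    norm_mul_circle, norm_mul_circle]

theorem momentMap_scaleAct_of_ne (K : Subgroup (Fin N → Circle)) {j l : Fin 3} (h : l ≠ j)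
    (Y : Fin N → ℝ) (ξ : HN N) : momentMap K (scaleAct j Y ξ) l = momentMap K ξ l :=
  Finset.sum_congr rfl fun i _ => by rw [scaleAct, momentCoord_scaleQ_of_ne h]

theorem momentMap_of_mem_complexOrbit {K : Subgroup (Fin N → Circle)} {j l : Fin 3} (h : l ≠ j)
    {ξ η : HN N} (hη : η ∈ complexOrbit K j ξ) : momentMap K η l = momentMap K ξ l := by
  obtain ⟨κ, -, X, -, rfl⟩ := mem_complexOrbit_iff.1 hη
  rw [momentMap_torusAct, momentMap_scaleAct_of_ne K h]

theorem scaleQ_eq_zero_iff {j : Fin 3} {y : ℝ} {q : Quaternion ℝ} : scaleQ j y q = 0 ↔ q = 0 := by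
  constructor
  · intro h
    rw [← scaleQ_zero j q, ← neg_add_cancel y, ← scaleQ_scaleQ, h]
    simp [scaleQ, zPart, wPart]
  · rintro rfl
    simp [scaleQ, zPart, wPart]

theorem coordSupport_scaleAct (j : Fin 3) (Y : Fin N → ℝ) (ξ : HN N) :
    coordSupport (scaleAct j Y ξ) = coordSupport ξ :=
  Set.ext fun _ => scaleQ_eq_zero_iff.not

theorem coe_circle_ne_zero (ζ : Circle) : ((ζ : ℂ) : Quaternion ℝ) ≠ 0 := by
  rw [← norm_ne_zero_iff, ← one_mul ((ζ : ℂ) : Quaternion ℝ), norm_mul_circle]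
  simp

theorem coordSupport_torusAct (κ : Fin N → Circle) (ξ : HN N) :
    coordSupport (torusAct κ ξ) = coordSupport ξ :=
  Set.ext fun i => not_congr (by simp [torusAct, coe_circle_ne_zero])

/-! ### Semistable points -/

/-- The coefficients `c` are admissible for `ξ`: `∑ c_i ι*u_i` lies in the cone of `ξ`. -/
def IsConeCoeff (j : Fin 3) (ξ : HN N) (c : Fin N → ℝ) : Prop :=
  ∀ i, (0 < c i → zPart j (ξ i) ≠ 0) ∧ (c i < 0 → wPart j (ξ i) ≠ 0)

/-- The norms only matter through their vanishing, so each pair of nonnegative coefficients can be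
merged into one real coefficient whose sign is constrained by the nonzero parts of `ξ i`. -/
theorem mem_semistable_iff {K : Subgroup (Fin N → Circle)} {j : Fin 3} {a : Param K} {ξ : HN N} :
    ξ ∈ semistable K j a ↔ (∀ l, l ≠ j → momentMap K ξ l = a l) ∧
      ∃ c, IsConeCoeff j ξ c ∧ a j = ∑ i, c i • iotaStar K i := by
  refine and_congr_right fun _ => ⟨?_, ?_⟩
  · rintro ⟨s, t, hs, ht, h⟩
    refine ⟨fun i => s i * ‖zPart j (ξ i)‖ ^ 2 - t i * ‖wPart j (ξ i)‖ ^ 2, fun i => ⟨?_, ?_⟩, ?_⟩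
    · intro h1 h2
      have := mul_nonneg (ht i) (sq_nonneg ‖wPart j (ξ i)‖)
      simp [h2] at h1
      linarith
    · intro h1 h2
      have := mul_nonneg (hs i) (sq_nonneg ‖zPart j (ξ i)‖)
      simp [h2] at h1
      linarith
    · rw [h, ← Finset.sum_add_distrib]
      refine Finset.sum_congr rfl fun i _ => ?_
      module
  · rintro ⟨c, hc, h⟩
    -- The positive part of `c i` goes to `z` and the negative part to `w`. Where the denominator is
    -- zero the sign condition makes the numerator zero too.
    refine ⟨fun i => max (c i) 0 / ‖zPart j (ξ i)‖ ^ 2, fun i => max (-c i) 0 / ‖wPart j (ξ i)‖ ^ 2,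
      fun i => by positivity, fun i => by positivity, ?_⟩
    rw [h, ← Finset.sum_add_distrib]
    refine Finset.sum_congr rfl fun i _ => ?_
    have h1 : max (c i) 0 / ‖zPart j (ξ i)‖ ^ 2 * ‖zPart j (ξ i)‖ ^ 2 = max (c i) 0 := by
      by_cases hi : 0 < c i
      · have := norm_ne_zero_iff.2 ((hc i).1 hi)
        field_simp
      · simp [max_eq_right (not_lt.1 hi)]
    have h2 : max (-c i) 0 / ‖wPart j (ξ i)‖ ^ 2 * ‖wPart j (ξ i)‖ ^ 2 = max (-c i) 0 := by
      by_cases hi : c i < 0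
      · have := norm_ne_zero_iff.2 ((hc i).2 hi)
        field_simp
      · simp [not_lt.1 hi]
    rw [h1, h2, smul_neg, ← sub_eq_add_neg, ← sub_smul]
    congr 1
    rcases le_total (c i) 0 with h3 | h3
    · rw [max_eq_right h3, max_eq_left (by linarith)]; ring
    · rw [max_eq_left h3, max_eq_right (by linarith)]; ring

theorem isConeCoeff_of_mem_complexOrbit {K : Subgroup (Fin N → Circle)} {j : Fin 3} {ξ η : HN N}
    (h : η ∈ complexOrbit K j ξ) {c : Fin N → ℝ} (hc : IsConeCoeff j ξ c) : IsConeCoeff j η c := by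
  obtain ⟨κ, -, X, -, rfl⟩ := mem_complexOrbit_iff.1 h
  intro i
  simp only [torusAct, scaleAct, zPart_mul_complex, wPart_mul_complex, zPart_scaleQ, wPart_scaleQ]
  simpa [coe_circle_ne_zero] using hc i

theorem mem_semistable_of_mem_complexOrbit {K : Subgroup (Fin N → Circle)} {j : Fin 3}
    {a : Param K} {ξ η : HN N} (h : η ∈ complexOrbit K j ξ) (hξ : ξ ∈ semistable K j a) :
    η ∈ semistable K j a := by
  rw [mem_semistable_iff] at hξ ⊢
  obtain ⟨h1, c, hc, hac⟩ := hξ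
  exact ⟨fun l hl => by rw [momentMap_of_mem_complexOrbit hl h, h1 l hl], c,
    isConeCoeff_of_mem_complexOrbit h hc, hac⟩

/-- For a regular parameter, the coefficients of a semistable point span `k*`. -/
theorem coordSpan_of_semistable {K : Subgroup (Fin N → Circle)} {j : Fin 3} {a : Param K}
    (ha : a ∈ regularValues K) {ξ : HN N} (h1 : ∀ l, l ≠ j → momentMap K ξ l = a l)
    {c : Fin N → ℝ} (hc : a j = ∑ i, c i • iotaStar K i) :
    coordSpan K {i | c i ≠ 0 ∨ (zPart j (ξ i) ≠ 0 ∧ wPart j (ξ i) ≠ 0)} = ⊤ := by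
  refine mem_regularValues_iff.1 ha _ fun l => ?_
  by_cases hl : l = j
  · rw [hl, hc]
    refine sum_smul_iotaStar_mem K fun i hi => ?_
    by_contra h
    exact hi (Or.inl h)
  · rw [← h1 l hl]
    -- For `l ≠ j` an index contributes to `μ_l` only if both parts of `ξ i` are nonzero.
    refine sum_smul_iotaStar_mem K fun i hi => momentCoord_eq_zero hl ?_
    simp only [Set.mem_ofPred_eq, not_or, not_and_or, not_not] at hi
    exact hi.2

theorem coordSpan_coordSupport_of_cone {K : Subgroup (Fin N → Circle)} {j : Fin 3} {ξ : HN N}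
    {c : Fin N → ℝ} (hc : IsConeCoeff j ξ c)
    (hs : coordSpan K {i | c i ≠ 0 ∨ (zPart j (ξ i) ≠ 0 ∧ wPart j (ξ i) ≠ 0)} = ⊤) :
    coordSpan K (coordSupport ξ) = ⊤ := by
  refine coordSpan_top_mono ?_ hs
  intro i hi h0
  have hz : zPart j (ξ i) = 0 := by rw [h0]; simp [zPart]
  have hw : wPart j (ξ i) = 0 := by rw [h0]; simp [wPart]
  rcases hi with h | h
  · rcases lt_or_gt_of_ne h with h | h
    exacts [(hc i).2 h hw, (hc i).1 h hz]
  · exact h.1 hz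

/-! ### The gradient equation -/

theorem exists_mul_sub_le_mul_exp {A M : ℝ} (hA : 0 < A) (hM : 0 ≤ M) :
    ∃ C, ∀ x, M * x - C ≤ A * Real.exp x := by
  rcases hM.eq_or_lt with rfl | hM
  · exact ⟨0, fun x => by simp; positivity⟩
  -- The bound compares `A e^x` with its tangent line of slope `M`, which touches at `x = log (M /
  -- A)`.
  · refine ⟨M * Real.log (M / A), fun x => ?_⟩
    have h1 := Real.add_one_le_exp (x - Real.log (M / A))
    have h2 : A * Real.exp x = M * Real.exp (x - Real.log (M / A)) := by
      rw [Real.exp_sub, Real.exp_log (by positivity)]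
      field_simp
    rw [h2]
    nlinarith

/-- The one-variable summand of the function minimized on a complexified orbit. -/
def energyTerm (A B c y : ℝ) : ℝ :=
  (A * Real.exp (-4 * Real.pi * y) + B * Real.exp (4 * Real.pi * y)) / 4 + c * y

theorem hasDerivAt_energyTerm (A B c y : ℝ) : HasDerivAt (energyTerm A B c)
    (c - Real.pi * (Real.exp (-4 * Real.pi * y) * A - Real.exp (4 * Real.pi * y) * B)) y := by
  have h1 : ∀ k : ℝ, HasDerivAt (fun y => Real.exp (k * y)) (Real.exp (k * y) * k) y := fun k => by
    simpa using ((hasDerivAt_id y).const_mul k).exp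
  have h2 := ((((h1 (-4 * Real.pi)).const_mul A).add ((h1 (4 * Real.pi)).const_mul B)).div_const
    4).add ((hasDerivAt_id y).const_mul c)
  refine h2.congr_deriv ?_
  ring

/-- Properness in one variable. For `c ≠ 0` the linear term grows in one direction, and the sign
condition supplies a growing exponential in the other. For `c = 0` both exponentials are needed;
otherwise `δ = 0`, which only says that the term is bounded below. -/
theorem exists_linear_le_energyTerm {A B c : ℝ} (hA : 0 ≤ A) (hB : 0 ≤ B) (hcA : 0 < c → 0 < A)
    (hcB : c < 0 → 0 < B) :
    ∃ δ C : ℝ, 0 ≤ δ ∧ (c ≠ 0 ∨ (0 < A ∧ 0 < B) → 0 < δ) ∧ ∀ y, δ * |y| - C ≤ energyTerm A B c y := by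
  have hpi := Real.pi_pos
  have key : ∀ {A : ℝ} (_ : 0 < A) {M : ℝ} (_ : 0 ≤ M), ∃ C, 0 ≤ C ∧ ∀ y,
      M * y - C ≤ A * Real.exp (4 * Real.pi * y) / 4 := by
    intro A hA M hM
    obtain ⟨C, hC⟩ := exists_mul_sub_le_mul_exp (A := A / 4) (M := M / (4 * Real.pi))
      (by positivity) (by positivity)
    refine ⟨max C 0, le_max_right _ _, fun y => ?_⟩
    have h1 := hC (4 * Real.pi * y)
    have h2 : M / (4 * Real.pi) * (4 * Real.pi * y) = M * y := by field_simp
    rw [h2] at h1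
    have := le_max_left C 0
    linarith
  have hAe : ∀ y, 0 ≤ A * Real.exp (-4 * Real.pi * y) := fun y => by positivity
  have hBe : ∀ y, 0 ≤ B * Real.exp (4 * Real.pi * y) := fun y => by positivity
  have hneg : ∀ y, Real.exp (-4 * Real.pi * y) = Real.exp (4 * Real.pi * -y) := fun y => by
    congr 1; ring
  rcases lt_trichotomy c 0 with hc | rfl | hc
  -- Slope `2|c|`: one `|c|` cancels the decreasing linear term, the other remains as `δ`.
  · obtain ⟨C, hC0, hC⟩ := key (hcB hc) (M := -2 * c) (by linarith)
    refine ⟨-c, C, by linarith, fun _ => by linarith, fun y => ?_⟩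
    have h1 := hC y
    have h2 := hAe y
    have h3 := hBe y
    rw [energyTerm]
    rcases abs_cases y with ⟨h, h'⟩ | ⟨h, h'⟩ <;> rw [h] <;> linarith
  · by_cases hAB : 0 < A ∧ 0 < B
    · obtain ⟨C, hC0, hC⟩ := key hAB.1 (M := 1) zero_le_one
      obtain ⟨D, hD0, hD⟩ := key hAB.2 (M := 1) zero_le_one
      refine ⟨1, C + D, zero_le_one, fun _ => one_pos, fun y => ?_⟩
      have h1 := hC (-y)
      have h1' := hD y
      have h2 := hAe y
      have h3 := hBe y
      rw [← hneg] at h1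
      rw [energyTerm]
      rcases abs_cases y with ⟨h, h'⟩ | ⟨h, h'⟩ <;> rw [h] <;> linarith
    · refine ⟨0, 0, le_rfl, fun h => ?_, fun y => ?_⟩
      · simp [hAB] at h
      · have h2 := hAe y
        have h3 := hBe y
        rw [energyTerm]
        linarith
  · obtain ⟨C, hC0, hC⟩ := key (hcA hc) (M := 2 * c) (by linarith)
    refine ⟨c, C, hc.le, fun _ => hc, fun y => ?_⟩
    have h1 := hC (-y)
    have h2 := hAe y
    have h3 := hBe y
    rw [← hneg] at h1
    rw [energyTerm]
    rcases abs_cases y with ⟨h, h'⟩ | ⟨h, h'⟩ <;> rw [h] <;> linarith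

/-- Every stable `K_ℂ`-orbit meets the level set of the moment map `μ_j`. -/
theorem exists_momentMap_scaleAct_eq {K : Subgroup (Fin N → Circle)} {j : Fin 3} {ξ : HN N}
    {c : Fin N → ℝ} (hc : IsConeCoeff j ξ c)
    (hs : coordSpan K {i | c i ≠ 0 ∨ (zPart j (ξ i) ≠ 0 ∧ wPart j (ξ i) ≠ 0)} = ⊤) :
    ∃ Y : lieAlg K, momentMap K (scaleAct j Y ξ) j = ∑ i, c i • iotaStar K i := by
  have hpos : ∀ q : Quaternion ℝ, q ≠ 0 ↔ 0 < ‖q‖ ^ 2 := fun q =>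
    ⟨fun h => by positivity, fun h h0 => by simp [h0] at h⟩
  have h1 : ∀ i, ∃ δ C : ℝ, 0 ≤ δ ∧
      (c i ≠ 0 ∨ (0 < ‖zPart j (ξ i)‖ ^ 2 ∧ 0 < ‖wPart j (ξ i)‖ ^ 2) → 0 < δ) ∧
      ∀ y, δ * |y| - C ≤ energyTerm (‖zPart j (ξ i)‖ ^ 2) (‖wPart j (ξ i)‖ ^ 2) (c i) y := fun i =>
    exists_linear_le_energyTerm (sq_nonneg _) (sq_nonneg _) (fun h => (hpos _).1 ((hc i).1 h))
      fun h => (hpos _).1 ((hc i).2 h)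
  choose δ C hδ hδ' hE using h1
  -- The Kempf–Ness function: its differential at `Y` is `∑ c_i ι*u_i - μ_j(Exp(√-1 Y) ξ)`, so a
  -- minimum solves the equation.
  let f : lieAlg K → ℝ := fun Y =>
    ∑ i, energyTerm (‖zPart j (ξ i)‖ ^ 2) (‖wPart j (ξ i)‖ ^ 2) (c i) (Y.1 i)
  -- `‖T Y‖` is a lower bound for `f` up to a constant. The indices with `δ i > 0` include the
  -- spanning set `hs`, so `T` is injective and `f` is proper.
  let T : lieAlg K →ₗ[ℝ] (Fin N → ℝ) :=
    { toFun := fun Y i => δ i * Y.1 i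
      map_add' := fun X Y => by ext i; simp [mul_add]
      map_smul' := fun r X => by ext i; simp; ring }
  have hT : LinearMap.ker T = ⊥ := by
    refine LinearMap.ker_eq_bot'.2 fun Y hY => coordSpan_eq_top_iff.1 hs Y fun i hi => ?_
    have h2 : δ i * Y.1 i = 0 := congrFun hY i
    simp only [hpos] at hi
    exact (mul_eq_zero.1 h2).resolve_left (hδ' i hi).ne'
  obtain ⟨L, hL, hTL⟩ := T.exists_antilipschitzWith hT
  have hfT : ∀ Y, ‖T Y‖ ≤ f Y + ∑ i, C i := by
    intro Y
    have h2 : ∑ i, (δ i * |Y.1 i| - C i) ≤ f Y := Finset.sum_le_sum fun i _ => hE i _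
    rw [Finset.sum_sub_distrib] at h2
    have h3 : ‖T Y‖ ≤ ∑ i, δ i * |Y.1 i| := by
      refine (pi_norm_le_iff_of_nonneg (Finset.sum_nonneg fun i _ =>
        mul_nonneg (hδ i) (abs_nonneg _))).2 fun i => ?_
      have h4 : ‖T Y i‖ = δ i * |Y.1 i| := by
        change ‖δ i * Y.1 i‖ = _
        rw [Real.norm_eq_abs, abs_mul, abs_of_nonneg (hδ i)]
      rw [h4]
      exact Finset.single_le_sum (f := fun i => δ i * |Y.1 i|)
        (fun i _ => mul_nonneg (hδ i) (abs_nonneg _)) (Finset.mem_univ i)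
    linarith
  have hcont : Continuous f := by
    refine continuous_finsetSum _ fun i _ => ?_
    have h2 : Continuous (energyTerm (‖zPart j (ξ i)‖ ^ 2) (‖wPart j (ξ i)‖ ^ 2) (c i)) :=
      continuous_iff_continuousAt.2 fun y => (hasDerivAt_energyTerm _ _ _ y).continuousAt
    exact h2.comp ((continuous_apply i).comp continuous_subtype_val)
  have htend : Filter.Tendsto f (Filter.cocompact (lieAlg K)) Filter.atTop := by
    have h2 : ∀ Y, (L : ℝ)⁻¹ * ‖Y‖ + -∑ i, C i ≤ f Y := by
      intro Y
      have h3 : ‖Y‖ ≤ L * ‖T Y‖ := hTL.le_mul_norm (map_zero T) Y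
      have h4 : (L : ℝ)⁻¹ * ‖Y‖ ≤ ‖T Y‖ := by
        rw [inv_mul_le_iff₀ (by exact_mod_cast hL)]
        exact h3
      linarith [hfT Y]
    refine Filter.tendsto_atTop_mono h2 (Filter.tendsto_atTop_add_const_right _ _ ?_)
    exact (tendsto_norm_cocompact_atTop (E := lieAlg K)).const_mul_atTop
      (inv_pos.2 (by exact_mod_cast hL))
  obtain ⟨Y, hY⟩ := hcont.exists_forall_le htend
  refine ⟨Y, ?_⟩
  ext Z
  have hd : HasDerivAt (fun t : ℝ => f (Y + t • Z)) (∑ i, (c i - momentCoord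
      (scaleAct j Y ξ i) j) * Z.1 i) 0 := by
    refine HasDerivAt.fun_sum fun i _ => ?_
    have h2 : HasDerivAt (fun t : ℝ => Y.1 i + t * Z.1 i) (Z.1 i) 0 := by
      simpa using ((hasDerivAt_id (0 : ℝ)).mul_const (Z.1 i)).const_add (Y.1 i)
    have h3 := (hasDerivAt_energyTerm (‖zPart j (ξ i)‖ ^ 2) (‖wPart j (ξ i)‖ ^ 2) (c i)
      (Y.1 i + 0 * Z.1 i)).comp 0 h2
    refine h3.congr_deriv ?_
    rw [scaleAct, momentCoord_scaleQ_self, zero_mul, add_zero]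
  have hmin : IsLocalMin (fun t : ℝ => f (Y + t • Z)) 0 := by
    refine Filter.Eventually.of_forall fun t => ?_
    simpa using hY (Y + t • Z)
  have h0 := hmin.hasDerivAt_eq_zero hd
  simp only [momentMap, sum_apply, smul_apply, smul_eq_mul, iotaStar_apply]
  simp only [sub_mul, Finset.sum_sub_distrib] at h0
  linarith

theorem exp_mul_sub_nonneg (A x y : ℝ) (hA : 0 ≤ A) :
    0 ≤ A * ((Real.exp (4 * Real.pi * x) - Real.exp (4 * Real.pi * y)) * (x - y)) := by
  refine mul_nonneg hA ?_
  rcases le_total x y with h | h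
  · refine mul_nonneg_of_nonpos_of_nonpos (sub_nonpos.2 (Real.exp_le_exp.2 ?_)) (sub_nonpos.2 h)
    exact mul_le_mul_of_nonneg_left h (by positivity)
  · refine mul_nonneg (sub_nonneg.2 (Real.exp_le_exp.2 ?_)) (sub_nonneg.2 h)
    exact mul_le_mul_of_nonneg_left h (by positivity)

theorem eq_of_exp_mul_sub_eq_zero {A x y : ℝ} (hA : A ≠ 0)
    (h : A * ((Real.exp (4 * Real.pi * x) - Real.exp (4 * Real.pi * y)) * (x - y)) = 0) :
    x = y := by
  rcases mul_eq_zero.1 ((mul_eq_zero.1 h).resolve_left hA) with h | h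
  · have := Real.exp_injective (sub_eq_zero.1 h)
    exact mul_left_cancel₀ (by positivity) this
  · exact sub_eq_zero.1 h

/-- The solution of the gradient equation is unique. -/
theorem momentMap_scaleAct_injective {K : Subgroup (Fin N → Circle)} {j : Fin 3} {ξ : HN N}
    (hs : coordSpan K (coordSupport ξ) = ⊤) {X Y : lieAlg K}
    (h : momentMap K (scaleAct j X ξ) j = momentMap K (scaleAct j Y ξ) j) : X = Y := by
  refine sub_eq_zero.1 (coordSpan_eq_top_iff.1 hs (X - Y) fun i hi => ?_)
  have h1 := DFunLike.congr_fun h (X - Y)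
  simp only [momentMap, sum_apply, smul_apply, smul_eq_mul, iotaStar_apply, scaleAct,
    momentCoord_scaleQ_self] at h1
  have hneg : ∀ y, Real.exp (-4 * Real.pi * y) = Real.exp (4 * Real.pi * -y) := fun y => by
    congr 1; ring
  -- Pairing the difference of the two moment values with `X - Y` gives `π ∑ g i` up to sign, and
  -- each summand is nonnegative because `exp` is increasing. Equality forces `X i = Y i` on the
  -- support.
  let g : Fin N → ℝ := fun i =>
    ‖zPart j (ξ i)‖ ^ 2 * ((Real.exp (4 * Real.pi * -X.1 i) - Real.exp (4 * Real.pi * -Y.1 i)) *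
      (-X.1 i - -Y.1 i)) +
    ‖wPart j (ξ i)‖ ^ 2 * ((Real.exp (4 * Real.pi * X.1 i) - Real.exp (4 * Real.pi * Y.1 i)) *
      (X.1 i - Y.1 i))
  have h2 : Real.pi * ∑ i, g i = 0 := by
    rw [← sub_eq_zero.2 h1.symm, ← Finset.sum_sub_distrib, Finset.mul_sum]
    refine Finset.sum_congr rfl fun i _ => ?_
    simp only [hneg, g, Submodule.coe_sub, Pi.sub_apply]
    ring
  have h3 : ∑ i, g i = 0 := (mul_eq_zero.1 h2).resolve_left Real.pi_ne_zero
  have hz := fun i => exp_mul_sub_nonneg (‖zPart j (ξ i)‖ ^ 2) (-X.1 i) (-Y.1 i) (sq_nonneg _)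
  have hw := fun i => exp_mul_sub_nonneg (‖wPart j (ξ i)‖ ^ 2) (X.1 i) (Y.1 i) (sq_nonneg _)
  have h4 := (Finset.sum_eq_zero_iff_of_nonneg fun i _ => add_nonneg (hz i) (hw i)).1 h3 i
    (Finset.mem_univ i)
  have hz0 := (add_eq_zero_iff_of_nonneg (hz i) (hw i)).1 h4
  have hi' : zPart j (ξ i) ≠ 0 ∨ wPart j (ξ i) ≠ 0 := by
    by_contra hc
    push Not at hc
    exact hi (by rw [← zPart_add_wPart j (ξ i), hc.1, hc.2, add_zero])
  rcases hi' with hi' | hi'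
  · have := eq_of_exp_mul_sub_eq_zero (by simpa using hi') hz0.1
    simp only [Submodule.coe_sub, Pi.sub_apply]
    linarith
  · have := eq_of_exp_mul_sub_eq_zero (by simpa using hi') hz0.2
    simp only [Submodule.coe_sub, Pi.sub_apply]
    linarith

/-! ### Infinitesimal actions -/

theorem infAct_add (X Y : Fin N → ℝ) (ξ : HN N) :
    infAct (X + Y) ξ = infAct X ξ + infAct Y ξ := by
  funext i
  simp only [infAct, Pi.add_apply]
  module

theorem infAct_neg (X : Fin N → ℝ) (ξ : HN N) : infAct (-X) ξ = -infAct X ξ := by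
  funext i
  simp only [infAct, Pi.neg_apply]
  module

theorem complexStr_add (j : Fin 3) (ξ η : HN N) :
    complexStr j (ξ + η) = complexStr j ξ + complexStr j η :=
  funext fun _ => mul_add _ _ _

theorem complexStr_neg (j : Fin 3) (ξ : HN N) : complexStr j (-ξ) = -complexStr j ξ :=
  funext fun _ => mul_neg _ _

theorem complexStr_complexStr (j : Fin 3) (ξ : HN N) : complexStr j (complexStr j ξ) = -ξ := by
  funext i
  rw [complexStr, complexStr, ← mul_assoc, imUnit_mul_self, neg_one_mul]
  rfl

theorem scaleQ_add (j : Fin 3) (y : ℝ) (p q : Quaternion ℝ) :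
    scaleQ j y (p + q) = scaleQ j y p + scaleQ j y q := by
  simp only [scaleQ, zPart_add, wPart_add]
  module

theorem scaleQ_smul (j : Fin 3) (y c : ℝ) (q : Quaternion ℝ) :
    scaleQ j y (c • q) = c • scaleQ j y q := by
  simp only [scaleQ, zPart_smul, wPart_smul]
  module

theorem scaleAct_add (j : Fin 3) (Y : Fin N → ℝ) (ξ η : HN N) :
    scaleAct j Y (ξ + η) = scaleAct j Y ξ + scaleAct j Y η :=
  funext fun _ => scaleQ_add _ _ _ _

theorem scaleAct_sub (j : Fin 3) (Y : Fin N → ℝ) (ξ η : HN N) :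
    scaleAct j Y (ξ - η) = scaleAct j Y ξ - scaleAct j Y η := by
  rw [eq_sub_iff_add_eq, ← scaleAct_add, sub_add_cancel]

theorem scaleAct_map_zero (j : Fin 3) (Y : Fin N → ℝ) : scaleAct j Y 0 = 0 :=
  funext fun _ => scaleQ_eq_zero_iff.2 rfl

theorem scaleAct_complexStr (j : Fin 3) (Y : Fin N → ℝ) (ξ : HN N) :
    scaleAct j Y (complexStr j ξ) = complexStr j (scaleAct j Y ξ) :=
  funext fun _ => scaleQ_imUnit_mul _ _ _

theorem scaleAct_infAct (j : Fin 3) (X Y : Fin N → ℝ) (ξ : HN N) :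
    scaleAct j Y (infAct X ξ) = infAct X (scaleAct j Y ξ) :=
  funext fun i => by rw [scaleAct, infAct, scaleQ_smul, scaleQ_mul_imUnit]; rfl

theorem momentDeriv_infAct (K : Subgroup (Fin N → Circle)) (X : Fin N → ℝ) (ξ : HN N) :
    momentDeriv K ξ (infAct X ξ) = 0 := by
  funext j
  rw [momentDeriv_apply]
  refine Finset.sum_eq_zero fun i _ => ?_
  simp [infAct, momentBilin_mul_imUnit]

/-- The moment map `μ_j` is nondegenerate in the directions `I_j k`. -/
theorem eq_zero_of_momentDeriv_complexStr {K : Subgroup (Fin N → Circle)} {j : Fin 3} {ξ : HN N}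
    (hs : coordSpan K (coordSupport ξ) = ⊤) {X : lieAlg K}
    (h : momentDeriv K ξ (complexStr j (infAct X ξ)) j = 0) : X = 0 := by
  refine coordSpan_eq_top_iff.1 hs X fun i hi => ?_
  have h1 := DFunLike.congr_fun h X
  simp only [momentDeriv_apply, sum_apply, smul_apply, smul_eq_mul, iotaStar_apply, complexStr,
    infAct, mul_smul_comm, map_smul, momentBilin_imUnit_mul, zero_apply] at h1
  -- Evaluating `dμ_j(I_j X ξ)` on `X` itself gives a negative definite quadratic form when the
  -- support spans.
  have h2 : 4 * Real.pi ^ 2 * ∑ i, ‖ξ i‖ ^ 2 * X.1 i ^ 2 = 0 := by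
    rw [← neg_eq_zero, ← h1, Finset.mul_sum, ← Finset.sum_neg_distrib]
    refine Finset.sum_congr rfl fun i _ => ?_
    ring
  have h3 := (mul_eq_zero.1 h2).resolve_left (by positivity)
  have h4 := (Finset.sum_eq_zero_iff_of_nonneg fun i _ => by positivity).1 h3 i (Finset.mem_univ i)
  have h5 := (mul_eq_zero.1 h4).resolve_left (pow_ne_zero 2 (norm_ne_zero_iff.2 hi))
  simpa using h5

/-- The derivative of the action of `Exp(√-1 k)`. -/
theorem exists_hasFDerivAt_scaleAct {E : Type*} [NormedAddCommGroup E] [NormedSpace ℝ E]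
    (j : Fin 3) {Y : E → Fin N → ℝ} {Y' : E →L[ℝ] Fin N → ℝ} {σ : E → HN N} {σ' : E →L[ℝ] HN N}
    {x : E} (hY : HasFDerivAt Y Y' x) (hσ : HasFDerivAt σ σ' x) :
    ∃ L : E →L[ℝ] HN N, HasFDerivAt (fun x => scaleAct j (Y x) (σ x)) L x ∧ ∀ v, L v =
      scaleAct j (Y x) (σ' v) + complexStr j (infAct (Y' v) (scaleAct j (Y x) (σ x))) := by
  have h : ∀ i, ∃ L : E →L[ℝ] Quaternion ℝ,
      HasFDerivAt (fun x => scaleQ j (Y x i) (σ x i)) L x ∧ ∀ v, L v = scaleQ j (Y x i) (σ' v i) +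
        imUnit j * ((2 * Real.pi * Y' v i) • (scaleQ j (Y x i) (σ x i) * imUnit 0)) := by
    intro i
    have hYi := hasFDerivAt_pi'.1 hY i
    have hσi := hasFDerivAt_pi'.1 hσ i
    have hz := (zPartL j).hasFDerivAt.comp x hσi
    have hw := (wPartL j).hasFDerivAt.comp x hσi
    refine ⟨_, ((hYi.const_mul (-2 * Real.pi)).exp.smul hz).add
      ((hYi.const_mul (2 * Real.pi)).exp.smul hw), fun v => ?_⟩
    rw [mul_smul_comm, ← zPart_sub_wPart, zPart_scaleQ, wPart_scaleQ]
    simp [scaleQ, zPartL_apply, wPartL_apply]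
    module
  choose L hL hLv using h
  exact ⟨ContinuousLinearMap.pi L, hasFDerivAt_pi.2 hL, fun v => funext fun i => hLv i v⟩

theorem contDiff_scaleAct (j : Fin 3) :
    ContDiff ℝ ∞ fun p : HN N × (Fin N → ℝ) => scaleAct j p.2 p.1 := by
  refine contDiff_pi.2 fun i => ?_
  have h1 : ContDiff ℝ ∞ fun p : HN N × (Fin N → ℝ) => p.1 i :=
    (contDiff_apply ℝ (Quaternion ℝ) i).comp contDiff_fst
  have h2 : ContDiff ℝ ∞ fun p : HN N × (Fin N → ℝ) => p.2 i :=
    (contDiff_apply ℝ ℝ i).comp contDiff_snd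
  exact ((contDiff_const.mul h2).exp.smul ((zPartL j).contDiff.comp h1)).add
    ((contDiff_const.mul h2).exp.smul ((wPartL j).contDiff.comp h1))

/-! ### The retraction onto a level set -/

/-- The points with spanning support whose orbit meets the level `α` of `μ_j`. -/
def retractDomain (K : Subgroup (Fin N → Circle)) (j : Fin 3) (α : kDual K) : Set (HN N) :=
  {ξ | coordSpan K (coordSupport ξ) = ⊤ ∧
    ∃ Y : lieAlg K, momentMap K (scaleAct j Y ξ) j = α}

open Classical in
/-- The element `Y` of `k` such that `Exp(√-1 Y) ξ` lies on the level `α` of `μ_j`. -/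
def retractParam (K : Subgroup (Fin N → Circle)) (j : Fin 3) (α : kDual K) (ξ : HN N) : lieAlg K :=
  if h : ∃ Y : lieAlg K, momentMap K (scaleAct j Y ξ) j = α then h.choose else 0

/-- The retraction of the stable locus onto the level `α` of `μ_j` along `Exp(√-1 k)`-orbits. -/
def retract (K : Subgroup (Fin N → Circle)) (j : Fin 3) (α : kDual K) (ξ : HN N) : HN N :=
  scaleAct j (retractParam K j α ξ) ξ

theorem momentMap_retract {K : Subgroup (Fin N → Circle)} {j : Fin 3} {α : kDual K} {ξ : HN N}
    (h : ξ ∈ retractDomain K j α) : momentMap K (retract K j α ξ) j = α := by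
  rw [retract, retractParam, dif_pos h.2]
  exact h.2.choose_spec

theorem retractParam_eq {K : Subgroup (Fin N → Circle)} {j : Fin 3} {α : kDual K} {ξ : HN N}
    (hs : coordSpan K (coordSupport ξ) = ⊤) {Y : lieAlg K}
    (h : momentMap K (scaleAct j Y ξ) j = α) : retractParam K j α ξ = Y :=
  momentMap_scaleAct_injective hs ((momentMap_retract ⟨hs, Y, h⟩).trans h.symm)

theorem isOpen_coordSpan_eq_top (K : Subgroup (Fin N → Circle)) :
    IsOpen {ξ : HN N | coordSpan K (coordSupport ξ) = ⊤} := by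
  refine isOpen_iff_mem_nhds.2 fun ξ hξ => ?_
  have h : ∀ᶠ η in nhds ξ, ∀ i ∈ coordSupport ξ, η i ≠ 0 := by
    rw [Filter.eventually_all_finite (Set.toFinite _)]
    intro i hi
    exact (continuous_apply i).continuousAt.eventually_ne hi
  filter_upwards [h] with η hη
  exact coordSpan_top_mono hη hξ

/-- The implicit function theorem for `(ξ, Y) ↦ (ξ, μ_j(Exp(√-1 Y) ξ))`. Its derivative is injective
because `dμ_j` is nondegenerate on `I_j k`. -/
theorem contDiffAt_retractParam {K : Subgroup (Fin N → Circle)} {j : Fin 3} {α : kDual K}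
    {ξ : HN N} (hξ : ξ ∈ retractDomain K j α) :
    retractDomain K j α ∈ nhds ξ ∧ ContDiffAt ℝ ∞ (retractParam K j α) ξ := by
  let G : HN N × lieAlg K → HN N × kDual K := fun p => (p.1, momentMap K (scaleAct j p.2 p.1) j)
  let s : Set (HN N × lieAlg K) := {p | coordSpan K (coordSupport p.1) = ⊤}
  have hs : IsOpen s := (isOpen_coordSpan_eq_top K).preimage continuous_fst
  have hsub : ContDiff ℝ ∞ fun p : HN N × lieAlg K => (p.1, (p.2 : Fin N → ℝ)) :=
    contDiff_fst.prodMk ((lieAlg K).subtypeL.contDiff.comp contDiff_snd)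
  have hG : ContDiff ℝ ∞ G := by
    refine contDiff_fst.prodMk ?_
    exact (contDiff_pi.1 (contDiff_momentMap K) j).comp ((contDiff_scaleAct j).comp hsub)
  have hinj : ∀ p ∈ s, ∀ v, fderiv ℝ G p v = 0 → v = 0 := by
    rintro p hp ⟨h, Z⟩ hv
    obtain ⟨L, hL, hLv⟩ := exists_hasFDerivAt_scaleAct j (x := p)
      (((lieAlg K).subtypeL.hasFDerivAt (x := p.2)).comp p hasFDerivAt_snd) hasFDerivAt_fst
    have h1 := (hasFDerivAt_pi'.1 (hasFDerivAt_momentMap K (scaleAct j p.2 p.1)) j).comp p hL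
    have h2 : HasFDerivAt G _ p := hasFDerivAt_fst.prodMk h1
    rw [h2.fderiv] at hv
    have h3 : h = 0 := congrArg Prod.fst hv
    have h4 : momentDeriv K (scaleAct j p.2 p.1) (L (h, Z)) j = 0 := congrArg Prod.snd hv
    have h5 : L (h, Z) = scaleAct j p.2 h + complexStr j (infAct Z (scaleAct j p.2 p.1)) :=
      hLv (h, Z)
    rw [h5, h3, scaleAct_map_zero, zero_add] at h4
    have h7 := eq_zero_of_momentDeriv_complexStr (by rw [coordSupport_scaleAct]; exact hp) h4
    rw [h3, h7]
    rfl
  have hfr : Module.finrank ℝ (HN N × lieAlg K) = Module.finrank ℝ (HN N × kDual K) := by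
    rw [Module.finrank_prod, Module.finrank_prod,
      ← (LinearMap.toContinuousLinearMap (𝕜 := ℝ) (E := lieAlg K) (F' := ℝ)).finrank_eq]
    congr 1
    exact Subspace.dual_finrank_eq.symm
  obtain ⟨hsp, Y, hY⟩ := hξ
  obtain ⟨e, he1, he2, he3, he4, he5⟩ := exists_openPartialHomeomorph_of_injective hfr hs
    hG.contDiffOn hinj (u := (ξ, Y)) hsp
  have heξ : (ξ, α) = e (ξ, Y) := by
    rw [he3]
    exact Prod.ext rfl hY.symm
  have hmem : (ξ, α) ∈ e.target := by
    rw [heξ]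
    exact e.map_source he1
  have hcont : Continuous fun η : HN N => (η, α) := by fun_prop
  have hnhds : ∀ᶠ η in nhds ξ, (η, α) ∈ e.target :=
    hcont.continuousAt.preimage_mem_nhds (e.open_target.mem_nhds hmem)
  have hsol : ∀ η, (η, α) ∈ e.target → coordSpan K (coordSupport η) = ⊤ ∧
      momentMap K (scaleAct j (e.symm (η, α)).2 η) j = α := by
    intro η hη
    have h1 : G (e.symm (η, α)) = (η, α) := by rw [← he3, e.right_inv hη]
    have h2 : (e.symm (η, α)).1 = η := congrArg Prod.fst h1
    have h3 : momentMap K (scaleAct j (e.symm (η, α)).2 (e.symm (η, α)).1) j = α :=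
      congrArg Prod.snd h1
    have h4 : coordSpan K (coordSupport (e.symm (η, α)).1) = ⊤ := he2 (e.map_target hη)
    rw [h2] at h3 h4
    exact ⟨h4, h3⟩
  refine ⟨?_, ?_⟩
  · filter_upwards [hnhds] with η hη using ⟨(hsol η hη).1, _, (hsol η hη).2⟩
  · have h1 : ContDiffAt ℝ ∞ (fun η : HN N => (e.symm (η, α)).2) ξ := by
      have h2 : ContDiffAt ℝ ∞ e.symm (ξ, α) := he5.contDiffAt (e.open_target.mem_nhds hmem)
      have h3 : ContDiffAt ℝ ∞ (fun η : HN N => (η, α)) ξ := by fun_prop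
      exact contDiffAt_snd.comp ξ (h2.comp ξ h3)
    refine h1.congr_of_eventuallyEq ?_
    -- Uniqueness of the solution identifies the smooth local solution with the chosen one.
    filter_upwards [hnhds] with η hη using retractParam_eq (hsol η hη).1 (hsol η hη).2

theorem isOpen_retractDomain (K : Subgroup (Fin N → Circle)) (j : Fin 3) (α : kDual K) :
    IsOpen (retractDomain K j α) :=
  isOpen_iff_mem_nhds.2 fun _ hξ => (contDiffAt_retractParam hξ).1

theorem contDiffOn_retract (K : Subgroup (Fin N → Circle)) (j : Fin 3) (α : kDual K) :
    ContDiffOn ℝ ∞ (retract K j α) (retractDomain K j α) := by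
  intro ξ hξ
  have h1 := (contDiffAt_retractParam hξ).2
  have h2 : ContDiffAt ℝ ∞ (fun η => (η, (retractParam K j α η : Fin N → ℝ))) ξ :=
    contDiffAt_id.prodMk ((lieAlg K).subtypeL.contDiff.contDiffAt.comp ξ h1)
  exact ((contDiff_scaleAct j).contDiffAt.comp ξ h2).contDiffWithinAt

theorem retract_mem_complexOrbit (K : Subgroup (Fin N → Circle)) (j : Fin 3) (α : kDual K)
    (ξ : HN N) : retract K j α ξ ∈ complexOrbit K j ξ :=
  scaleAct_mem_complexOrbit j (retractParam K j α ξ).2 ξ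

theorem coordSupport_of_mem_complexOrbit {K : Subgroup (Fin N → Circle)} {j : Fin 3} {ξ η : HN N}
    (h : η ∈ complexOrbit K j ξ) : coordSupport η = coordSupport ξ := by
  obtain ⟨κ, -, X, -, rfl⟩ := mem_complexOrbit_iff.1 h
  rw [coordSupport_torusAct, coordSupport_scaleAct]

/-- Two points of the same `K_ℂ`-orbit on the same level of `μ_j` lie on the same `K`-orbit. -/
theorem exists_torusAct_of_mem_complexOrbit {K : Subgroup (Fin N → Circle)} {j : Fin 3}
    {ξ η : HN N} (hs : coordSpan K (coordSupport ξ) = ⊤) (h : η ∈ complexOrbit K j ξ)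
    (hm : momentMap K η j = momentMap K ξ j) : ∃ κ ∈ K, η = torusAct κ ξ := by
  obtain ⟨κ, hκ, X, hX, rfl⟩ := mem_complexOrbit_iff.1 h
  rw [momentMap_torusAct] at hm
  have h1 : (⟨X, hX⟩ : lieAlg K) = 0 := momentMap_scaleAct_injective (j := j) hs (by
    rw [hm, ZeroMemClass.coe_zero, scaleAct_zero])
  refine ⟨κ, hκ, ?_⟩
  rw [show X = 0 from congrArg Subtype.val h1, scaleAct_zero]

/-- For a regular parameter semistability implies stability: the admissible coefficients span, so
the gradient equation on the orbit is solvable. -/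
theorem mem_retractDomain_of_semistable {K : Subgroup (Fin N → Circle)} {j : Fin 3} {a : Param K}
    (ha : a ∈ regularValues K) {ξ : HN N} (hξ : ξ ∈ semistable K j a) :
    ξ ∈ retractDomain K j (a j) := by
  obtain ⟨h1, c, hc, hac⟩ := mem_semistable_iff.1 hξ
  have hs := coordSpan_of_semistable ha h1 hac
  refine ⟨coordSpan_coordSupport_of_cone hc hs, ?_⟩
  rw [hac]
  exact exists_momentMap_scaleAct_eq hc hs

theorem momentMap_retract_of_semistable {K : Subgroup (Fin N → Circle)} {j : Fin 3} {a : Param K}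
    (ha : a ∈ regularValues K) {ξ : HN N} (hξ : ξ ∈ semistable K j a) :
    momentMap K (retract K j (a j) ξ) = a := by
  funext l
  by_cases hl : l = j
  · rw [hl]
    exact momentMap_retract (mem_retractDomain_of_semistable ha hξ)
  · rw [momentMap_of_mem_complexOrbit hl (retract_mem_complexOrbit K j (a j) ξ)]
    exact (mem_semistable_iff.1 hξ).1 l hl

/-! ### The topology of the quotients -/

theorem continuous_torusAct : Continuous fun p : (Fin N → Circle) × HN N => torusAct p.1 p.2 := by
  refine continuous_pi fun i => ?_
  have h1 : Continuous fun p : (Fin N → Circle) × HN N => p.2 i :=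
    (continuous_apply i).comp continuous_snd
  have h2 : Continuous fun p : (Fin N → Circle) × HN N => ((p.1 i : ℂ) : Quaternion ℝ) :=
    (LinearMap.continuous_of_finiteDimensional Quaternion.ofComplex.toLinearMap).comp
      ((show Continuous fun c : Circle => (c : ℂ) by fun_prop).comp ((continuous_apply i).comp continuous_fst))
  exact h1.mul h2

theorem continuous_torusAct_right (κ : Fin N → Circle) : Continuous (torusAct κ) :=
  continuous_torusAct.comp (continuous_const.prodMk continuous_id)

theorem mk_eq_mk_iff {K : Subgroup (Fin N → Circle)} {a : Param K} {x y : LevelSet K a} :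
    Quotient.mk (orbitSetoid K a) x = Quotient.mk (orbitSetoid K a) y ↔
      ∃ κ ∈ K, y.1 = torusAct κ x.1 := Quotient.eq

theorem isOpenQuotientMap_mk (K : Subgroup (Fin N → Circle)) (a : Param K) :
    IsOpenQuotientMap (Quotient.mk (orbitSetoid K a)) := by
  refine ⟨Quotient.mk_surjective, continuous_quotient_mk', fun U hU => ?_⟩
  rw [← isQuotientMap_quotient_mk'.isOpen_preimage]
  have h : Quotient.mk (orbitSetoid K a) ⁻¹' (Quotient.mk (orbitSetoid K a) '' U) =
      ⋃ κ ∈ K, (fun x : LevelSet K a =>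
        (⟨torusAct κ x.1, (momentMap_torusAct K κ x.1).trans x.2⟩ : LevelSet K a)) ⁻¹' U := by
    ext x
    simp only [Set.mem_preimage, Set.mem_image, Set.mem_iUnion, exists_prop]
    constructor
    · rintro ⟨y, hy, hyx⟩
      obtain ⟨κ, hκ, h⟩ := mk_eq_mk_iff.1 hyx.symm
      refine ⟨κ, hκ, ?_⟩
      convert hy
      exact h.symm
    · rintro ⟨κ, hκ, h⟩
      exact ⟨_, h, (mk_eq_mk_iff.2 ⟨κ, hκ, rfl⟩).symm⟩
  change IsOpen (Quotient.mk (orbitSetoid K a) ⁻¹' (Quotient.mk (orbitSetoid K a) '' U))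
  rw [h]
  exact isOpen_biUnion fun κ _ => hU.preimage
    (((continuous_torusAct_right κ).comp continuous_subtype_val).subtype_mk _)

/-- The orbit relation is the image of a closed set under a projection along the compact torus,
hence closed. For an open quotient map this suffices. -/
theorem t2Space_variety {K : Subgroup (Fin N → Circle)}
    (hK : IsClosed (K : Set (Fin N → Circle))) (a : Param K) : T2Space (Variety K a) := by
  rw [t2Space_iff_of_isOpenQuotientMap (isOpenQuotientMap_mk K a)]
  have h : {q : LevelSet K a × LevelSet K a |
      Quotient.mk (orbitSetoid K a) q.1 = Quotient.mk (orbitSetoid K a) q.2} =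
      Prod.snd '' {p : (Fin N → Circle) × (LevelSet K a × LevelSet K a) |
        p.1 ∈ K ∧ p.2.2.1 = torusAct p.1 p.2.1.1} := by
    ext q
    rw [Set.mem_ofPred_eq, mk_eq_mk_iff]
    constructor
    · rintro ⟨κ, hκ, h⟩
      exact ⟨(κ, q), ⟨hκ, h⟩, rfl⟩
    · rintro ⟨⟨κ, q⟩, ⟨hκ, h⟩, rfl⟩
      exact ⟨κ, hκ, h⟩
  rw [h]
  refine isClosedMap_snd_of_compactSpace _ ((hK.preimage continuous_fst).inter (isClosed_eq ?_ ?_))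
  · fun_prop
  · exact continuous_torusAct.comp (continuous_fst.prodMk
      (continuous_subtype_val.comp (continuous_fst.comp continuous_snd)))

theorem secondCountableTopology_variety (K : Subgroup (Fin N → Circle)) (a : Param K) :
    SecondCountableTopology (Variety K a) :=
  TopologicalSpace.Quotient.secondCountableTopology (isOpenQuotientMap_mk K a).isOpenMap

theorem isCompact_torusOrbit {K : Subgroup (Fin N → Circle)}
    (hK : IsClosed (K : Set (Fin N → Circle))) (ξ : HN N) :
    IsCompact ((fun κ => torusAct κ ξ) '' (K : Set (Fin N → Circle))) :=
  hK.isCompact.image (continuous_torusAct.comp (continuous_id.prodMk continuous_const))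

/-! ### Closed orbits -/

/-- Both retracted points lie on the same `K_ℂ`-orbit and on the same level. This makes `retract`
descend to quotients. -/
theorem exists_retract_eq_torusAct {K : Subgroup (Fin N → Circle)} {j : Fin 3} {a : Param K}
    (ha : a ∈ regularValues K) {ξ η : HN N} (hξ : ξ ∈ semistable K j a)
    (hη : η ∈ complexOrbit K j ξ) :
    ∃ κ ∈ K, retract K j (a j) η = torusAct κ (retract K j (a j) ξ) := by
  have hη' := mem_semistable_of_mem_complexOrbit hη hξ
  refine exists_torusAct_of_mem_complexOrbit (j := j) ?_ ?_ ?_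
  · rw [coordSupport_of_mem_complexOrbit (retract_mem_complexOrbit K j (a j) ξ)]
    exact (mem_retractDomain_of_semistable ha hξ).1
  · exact complexOrbit_trans (complexOrbit_trans
      (complexOrbit_symm (retract_mem_complexOrbit K j (a j) ξ)) hη)
      (retract_mem_complexOrbit K j (a j) η)
  · rw [momentMap_retract_of_semistable ha hξ, momentMap_retract_of_semistable ha hη']

/-- The continuous map `retract` sends the orbit of `ξ` into one compact `K`-orbit, so it sends the
semistable limit point `η` there as well, and `retract` never leaves a `K_ℂ`-orbit. -/
theorem mem_complexOrbit_of_mem_closure {K : Subgroup (Fin N → Circle)}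
    (hK : IsClosed (K : Set (Fin N → Circle))) {j : Fin 3} {a : Param K}
    (ha : a ∈ regularValues K) {ξ η : HN N} (hξ : ξ ∈ semistable K j a)
    (hη : η ∈ semistable K j a) (h : η ∈ closure (complexOrbit K j ξ)) :
    η ∈ complexOrbit K j ξ := by
  have hd := mem_retractDomain_of_semistable ha hη
  have hc : ContinuousAt (retract K j (a j)) η :=
    (contDiffOn_retract K j (a j)).continuousOn.continuousAt
      ((isOpen_retractDomain K j (a j)).mem_nhds hd)
  have h1 := mem_closure_image hc h
  have h2 : retract K j (a j) '' complexOrbit K j ξ ⊆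
      (fun κ => torusAct κ (retract K j (a j) ξ)) '' (K : Set (Fin N → Circle)) := by
    rintro _ ⟨θ, hθ, rfl⟩
    obtain ⟨κ, hκ, h⟩ := exists_retract_eq_torusAct ha hξ hθ
    exact ⟨κ, hκ, h.symm⟩
  obtain ⟨κ, hκ, h3⟩ := closure_minimal h2 (isCompact_torusOrbit hK _).isClosed h1
  have h4 : retract K j (a j) η ∈ complexOrbit K j ξ := by
    rw [← h3]
    exact complexOrbit_trans (retract_mem_complexOrbit K j (a j) ξ)
      (torusAct_mem_complexOrbit K j _ hκ)
  exact complexOrbit_trans h4 (complexOrbit_symm (retract_mem_complexOrbit K j (a j) η))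

theorem isClosed_complexOrbit {K : Subgroup (Fin N → Circle)}
    (hK : IsClosed (K : Set (Fin N → Circle))) {j : Fin 3} {a : Param K}
    (ha : a ∈ regularValues K) {ξ : HN N} (hξ : ξ ∈ semistable K j a) :
    IsClosed ((↑) ⁻¹' complexOrbit K j ξ : Set (semistable K j a)) := by
  refine isClosed_of_closure_subset fun x hx => ?_
  exact mem_complexOrbit_of_mem_closure hK ha hξ x.2
    (map_mem_closure continuous_subtype_val hx fun _ h => h)

theorem gitRel_iff {K : Subgroup (Fin N → Circle)}
    (hK : IsClosed (K : Set (Fin N → Circle))) {j : Fin 3} {a : Param K}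
    (ha : a ∈ regularValues K) {x y : semistable K j a} :
    gitRel K j a x y ↔ y.1 ∈ complexOrbit K j x.1 := by
  constructor
  · rintro ⟨p, ⟨hx, hy⟩, hp⟩
    exact complexOrbit_trans (mem_complexOrbit_of_mem_closure hK ha x.2 hp hx)
      (complexOrbit_symm (mem_complexOrbit_of_mem_closure hK ha y.2 hp hy))
  · intro h
    exact ⟨y.1, ⟨subset_closure h, subset_closure (self_mem_complexOrbit K j y.1)⟩, y.2⟩

theorem isHomeomorph_orbitSpaceToGIT {K : Subgroup (Fin N → Circle)}
    (hK : IsClosed (K : Set (Fin N → Circle))) {j : Fin 3} {a : Param K}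
    (ha : a ∈ regularValues K) : IsHomeomorph (orbitSpaceToGIT K j a) := by
  refine isHomeomorph_iff_exists_inverse.2 ⟨?_, Quot.map id fun _ _ h => (gitRel_iff hK ha).1 h,
    ?_, ?_, ?_⟩
  · exact continuous_quot_lift _ continuous_quot_mk
  · rintro ⟨x⟩
    rfl
  · rintro ⟨x⟩
    rfl
  · exact continuous_quot_lift _ continuous_quot_mk

/-- Equality in `Quot` only means equivalence under the relation generated by `gitRel`. The orbit
itself is an invariant that descends, so it can be read off from the class. -/
theorem mem_complexOrbit_of_quot_eq {K : Subgroup (Fin N → Circle)}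
    (hK : IsClosed (K : Set (Fin N → Circle))) {j : Fin 3} {a : Param K}
    (ha : a ∈ regularValues K) {x y : semistable K j a}
    (h : Quot.mk (gitRel K j a) x = Quot.mk (gitRel K j a) y) :
    y.1 ∈ complexOrbit K j x.1 := by
  let f : GITQuotient K j a → Set (HN N) := Quot.lift (fun x => complexOrbit K j x.1) (by
    intro x y hxy
    rw [gitRel_iff hK ha] at hxy
    ext p
    exact ⟨fun hp => complexOrbit_trans (complexOrbit_symm hxy) hp,
      fun hp => complexOrbit_trans hxy hp⟩)
  have h1 : complexOrbit K j x.1 = complexOrbit K j y.1 := congrArg f h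
  rw [h1]
  exact self_mem_complexOrbit K j y.1

/-- The injective half of the Kempf–Ness correspondence; it yields the uniqueness of natural
morphisms. -/
theorem varietyToGIT_injective {K : Subgroup (Fin N → Circle)}
    (hK : IsClosed (K : Set (Fin N → Circle))) {j : Fin 3} {a : Param K}
    (ha : a ∈ regularValues K) : Function.Injective (varietyToGIT K j a) := by
  rintro ⟨x⟩ ⟨y⟩ h
  have h1 := mem_complexOrbit_of_quot_eq hK ha h
  exact mk_eq_mk_iff.2 (exists_torusAct_of_mem_complexOrbit
    (coordSpan_coordSupport_of_regular ha x.2) h1 (by rw [x.2, y.2]))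

/-! ### Natural morphisms -/

/-- The map of level sets which induces the natural morphism. -/
def levelMap {K : Subgroup (Fin N → Circle)} {j : Fin 3} {a b : Param K} (hb : b ∈ regularValues K)
    (h : semistable K j a ⊆ semistable K j b) (x : LevelSet K a) : LevelSet K b :=
  ⟨retract K j (b j) x.1,
    momentMap_retract_of_semistable hb (h (levelSet_subset_semistable K j a x.2))⟩

/-- The natural morphism `X(a) → X(b)` for an inclusion of semistable loci and a regular `b`. -/
def naturalMap {K : Subgroup (Fin N → Circle)} {j : Fin 3} {a b : Param K}
    (hb : b ∈ regularValues K) (h : semistable K j a ⊆ semistable K j b) :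
    Variety K a → Variety K b :=
  Quotient.map (levelMap hb h) (by
    rintro x y ⟨κ, hκ, hy⟩
    refine exists_retract_eq_torusAct hb (h (levelSet_subset_semistable K j a x.2)) ?_
    rw [hy]
    exact torusAct_mem_complexOrbit K j x.1 hκ)

theorem isNaturalMorphism_naturalMap {K : Subgroup (Fin N → Circle)} {j : Fin 3} {a b : Param K}
    (hab : ∀ l, l ≠ j → a l = b l) (hb : b ∈ regularValues K)
    (h : semistable K j a ⊆ semistable K j b) : IsNaturalMorphism K j (naturalMap hb h) := by
  refine ⟨hab, h, ?_⟩
  rintro ⟨x⟩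
  refine Quot.sound ⟨x.1, ⟨subset_closure ?_, subset_closure ?_⟩,
    h (levelSet_subset_semistable K j a x.2)⟩
  · exact complexOrbit_symm (retract_mem_complexOrbit K j (b j) x.1)
  · exact self_mem_complexOrbit K j x.1

theorem eq_naturalMap {K : Subgroup (Fin N → Circle)} (hK : IsClosed (K : Set (Fin N → Circle)))
    {j : Fin 3} {a b : Param K} (hb : b ∈ regularValues K)
    (h : semistable K j a ⊆ semistable K j b) {f : Variety K a → Variety K b}
    (hf : IsNaturalMorphism K j f) : f = naturalMap hb h := by
  obtain ⟨h1, h2, h3⟩ := hf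
  obtain ⟨-, h4, h5⟩ := isNaturalMorphism_naturalMap h1 hb h
  exact funext fun x => varietyToGIT_injective hK (j := j) hb ((h3 x).trans (h5 x).symm)

theorem continuous_naturalMap {K : Subgroup (Fin N → Circle)} {j : Fin 3} {a b : Param K}
    (hb : b ∈ regularValues K) (h : semistable K j a ⊆ semistable K j b) :
    Continuous (naturalMap hb h) := by
  refine Continuous.quotient_map' (Continuous.subtype_mk ?_ _) _
  exact (contDiffOn_retract K j (b j)).continuousOn.comp_continuous continuous_subtype_val
    fun x => mem_retractDomain_of_semistable hb (h (levelSet_subset_semistable K j a x.2))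

/-- Both retractions move along `K_ℂ`-orbits, and the result is back in `μ⁻¹(a)`, where a
`K_ℂ`-orbit is at most one `K`-orbit. -/
theorem naturalMap_naturalMap {K : Subgroup (Fin N → Circle)} {j : Fin 3} {a b : Param K}
    (ha : a ∈ regularValues K) (hb : b ∈ regularValues K)
    (h : semistable K j a ⊆ semistable K j b) (h' : semistable K j b ⊆ semistable K j a)
    (x : Variety K a) : naturalMap ha h' (naturalMap hb h x) = x := by
  obtain ⟨x⟩ := x
  refine mk_eq_mk_iff.2 (exists_torusAct_of_mem_complexOrbit (j := j)
    (coordSpan_coordSupport_of_regular ha (levelMap ha h' (levelMap hb h x)).2) ?_ ?_)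
  · exact complexOrbit_trans
      (complexOrbit_symm (retract_mem_complexOrbit K j (a j) (levelMap hb h x).1))
      (complexOrbit_symm (retract_mem_complexOrbit K j (b j) x.1))
  · rw [x.2, (levelMap ha h' (levelMap hb h x)).2]

/-- The natural morphism between regular parameters with the same semistable locus. -/
def naturalHomeomorph {K : Subgroup (Fin N → Circle)} {j : Fin 3} {a b : Param K}
    (ha : a ∈ regularValues K) (hb : b ∈ regularValues K)
    (h : semistable K j a = semistable K j b) : Variety K a ≃ₜ Variety K b where
  toFun := naturalMap hb h.subset
  invFun := naturalMap ha h.superset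
  left_inv := naturalMap_naturalMap ha hb h.subset h.superset
  right_inv := naturalMap_naturalMap hb ha h.superset h.subset
  continuous_toFun := continuous_naturalMap hb h.subset
  continuous_invFun := continuous_naturalMap ha h.superset

/-! ### Slices -/

/-- The map `σ` is an immersion at `u` transverse to the tangent space `k p + I_j k p` of the
`K_ℂ`-orbit. -/
def IsTransverse (K : Subgroup (Fin N → Circle)) (j : Fin 3) {E : Type*} [NormedAddCommGroup E]
    [NormedSpace ℝ E] (σ : E → HN N) (u : E) : Prop :=
  ∀ v, (∃ X ∈ lieAlg K, ∃ Y ∈ lieAlg K,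
    fderiv ℝ σ u v = infAct X (σ u) + complexStr j (infAct Y (σ u))) → v = 0

/-- The derivative of `σ` at `u` is `I_j`-linear modulo `k p + I_j k p`. -/
def IsHolomorphicMod (K : Subgroup (Fin N → Circle)) (j : Fin 3) {E : Type*}
    [NormedAddCommGroup E] [NormedSpace ℂ E] (σ : E → HN N) (u : E) : Prop :=
  ∀ v, ∃ X ∈ lieAlg K, ∃ Y ∈ lieAlg K,
    fderiv ℝ σ u (Complex.I • v) - complexStr j (fderiv ℝ σ u v) =
      infAct X (σ u) + complexStr j (infAct Y (σ u))

theorem infAct_zero (ξ : HN N) : infAct 0 ξ = 0 := by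
  funext i
  simp [infAct]

theorem complexStr_zero (j : Fin 3) : complexStr j (0 : HN N) = 0 :=
  funext fun _ => mul_zero _

/-- `dμ` kills the tangent vectors of `σ` and those of the `K`-orbit, but no nonzero vector of `I_j
k p`. Transversality to `K`-orbits inside the level set thus upgrades to transversality to
`K_ℂ`-orbits. -/
theorem IsSlice.isTransverse {K : Subgroup (Fin N → Circle)} {a : Param K}
    (ha : a ∈ regularValues K) {E : Type} [NormedAddCommGroup E] [NormedSpace ℝ E] {s : Set E}
    (hs : IsOpen s) {φ : E → Variety K a} {σ : E → HN N} (h : IsSlice K a s φ σ) (j : Fin 3)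
    {u : E} (hu : u ∈ s) : IsTransverse K j σ u := by
  obtain ⟨h1, h2, h3⟩ := h
  rintro v ⟨X, hX, Y, hY, hv⟩
  obtain ⟨hm, -⟩ := h2 u hu
  have hd := ((h1.contDiffAt (hs.mem_nhds hu)).differentiableAt (by simp)).hasFDerivAt
  have hc := (hasFDerivAt_momentMap K (σ u)).comp u hd
  have hconst : HasFDerivAt (momentMap K ∘ σ) (0 : E →L[ℝ] Param K) u := by
    refine (hasFDerivAt_const a u).congr_of_eventuallyEq ?_
    filter_upwards [hs.mem_nhds hu] with x hx
    exact (h2 x hx).1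
  have h4 : momentDeriv K (σ u) (fderiv ℝ σ u v) = 0 := DFunLike.congr_fun (hc.unique hconst) v
  rw [hv, map_add, momentDeriv_infAct, zero_add] at h4
  have h5 : (⟨Y, hY⟩ : lieAlg K) = 0 := eq_zero_of_momentDeriv_complexStr (j := j)
    (coordSpan_coordSupport_of_regular ha hm) (congrFun h4 j)
  have h6 : Y = 0 := congrArg Subtype.val h5
  refine h3 u hu v ⟨X, hX, ?_⟩
  rw [hv, h6, infAct_zero, complexStr_zero, add_zero]

/-- Product rule: the group element acts on the tangent vector, and its own variation adds only a
vector of `I_j k p`. No formula for `W` is needed. -/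
theorem exists_fderiv_retract {K : Subgroup (Fin N → Circle)} {j : Fin 3} {α : kDual K}
    {E : Type*} [NormedAddCommGroup E] [NormedSpace ℝ E] {σ : E → HN N} {u : E}
    (hσ : DifferentiableAt ℝ σ u) (hu : σ u ∈ retractDomain K j α) :
    ∃ W : E → lieAlg K, ∀ v, fderiv ℝ (fun x => retract K j α (σ x)) u v =
      scaleAct j (retractParam K j α (σ u)) (fderiv ℝ σ u v) +
        complexStr j (infAct (W v) (retract K j α (σ u))) := by
  have h1 := ((contDiffAt_retractParam hu).2.differentiableAt (by simp)).hasFDerivAt.comp u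
    hσ.hasFDerivAt
  have h2 := ((lieAlg K).subtypeL.hasFDerivAt (x := retractParam K j α (σ u))).comp u h1
  obtain ⟨L, hL, hLv⟩ := exists_hasFDerivAt_scaleAct j h2 hσ.hasFDerivAt
  refine ⟨fun v => fderiv ℝ (retractParam K j α) (σ u) (fderiv ℝ σ u v), fun v => ?_⟩
  have h3 : HasFDerivAt (fun x => retract K j α (σ x)) L u := hL
  rw [h3.fderiv, hLv]
  rfl

/-- The linear map `scaleAct` carries the orbit directions at `σ u` to those at the retracted point,
and the extra term is itself an orbit direction. Applying the inverse scaling returns to the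
hypothesis. -/
theorem IsTransverse.retract {K : Subgroup (Fin N → Circle)} {j : Fin 3} {α : kDual K}
    {E : Type*} [NormedAddCommGroup E] [NormedSpace ℝ E] {σ : E → HN N} {u : E}
    (h : IsTransverse K j σ u) (hσ : DifferentiableAt ℝ σ u)
    (hu : σ u ∈ retractDomain K j α) :
    IsTransverse K j (fun x => ToricHK.retract K j α (σ x)) u := by
  obtain ⟨W, hW⟩ := exists_fderiv_retract hσ hu
  rintro v ⟨X, hX, Y, hY, hv⟩
  rw [hW] at hv
  refine h v ⟨X, hX, Y + -(W v).1, Submodule.add_mem _ hY (Submodule.neg_mem _ (W v).2), ?_⟩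
  set T := (retractParam K j α (σ u) : Fin N → ℝ) with hT
  have h1 : scaleAct j T (fderiv ℝ σ u v) = scaleAct j T
      (infAct X (σ u) + complexStr j (infAct (Y + -(W v).1) (σ u))) := by
    rw [scaleAct_add, scaleAct_complexStr, scaleAct_infAct, scaleAct_infAct, infAct_add,
      infAct_neg, complexStr_add, complexStr_neg]
    have h2 : scaleAct j T (σ u) = ToricHK.retract K j α (σ u) := rfl
    rw [h2, ← add_assoc, ← hv]
    abel
  have h3 := congrArg (scaleAct j (-T)) h1
  rwa [scaleAct_scaleAct, scaleAct_scaleAct, neg_add_cancel, scaleAct_zero, scaleAct_zero] at h3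

theorem IsHolomorphicMod.retract {K : Subgroup (Fin N → Circle)} {j : Fin 3} {α : kDual K}
    {E : Type*} [NormedAddCommGroup E] [NormedSpace ℂ E] {σ : E → HN N} {u : E}
    (h : IsHolomorphicMod K j σ u) (hσ : DifferentiableAt ℝ σ u)
    (hu : σ u ∈ retractDomain K j α) :
    IsHolomorphicMod K j (fun x => ToricHK.retract K j α (σ x)) u := by
  obtain ⟨W, hW⟩ := exists_fderiv_retract hσ hu
  intro v
  obtain ⟨X, hX, Y, hY, hv⟩ := h v
  -- The term `-I_j (I_j (W v) p)` equals `(W v) p`, hence the contribution `W v` to the `k p` part.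
  refine ⟨X + W v, Submodule.add_mem _ hX (W v).2, Y + W (Complex.I • v),
    Submodule.add_mem _ hY (W (Complex.I • v)).2, ?_⟩
  rw [hW, hW, complexStr_add, complexStr_complexStr, ← scaleAct_complexStr]
  have h1 := congrArg (scaleAct j (retractParam K j α (σ u))) hv
  rw [scaleAct_sub, scaleAct_add, scaleAct_infAct, scaleAct_complexStr _ _ (infAct Y (σ u)),
    scaleAct_infAct] at h1
  rw [infAct_add, infAct_add, complexStr_add]
  have h2 : scaleAct j (retractParam K j α (σ u)) (σ u) = ToricHK.retract K j α (σ u) := rfl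
  rw [h2] at h1
  rw [add_sub_add_comm, h1]
  abel

theorem IsTransverse.eq_zero_of_infAct {K : Subgroup (Fin N → Circle)} {j : Fin 3}
    {E : Type*} [NormedAddCommGroup E] [NormedSpace ℝ E] {σ : E → HN N} {u : E}
    (h : IsTransverse K j σ u) {v : E} (hv : ∃ X ∈ lieAlg K, fderiv ℝ σ u v = infAct X (σ u)) :
    v = 0 := by
  obtain ⟨X, hX, hv⟩ := hv
  refine h v ⟨X, hX, 0, Submodule.zero_mem _, ?_⟩
  rw [hv, infAct_zero, complexStr_zero, add_zero]

/-- A family of points of the semistable locus transverse to the `K_ℂ`-orbits induces a slice. -/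
theorem isSlice_retract {K : Subgroup (Fin N → Circle)} {j : Fin 3} {b : Param K}
    (hb : b ∈ regularValues K) {E : Type} [NormedAddCommGroup E] [NormedSpace ℝ E] {s : Set E}
    (hs : IsOpen s) {σ : E → HN N} (hσ : ContDiffOn ℝ ∞ σ s)
    (hss : ∀ u ∈ s, σ u ∈ semistable K j b) (ht : ∀ u ∈ s, IsTransverse K j σ u)
    {φ : E → Variety K b} (hφ : ∀ u (hu : u ∈ s), φ u = Quotient.mk (orbitSetoid K b)
      ⟨retract K j (b j) (σ u), momentMap_retract_of_semistable hb (hss u hu)⟩) :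
    IsSlice K b s φ (fun x => retract K j (b j) (σ x)) := by
  refine ⟨(contDiffOn_retract K j (b j)).comp hσ fun u hu =>
    mem_retractDomain_of_semistable hb (hss u hu), fun u hu => ⟨_, hφ u hu⟩, fun u hu v hv => ?_⟩
  exact ((ht u hu).retract ((hσ.contDiffAt (hs.mem_nhds hu)).differentiableAt (by simp))
    (mem_retractDomain_of_semistable hb (hss u hu))).eq_zero_of_infAct hv

/-! ### Complex coordinates -/

/-- The complex coordinates `(z, w)` of `ℍᴺ`. -/
def coordEquiv : HN N ≃L[ℝ] (Fin N → ℂ × ℂ) :=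
  LinearEquiv.toContinuousLinearEquiv
    { toFun := fun ξ l => (zCoord (ξ l), wCoord (ξ l))
      invFun := fun p l => mkQ (p l).1 (p l).2
      map_add' := fun ξ η => by
        funext l
        refine Prod.ext ?_ ?_ <;> apply Complex.ext <;> simp [zCoord, wCoord]
      map_smul' := fun c ξ => by
        funext l
        refine Prod.ext ?_ ?_ <;> apply Complex.ext <;> simp [zCoord, wCoord]
      left_inv := fun ξ => rfl
      right_inv := fun p => rfl }

theorem coordEquiv_apply (ξ : HN N) (l : Fin N) :
    coordEquiv ξ l = (zCoord (ξ l), wCoord (ξ l)) := rfl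

theorem coordEquiv_complexStr (ξ : HN N) :
    coordEquiv (complexStr 0 ξ) = Complex.I • coordEquiv ξ := by
  funext l
  refine Prod.ext ?_ ?_ <;> apply Complex.ext <;> simp [coordEquiv_apply, complexStr, zCoord, wCoord,
    re_imUnit, imI_imUnit, imJ_imUnit, imK_imUnit]

/-- The action of `(ℂˣ)ᴺ` in complex coordinates. -/
def mulAct (ζ : Fin N → ℂ) (p : Fin N → ℂ × ℂ) : Fin N → ℂ × ℂ :=
  fun l => ((p l).1 * ζ l, (p l).2 * (ζ l)⁻¹)

/-- The infinitesimal action of `ℂᴺ` in complex coordinates. -/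
def infMul (A : Fin N → ℂ) (p : Fin N → ℂ × ℂ) : Fin N → ℂ × ℂ :=
  fun l => (A l * (p l).1, -(A l * (p l).2))

theorem coordEquiv_complexAct (ζ : Fin N → ℂ) (ξ : HN N) :
    coordEquiv (complexAct 0 ζ ξ) = mulAct ζ (coordEquiv ξ) :=
  funext fun l => Prod.ext (complexAct_coord ζ ξ l).1 (complexAct_coord ζ ξ l).2

theorem mulAct_infMul (ζ A : Fin N → ℂ) (p : Fin N → ℂ × ℂ) :
    mulAct ζ (infMul A p) = infMul A (mulAct ζ p) := by
  funext l
  refine Prod.ext ?_ ?_ <;> simp [mulAct, infMul] <;> ring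

/-- `mulAct ζ` as a continuous linear map. -/
def mulActL (ζ : Fin N → ℂ) : (Fin N → ℂ × ℂ) →L[ℂ] (Fin N → ℂ × ℂ) :=
  LinearMap.toContinuousLinearMap
    { toFun := mulAct ζ
      map_add' := fun p q => by
        funext l
        refine Prod.ext ?_ ?_ <;> simp [mulAct, add_mul]
      map_smul' := fun c p => by
        funext l
        refine Prod.ext ?_ ?_ <;> simp [mulAct, mul_assoc] }

theorem mulActL_apply (ζ : Fin N → ℂ) (p : Fin N → ℂ × ℂ) : mulActL ζ p = mulAct ζ p := rfl

/-- The complexified Lie algebra of `K`. -/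
def complexLie (K : Subgroup (Fin N → Circle)) : Set (Fin N → ℂ) :=
  {A | (fun l => (A l).re) ∈ lieAlg K ∧ (fun l => (A l).im) ∈ lieAlg K}

theorem exp_mem_complexification {K : Subgroup (Fin N → Circle)} {A : Fin N → ℂ}
    (hA : A ∈ complexLie K) : (fun l => Complex.exp (A l)) ∈ complexification K := by
  refine ⟨torusExp ((1 / (2 * Real.pi)) • fun l => (A l).im), hA.2 _,
    (-(1 / (2 * Real.pi))) • fun l => (A l).re, Submodule.smul_mem _ _ hA.1, fun l => ?_⟩
  have h1 : 2 * Real.pi * (1 / (2 * Real.pi) * (A l).im) = (A l).im := by field_simp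
  have h2 : -2 * Real.pi * (-(1 / (2 * Real.pi)) * (A l).re) = (A l).re := by field_simp
  simp only [torusExp, Pi.smul_apply, smul_eq_mul]
  rw [h1, h2, Circle.coe_exp, Complex.ofReal_exp, ← Complex.exp_add]
  congr 1
  apply Complex.ext <;> simp

/-- In complex coordinates `X` acts as `2π√-1 X` and `I₁ Y` as `-2π Y`, so `A = -2π Y + 2π√-1 X`. -/
theorem infMul_coordEquiv {K : Subgroup (Fin N → Circle)} {A : Fin N → ℂ}
    (hA : A ∈ complexLie K) (ξ : HN N) : ∃ X ∈ lieAlg K, ∃ Y ∈ lieAlg K,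
      infMul A (coordEquiv ξ) = coordEquiv (infAct X ξ + complexStr 0 (infAct Y ξ)) := by
  refine ⟨(1 / (2 * Real.pi)) • fun l => (A l).im, Submodule.smul_mem _ _ hA.2,
    (-(1 / (2 * Real.pi))) • fun l => (A l).re, Submodule.smul_mem _ _ hA.1, ?_⟩
  have h1 : ∀ x, 2 * Real.pi * (1 / (2 * Real.pi) * x) = x := fun x => by field_simp
  have h2 : ∀ x, 2 * Real.pi * (-(1 / (2 * Real.pi)) * x) = -x := fun x => by field_simp
  funext l
  refine Prod.ext ?_ ?_ <;> apply Complex.ext <;>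
    simp only [coordEquiv_apply, infMul, infAct, complexStr, Pi.smul_apply, Pi.add_apply,
      smul_eq_mul, h1, h2] <;>
    simp [zCoord, wCoord, re_imUnit, imI_imUnit, imJ_imUnit, imK_imUnit] <;> ring

theorem coordEquiv_infAct_add {K : Subgroup (Fin N → Circle)} {X Y : Fin N → ℝ}
    (hX : X ∈ lieAlg K) (hY : Y ∈ lieAlg K) (ξ : HN N) : ∃ A ∈ complexLie K,
      coordEquiv (infAct X ξ + complexStr 0 (infAct Y ξ)) = infMul A (coordEquiv ξ) := by
  refine ⟨fun l => ⟨-(2 * Real.pi) * Y l, 2 * Real.pi * X l⟩,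
    ⟨Submodule.smul_mem _ (-(2 * Real.pi)) hY, Submodule.smul_mem _ (2 * Real.pi) hX⟩, ?_⟩
  funext l
  refine Prod.ext ?_ ?_ <;> apply Complex.ext <;>
    simp only [coordEquiv_apply, infMul, infAct, complexStr, Pi.add_apply] <;>
    simp [zCoord, wCoord, re_imUnit, imI_imUnit, imJ_imUnit, imK_imUnit] <;> ring

/-! ### Frames -/

/-- A frame of `K`: a set of coordinates which restrict to a basis of `k*`, the dual basis of `k`
(extended by zero), and the choice of one of the coordinates `z_i`, `w_i` for each `i`. -/
structure Frame (K : Subgroup (Fin N → Circle)) where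
  idx : Finset (Fin N)
  vec : Fin N → lieAlg K
  vec_eq_zero : ∀ i, i ∉ idx → vec i = 0
  vec_apply : ∀ l ∈ idx, ∀ i, (vec i).1 l = if l = i then 1 else 0
  coordSpan_idx : coordSpan K idx = ⊤
  isZ : Fin N → Bool

/-- A maximal independent set of weights in `S` is a basis of `k*`. Restriction to these coordinates
is then an isomorphism `k → ℝ^b`, and its inverse provides the dual basis. -/
theorem exists_frame {K : Subgroup (Fin N → Circle)} {S : Set (Fin N)}
    (hS : coordSpan K S = ⊤) (f : Fin N → Bool) :
    ∃ F : Frame K, (∀ i ∈ F.idx, i ∈ S) ∧ F.isZ = f := by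
  classical
  obtain ⟨b, hbS, -, hb, hli⟩ := exists_linearIndepOn_extension (K := ℝ) (v := iotaStar K)
    (s := ∅) (t := S) (linearIndepOn_empty ℝ _) (Set.empty_subset S)
  have htop : coordSpan K b = ⊤ := by
    rw [← top_le_iff, ← hS]
    exact Submodule.span_le.2 hb
  let ev : lieAlg K →ₗ[ℝ] (b → ℝ) :=
    { toFun := fun X i => X.1 i
      map_add' := fun _ _ => rfl
      map_smul' := fun _ _ => rfl }
  have hinj : Function.Injective ev := by
    refine (injective_iff_map_eq_zero _).2 fun X hX => coordSpan_eq_top_iff.1 htop X fun i hi => ?_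
    exact congrFun hX ⟨i, hi⟩
  have hfr : Module.finrank ℝ (lieAlg K) = Module.finrank ℝ (b → ℝ) := by
    have h1 : Module.finrank ℝ (kDual K) = Fintype.card b :=
      Module.finrank_eq_card_basis (Module.Basis.mk (v := fun i : b => iotaStar K i) hli (by
        rw [← htop, coordSpan, Set.image_eq_range]))
    have h2 : Module.finrank ℝ (lieAlg K) = Module.finrank ℝ (kDual K) := by
      rw [← (LinearMap.toContinuousLinearMap (𝕜 := ℝ) (E := lieAlg K) (F' := ℝ)).finrank_eq]
      exact Subspace.dual_finrank_eq.symm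
    rw [h2, h1, Module.finrank_pi]
  have hsurj := (LinearMap.injective_iff_surjective_of_finrank_eq_finrank hfr).1 hinj
  choose g hg using hsurj
  refine ⟨⟨b.toFinset, fun i => g fun l => if l.1 = i then 1 else 0, ?_, ?_, ?_, f⟩, ?_, rfl⟩
  · intro i hi
    apply hinj
    rw [hg, map_zero]
    funext l
    exact if_neg (by rintro rfl; exact hi (Set.mem_toFinset.2 l.2))
  · intro l hl i
    exact congrFun (hg fun l => if l.1 = i then 1 else 0) ⟨l, Set.mem_toFinset.1 hl⟩
  · rw [Set.coe_toFinset, htop]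
  · intro i hi
    exact hbS (Set.mem_toFinset.1 hi)

namespace Frame

variable {K : Subgroup (Fin N → Circle)} (F : Frame K)

theorem sum_smul_vec (X : lieAlg K) : ∑ i, X.1 i • F.vec i = X := by
  refine sub_eq_zero.1 (coordSpan_eq_top_iff.1 F.coordSpan_idx _ fun l hl => ?_)
  have h : (∑ i, X.1 i • F.vec i : lieAlg K).1 l = ∑ i, X.1 i * (F.vec i).1 l := by
    rw [AddSubmonoidClass.coe_finsetSum, Finset.sum_apply]
    rfl
  rw [Submodule.coe_sub, Pi.sub_apply, h]
  simp [F.vec_apply l hl]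

theorem sum_vec_mul {X : Fin N → ℝ} (hX : X ∈ lieAlg K) (l : Fin N) :
    ∑ i, (F.vec i).1 l * X i = X l := by
  have h := congrArg (fun Y : lieAlg K => Y.1 l) (F.sum_smul_vec ⟨X, hX⟩)
  simp only [AddSubmonoidClass.coe_finsetSum, Finset.sum_apply] at h
  rw [← h]
  exact Finset.sum_congr rfl fun i _ => mul_comm _ _

theorem card_idx : F.idx.card = Module.finrank ℝ (lieAlg K) := by
  let ev : lieAlg K →ₗ[ℝ] (F.idx → ℝ) :=
    { toFun := fun X i => X.1 i
      map_add' := fun _ _ => rfl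
      map_smul' := fun _ _ => rfl }
  have hinj : Function.Injective ev := by
    refine (injective_iff_map_eq_zero _).2 fun X hX =>
      coordSpan_eq_top_iff.1 F.coordSpan_idx X fun i hi => ?_
    exact congrFun hX ⟨i, hi⟩
  have hsurj : Function.Surjective ev := by
    intro c
    refine ⟨∑ i : F.idx, c i • F.vec i, funext fun l => ?_⟩
    have h : (∑ i : F.idx, c i • F.vec i : lieAlg K).1 l = ∑ i : F.idx, c i * (F.vec i).1 l := by
      rw [AddSubmonoidClass.coe_finsetSum, Finset.sum_apply]
      rfl
    refine h.trans ?_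
    rw [Finset.sum_eq_single_of_mem l (Finset.mem_univ l)]
    · rw [F.vec_apply l l.2, if_pos rfl, mul_one]
    · intro i _ hi
      rw [F.vec_apply l l.2, if_neg fun h => hi (Subtype.ext h.symm), mul_zero]
  have := (LinearEquiv.ofBijective ev ⟨hinj, hsurj⟩).finrank_eq
  rw [this, Module.finrank_pi, Fintype.card_coe]

/-- The space of the coordinates outside of the frame. -/
abbrev Slice : Type := {l // l ∉ F.idx} → ℂ × ℂ

theorem finrank_slice : Module.finrank ℂ F.Slice = 2 * quotDim K := by
  rw [Module.finrank_pi_fintype]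
  simp [quotDim, F.card_idx, mul_comm]

theorem finrank_real_slice : Module.finrank ℝ F.Slice = 4 * quotDim K := by
  rw [finrank_real_of_complex, F.finrank_slice]
  ring

theorem vec_combination_mem (c : Fin N → ℂ) :
    (fun l => ∑ i, ((F.vec i).1 l : ℂ) * c i) ∈ complexLie K := by
  constructor
  · have h : (fun l => (∑ i, ((F.vec i).1 l : ℂ) * c i).re) = ∑ i, (c i).re • (F.vec i).1 := by
      funext l
      simp [mul_comm]
    rw [h]
    exact Submodule.sum_mem _ fun i _ => Submodule.smul_mem _ _ (F.vec i).2
  · have h : (fun l => (∑ i, ((F.vec i).1 l : ℂ) * c i).im) = ∑ i, (c i).im • (F.vec i).1 := by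
      funext l
      simp [mul_comm]
    rw [h]
    exact Submodule.sum_mem _ fun i _ => Submodule.smul_mem _ _ (F.vec i).2

theorem sum_vec_mul_complex {A : Fin N → ℂ} (hA : A ∈ complexLie K) (l : Fin N) :
    ∑ i, ((F.vec i).1 l : ℂ) * A i = A l := by
  apply Complex.ext
  · simpa using F.sum_vec_mul hA.1 l
  · simpa using F.sum_vec_mul hA.2 l

/-- The chosen one of the coordinates `z_i`, `w_i`. -/
def marked (p : Fin N → ℂ × ℂ) (i : Fin N) : ℂ := if F.isZ i then (p i).1 else (p i).2

/-- The logarithm of the torus element which normalizes the chosen coordinate to one, for the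
indices of the frame. -/
def logCoord (p : Fin N → ℂ × ℂ) (i : Fin N) : ℂ :=
  if i ∈ F.idx then
    (if F.isZ i then -Complex.log (F.marked p i) else Complex.log (F.marked p i))
  else 0

/-- The logarithm of the element of `K_ℂ` which normalizes the chosen coordinates to one. -/
def logVec (p : Fin N → ℂ × ℂ) : Fin N → ℂ := fun l => ∑ i, ((F.vec i).1 l : ℂ) * F.logCoord p i

theorem logVec_mem (p : Fin N → ℂ × ℂ) : F.logVec p ∈ complexLie K := F.vec_combination_mem _

theorem logVec_of_mem (p : Fin N → ℂ × ℂ) {l : Fin N} (hl : l ∈ F.idx) :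
    F.logVec p l = F.logCoord p l := by
  rw [logVec, Finset.sum_eq_single_of_mem l (Finset.mem_univ l)]
  · rw [F.vec_apply l hl, if_pos rfl, Complex.ofReal_one, one_mul]
  · intro i _ hi
    rw [F.vec_apply l hl, if_neg hi.symm, Complex.ofReal_zero, zero_mul]

/-- The coordinates outside of the frame, after normalization. -/
def proj (p : Fin N → ℂ × ℂ) : F.Slice :=
  fun l => mulAct (fun l => Complex.exp (F.logVec p l)) p l

/-- The components of the complex moment map in the frame. -/
def complexMoment (p : Fin N → ℂ × ℂ) (i : Fin N) : ℂ :=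
  ∑ l, ((F.vec i).1 l : ℂ) * ((p l).1 * (p l).2)

/-- The components of the parameter `β` in the frame. -/
def paramCoord (a : Param K) (i : Fin N) : ℂ :=
  ((a 1 (F.vec i) : ℂ) + Complex.I * (a 2 (F.vec i) : ℂ)) / (-2 * Real.pi * Complex.I)

/-- The value of `z_i w_i` determined by the equation `μ_ℂ = β`. -/
def quad (b : Fin N → ℂ) (u : F.Slice) (i : Fin N) : ℂ :=
  b i - ∑ l, ((F.vec i).1 l.1 : ℂ) * ((u l).1 * (u l).2)

/-- The global slice of the `K_ℂ`-action on the set where the chosen coordinates do not vanish. -/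
def globalSlice (b : Fin N → ℂ) (u : F.Slice) : Fin N → ℂ × ℂ := fun l =>
  if h : l ∈ F.idx then (if F.isZ l then (1, F.quad b u l) else (F.quad b u l, 1)) else u ⟨l, h⟩

theorem globalSlice_of_notMem (b : Fin N → ℂ) (u : F.Slice) (l : {l // l ∉ F.idx}) :
    F.globalSlice b u l = u l := by
  rw [globalSlice, dif_neg l.2]

theorem globalSlice_of_mem (b : Fin N → ℂ) (u : F.Slice) {l : Fin N} (hl : l ∈ F.idx) :
    F.globalSlice b u l = if F.isZ l then (1, F.quad b u l) else (F.quad b u l, 1) := by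
  rw [globalSlice, dif_pos hl]

theorem marked_globalSlice (b : Fin N → ℂ) (u : F.Slice) {l : Fin N} (hl : l ∈ F.idx) :
    F.marked (F.globalSlice b u) l = 1 := by
  rw [marked, F.globalSlice_of_mem b u hl]
  split_ifs <;> rfl

theorem logVec_globalSlice (b : Fin N → ℂ) (u : F.Slice) : F.logVec (F.globalSlice b u) = 0 := by
  funext l
  refine Finset.sum_eq_zero fun i _ => ?_
  by_cases hi : i ∈ F.idx
  · simp [logCoord, F.marked_globalSlice b u hi]
  · simp [F.vec_eq_zero i hi]

theorem proj_globalSlice (b : Fin N → ℂ) (u : F.Slice) : F.proj (F.globalSlice b u) = u := by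
  funext l
  simp only [proj, F.logVec_globalSlice, mulAct, F.globalSlice_of_notMem]
  simp

theorem sum_split (f : Fin N → ℂ) :
    ∑ l, f l = ∑ l ∈ F.idx, f l + ∑ l : {l // l ∉ F.idx}, f l := by
  rw [← Finset.sum_add_sum_compl F.idx f]
  congr 1
  exact Finset.sum_subtype F.idxᶜ (fun l => by simp) f

/-- By duality only the index `i` of the frame enters the `i`-th component, with product `z_i w_i =
quad`, which is chosen to complete the free coordinates to `b i`. Off the frame the vector is zero,
hence the condition on `b`. -/
theorem complexMoment_globalSlice {b : Fin N → ℂ} (hb : ∀ i, i ∉ F.idx → b i = 0) (u : F.Slice)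
    (i : Fin N) : F.complexMoment (F.globalSlice b u) i = b i := by
  by_cases hi : i ∈ F.idx
  · rw [complexMoment, F.sum_split]
    have h1 : ∑ l ∈ F.idx, ((F.vec i).1 l : ℂ) *
        ((F.globalSlice b u l).1 * (F.globalSlice b u l).2) = F.quad b u i := by
      rw [Finset.sum_eq_single_of_mem i hi]
      · rw [F.vec_apply i hi, F.globalSlice_of_mem b u hi]
        split_ifs <;> simp_all
      · intro l hl hli
        rw [F.vec_apply l hl, if_neg hli]
        simp
    rw [h1]
    simp only [F.globalSlice_of_notMem, quad]
    ring
  · simp [complexMoment, F.vec_eq_zero i hi, hb i hi]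

/-- The exponential of `logVec` makes the marked coordinates `1`. Products `z_l w_l` are invariant,
so the partner of a marked coordinate is the product itself, which the moment equation expresses by
the coordinates off the frame. -/
theorem mulAct_logVec {b : Fin N → ℂ} {p : Fin N → ℂ × ℂ} (hp : ∀ i, F.complexMoment p i = b i)
    (hm : ∀ i ∈ F.idx, F.marked p i ≠ 0) :
    mulAct (fun l => Complex.exp (F.logVec p l)) p = F.globalSlice b (F.proj p) := by
  funext l
  by_cases hl : l ∈ F.idx
  · have hq : F.quad b (F.proj p) l = (p l).1 * (p l).2 := by
      have h1 := hp l
      rw [complexMoment, F.sum_split, Finset.sum_eq_single_of_mem l hl] at h1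
      · rw [quad, ← h1, F.vec_apply l hl]
        have h2 : ∀ l' : {l // l ∉ F.idx}, ((F.proj p) l').1 * ((F.proj p) l').2 =
            (p l').1 * (p l').2 := by
          intro l'
          have := Complex.exp_ne_zero (F.logVec p l')
          simp only [proj, mulAct]
          field_simp
        simp [h2]
      · intro l' hl' hne
        rw [F.vec_apply l' hl', if_neg hne]
        simp
    have hml := hm l hl
    rw [F.globalSlice_of_mem b _ hl, hq]
    simp only [mulAct, F.logVec_of_mem p hl, logCoord, if_pos hl]
    by_cases hz : F.isZ l
    · simp only [marked, hz, if_true] at hml ⊢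
      rw [Complex.exp_neg, Complex.exp_log hml]
      refine Prod.ext ?_ ?_
      · simp [hml]
      · simp [mul_comm]
    · simp only [marked, hz] at hml ⊢
      simp only [Bool.false_eq_true, if_false] at hml ⊢
      rw [Complex.exp_log hml]
      refine Prod.ext ?_ ?_
      · simp
      · simp [hml]
  · exact (F.globalSlice_of_notMem b (F.proj p) ⟨l, hl⟩).symm

theorem paramCoord_eq_zero (a : Param K) {i : Fin N} (hi : i ∉ F.idx) : F.paramCoord a i = 0 := by
  simp [paramCoord, F.vec_eq_zero i hi]

theorem paramCoord_momentMap (ξ : HN N) (i : Fin N) :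
    F.paramCoord (momentMap K ξ) i = F.complexMoment (coordEquiv ξ) i := by
  have h : ∀ q : Quaternion ℝ, (momentCoord q 1 : ℂ) + Complex.I * (momentCoord q 2 : ℂ) =
      -2 * Real.pi * Complex.I * (zCoord q * wCoord q) := by
    intro q
    have h1 : momentCoord q 1 = (-2 * Real.pi * Complex.I * zCoord q * wCoord q).re := rfl
    have h2 : momentCoord q 2 = (-2 * Real.pi * Complex.I * zCoord q * wCoord q).im := rfl
    rw [h1, h2, mul_comm Complex.I, Complex.re_add_im]
    ring
  have hpi : (-2 * Real.pi * Complex.I : ℂ) ≠ 0 := by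
    simp [Real.pi_ne_zero]
  rw [paramCoord, div_eq_iff hpi, complexMoment, Finset.sum_mul]
  simp only [momentMap, sum_apply, smul_apply, smul_eq_mul, iotaStar_apply]
  push_cast
  rw [Finset.mul_sum, ← Finset.sum_add_distrib]
  refine Finset.sum_congr rfl fun l _ => ?_
  rw [coordEquiv_apply]
  linear_combination ((F.vec i).1 l : ℂ) * h (ξ l)

/-- The vectors of the frame span `k`, so `μ_ℂ = β` can be tested on them. -/
theorem forall_momentMap_eq_iff {a : Param K} {ξ : HN N} :
    (∀ l, l ≠ 0 → momentMap K ξ l = a l) ↔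
      ∀ i, F.complexMoment (coordEquiv ξ) i = F.paramCoord a i := by
  simp only [← F.paramCoord_momentMap]
  constructor
  · intro h i
    simp only [paramCoord, h 1 (by decide), h 2 (by decide)]
  · intro h
    have hpi : (-2 * Real.pi * Complex.I : ℂ) ≠ 0 := by
      simp [Real.pi_ne_zero]
    have h1 : ∀ i, momentMap K ξ 1 (F.vec i) = a 1 (F.vec i) ∧
        momentMap K ξ 2 (F.vec i) = a 2 (F.vec i) := by
      intro i
      have h2 := (div_left_inj' hpi).1 (h i)
      exact ⟨by simpa using congrArg Complex.re h2, by simpa using congrArg Complex.im h2⟩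
    have h3 : ∀ v w : kDual K, (∀ i, v (F.vec i) = w (F.vec i)) → v = w := by
      intro v w hvw
      ext X
      rw [← F.sum_smul_vec X, map_sum, map_sum]
      simp [hvw]
    intro l hl
    fin_cases l
    · exact absurd rfl hl
    · exact h3 _ _ fun i => (h1 i).1
    · exact h3 _ _ fun i => (h1 i).2

/-! ### Smoothness of the normalization -/

/-- The set on which the logarithms of the chosen coordinates are holomorphic. -/
def slit : Set (Fin N → ℂ × ℂ) := {p | ∀ i ∈ F.idx, F.marked p i ∈ Complex.slitPlane}

theorem globalSlice_mem_slit (b : Fin N → ℂ) (u : F.Slice) : F.globalSlice b u ∈ F.slit := by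
  intro i hi
  rw [F.marked_globalSlice _ _ hi]
  exact Complex.one_mem_slitPlane

theorem contDiff_marked (i : Fin N) : ContDiff ℂ ∞ fun p => F.marked p i := by
  have h : ContDiff ℂ ∞ fun p : Fin N → ℂ × ℂ => p i := contDiff_apply ℂ (ℂ × ℂ) i
  by_cases hi : F.isZ i
  · simp only [marked, hi, if_true]
    exact h.fst
  · simp only [marked, hi, Bool.false_eq_true, if_false]
    exact h.snd

theorem isOpen_slit : IsOpen F.slit := by
  have h : F.slit = ⋂ i ∈ F.idx, (fun p => F.marked p i) ⁻¹' Complex.slitPlane := by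
    ext p
    simp [slit]
  rw [h]
  exact isOpen_biInter_finset fun i _ =>
    Complex.isOpen_slitPlane.preimage (F.contDiff_marked i).continuous

theorem contDiffAt_logCoord {p : Fin N → ℂ × ℂ} (hp : p ∈ F.slit) :
    ContDiffAt ℂ ∞ F.logCoord p := by
  refine contDiffAt_pi.2 fun i => ?_
  by_cases hi : i ∈ F.idx
  · have h : ContDiffAt ℂ ∞ (fun p => Complex.log (F.marked p i)) p :=
      ContDiffAt.comp (g := Complex.log) p (Complex.contDiffAt_log (hp i hi))
        (F.contDiff_marked i).contDiffAt
    by_cases hz : F.isZ i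
    · simp only [logCoord, hi, hz, if_true]
      exact h.neg
    · simp only [logCoord, hi, hz, if_true, Bool.false_eq_true, if_false]
      exact h
  · simp only [logCoord, hi, if_false]
    exact contDiffAt_const

theorem contDiffAt_logVec {p : Fin N → ℂ × ℂ} (hp : p ∈ F.slit) :
    ContDiffAt ℂ ∞ F.logVec p := by
  refine contDiffAt_pi.2 fun l => ContDiffAt.sum fun i _ => contDiffAt_const.mul ?_
  exact contDiffAt_pi.1 (F.contDiffAt_logCoord hp) i

theorem contDiffAt_proj {p : Fin N → ℂ × ℂ} (hp : p ∈ F.slit) : ContDiffAt ℂ ∞ F.proj p := by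
  refine contDiffAt_pi.2 fun l => ?_
  have h1 : ContDiffAt ℂ ∞ (fun p : Fin N → ℂ × ℂ => p l.1) p :=
    (contDiff_apply ℂ (ℂ × ℂ) l.1).contDiffAt
  have h2 : ContDiffAt ℂ ∞ (fun p => Complex.exp (F.logVec p l)) p :=
    (contDiffAt_pi.1 (F.contDiffAt_logVec hp) l).cexp
  exact (h1.fst.mul h2).prodMk (h1.snd.mul (h2.inv (Complex.exp_ne_zero _)))

theorem contDiff_quad (b : Fin N → ℂ) (i : Fin N) : ContDiff ℂ ∞ fun u => F.quad b u i := by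
  refine contDiff_const.sub (ContDiff.sum fun l _ => contDiff_const.mul ?_)
  have h : ContDiff ℂ ∞ fun u : F.Slice => u l := contDiff_apply ℂ (ℂ × ℂ) l
  exact h.fst.mul h.snd

theorem contDiff_globalSlice (b : Fin N → ℂ) : ContDiff ℂ ∞ (F.globalSlice b) := by
  refine contDiff_pi.2 fun l => ?_
  by_cases hl : l ∈ F.idx
  · by_cases hz : F.isZ l
    · simp only [globalSlice, hl, hz, dif_pos, if_true]
      exact contDiff_const.prodMk (F.contDiff_quad b l)
    · simp only [globalSlice, hl, hz, dif_pos, Bool.false_eq_true, if_false]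
      exact (F.contDiff_quad b l).prodMk contDiff_const
  · simp only [globalSlice, hl, dif_neg, not_false_eq_true]
    exact contDiff_apply ℂ (ℂ × ℂ) (⟨l, hl⟩ : {l // l ∉ F.idx})

theorem hasDerivAt_mulAct_exp (A : Fin N → ℂ) (p : Fin N → ℂ × ℂ) :
    HasDerivAt (fun t : ℂ => mulAct (fun l => Complex.exp (t * A l)) p) (infMul A p) 0 := by
  refine hasDerivAt_pi.2 fun l => ?_
  have h1 : HasDerivAt (fun t : ℂ => Complex.exp (t * A l)) (A l) 0 := by
    simpa using ((hasDerivAt_id (0 : ℂ)).mul_const (A l)).cexp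
  have h2 := h1.fun_inv (Complex.exp_ne_zero _)
  refine ((h1.const_mul (p l).1).prodMk (h2.const_mul (p l).2)).congr_deriv ?_
  refine Prod.ext ?_ ?_
  · simp [infMul, mul_comm]
  · simp [infMul, mul_comm]

/-- The normalization is constant along the `K_ℂ`-orbits. -/
theorem fderiv_proj_infMul {p : Fin N → ℂ × ℂ} (hp : p ∈ F.slit) {A : Fin N → ℂ}
    (hA : A ∈ complexLie K) : fderiv ℂ F.proj p (infMul A p) = 0 := by
  let γ : ℂ → Fin N → ℂ × ℂ := fun t => mulAct (fun l => Complex.exp (t * A l)) p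
  have hγ : HasDerivAt γ (infMul A p) 0 := hasDerivAt_mulAct_exp A p
  have hγ0 : γ 0 = p := by
    funext l
    simp [γ, mulAct]
  have hγl : ∀ l, HasDerivAt (fun t => γ t l) (infMul A p l) 0 := hasDerivAt_pi.1 hγ
  -- The derivative is `-A i` for both markings: `w` scales inversely to `z`, and `logCoord` has the
  -- opposite sign there.
  have hlog : ∀ i, HasDerivAt (fun t => F.logCoord (γ t) i) (if i ∈ F.idx then -A i else 0) 0 := by
    intro i
    by_cases hi : i ∈ F.idx
    · have hm := hp i hi
      have hm0 := Complex.slitPlane_ne_zero hm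
      by_cases hz : F.isZ i
      · simp only [marked, logCoord, hi, hz, if_true] at hm hm0 ⊢
        have h1 : HasDerivAt (fun t => (γ t i).1) (A i * (p i).1) 0 := (hγl i).fst
        have h2 := (h1.clog (by rw [hγ0]; exact hm)).fun_neg
        refine h2.congr_deriv ?_
        rw [hγ0]
        field_simp
      · simp only [marked, logCoord, hi, hz, if_true, Bool.false_eq_true, if_false] at hm hm0 ⊢
        have h1 : HasDerivAt (fun t => (γ t i).2) (-(A i * (p i).2)) 0 := (hγl i).snd
        have h2 := h1.clog (by rw [hγ0]; exact hm)
        refine h2.congr_deriv ?_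
        rw [hγ0]
        field_simp
    · simp only [logCoord, hi, if_false]
      exact hasDerivAt_const _ _
  have hvec : ∀ l, HasDerivAt (fun t => F.logVec (γ t) l) (-A l) 0 := by
    intro l
    have h1 := HasDerivAt.fun_sum fun i (_ : i ∈ Finset.univ) =>
      (hlog i).const_mul ((F.vec i).1 l : ℂ)
    refine h1.congr_deriv ?_
    -- An element of the complexified Lie algebra is recovered from its frame coordinates, so
    -- `logVec` changes by exactly `-A` and cancels the motion of `γ`.
    rw [← F.sum_vec_mul_complex hA l, ← Finset.sum_neg_distrib]
    refine Finset.sum_congr rfl fun i _ => ?_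
    by_cases hi : i ∈ F.idx
    · simp [hi]
    · simp [hi, F.vec_eq_zero i hi]
  have hproj : HasDerivAt (fun t => F.proj (γ t)) 0 0 := by
    refine hasDerivAt_pi.2 fun l => ?_
    have h1 := (hvec l).cexp
    have h2 := h1.fun_inv (Complex.exp_ne_zero _)
    have hz : HasDerivAt (fun t => (γ t l).1) (A l * (p l).1) 0 := (hγl l).fst
    have hw : HasDerivAt (fun t => (γ t l).2) (-(A l * (p l).2)) 0 := (hγl l).snd
    refine ((hz.fun_mul h1).prodMk (hw.fun_mul h2)).congr_deriv ?_
    have h3 := Complex.exp_ne_zero (F.logVec p l)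
    refine Prod.ext ?_ ?_
    · simp [hγ0]
      ring
    · simp [hγ0]
      field_simp
      ring
  have hp' : HasFDerivAt F.proj (fderiv ℂ F.proj (γ 0)) (γ 0) := by
    rw [hγ0]
    exact ((F.contDiffAt_proj hp).differentiableAt (by simp)).hasFDerivAt
  have h := (hp'.comp_hasDerivAt 0 hγ).unique hproj
  rwa [hγ0] at h

theorem complexMoment_mulAct {ζ : Fin N → ℂ} (hζ : ∀ l, ζ l ≠ 0) (p : Fin N → ℂ × ℂ) (i : Fin N) :
    F.complexMoment (mulAct ζ p) i = F.complexMoment p i := by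
  refine Finset.sum_congr rfl fun l _ => ?_
  have := hζ l
  simp only [mulAct]
  field_simp

theorem marked_ne_zero_of_slit {p : Fin N → ℂ × ℂ} (hp : p ∈ F.slit) :
    ∀ i ∈ F.idx, F.marked p i ≠ 0 := fun i hi => Complex.slitPlane_ne_zero (hp i hi)

/-- A tangent vector of `μ_ℂ⁻¹(β)` killed by the normalization is tangent to the `K_ℂ`-orbit. -/
theorem exists_fderiv_eq_of_fderiv_proj_eq_zero {E : Type*} [NormedAddCommGroup E]
    [NormedSpace ℝ E] {σ : E → HN N} {u : E} (hσ : DifferentiableAt ℝ σ u) {ζ : Fin N → ℂ}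
    (hζ : ∀ l, ζ l ≠ 0) (hslit : mulAct ζ (coordEquiv (σ u)) ∈ F.slit) {b : Fin N → ℂ}
    (hb : ∀ᶠ x in nhds u, ∀ i, F.complexMoment (coordEquiv (σ x)) i = b i) {v : E}
    (hv : fderiv ℝ (fun x => F.proj (mulAct ζ (coordEquiv (σ x)))) u v = 0) :
    ∃ X ∈ lieAlg K, ∃ Y ∈ lieAlg K,
      fderiv ℝ σ u v = infAct X (σ u) + complexStr 0 (infAct Y (σ u)) := by
  let g : E → Fin N → ℂ × ℂ := fun x => mulAct ζ (coordEquiv (σ x))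
  have hg : HasFDerivAt g (((mulActL ζ).restrictScalars ℝ).comp
      ((coordEquiv (N := N)).toContinuousLinearMap.comp (fderiv ℝ σ u))) u :=
    ((mulActL ζ).restrictScalars ℝ).hasFDerivAt.comp u
      ((coordEquiv (N := N)).toContinuousLinearMap.hasFDerivAt.comp u hσ.hasFDerivAt)
  set g' := ((mulActL ζ).restrictScalars ℝ).comp
      ((coordEquiv (N := N)).toContinuousLinearMap.comp (fderiv ℝ σ u)) with hg'
  set c' := ((fderiv ℂ F.logCoord (g u)).restrictScalars ℝ).comp g' with hc'
  have hc : HasFDerivAt (fun x => F.logCoord (g x)) c' u :=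
    HasFDerivAt.comp (g := F.logCoord) u (((F.contDiffAt_logCoord hslit).differentiableAt
      (by simp)).hasFDerivAt.restrictScalars ℝ) hg
  have hL : ∀ l, HasFDerivAt (fun x => F.logVec (g x) l)
      (∑ i, ((F.vec i).1 l : ℂ) • (ContinuousLinearMap.proj i).comp c') u := fun l =>
    HasFDerivAt.fun_sum fun i _ => (hasFDerivAt_pi'.1 hc i).const_mul _
  have hQ : HasFDerivAt (fun x => F.proj (g x))
      (fderiv ℝ (fun x => F.proj (mulAct ζ (coordEquiv (σ x)))) u) u :=
    (HasFDerivAt.comp (g := F.proj) u (((F.contDiffAt_proj hslit).differentiableAt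
      (by simp)).hasFDerivAt.restrictScalars ℝ) hg).differentiableAt.hasFDerivAt
  have hτ := (((F.contDiff_globalSlice b).differentiable (by simp)
    (F.proj (g u))).hasFDerivAt.restrictScalars ℝ).comp u hQ
  -- Near `u`, `g` is recovered from its projection up to the factor `exp (logVec)`. The derivative
  -- of the right side vanishes on `v`, so only the variation of this factor remains in `g' v`.
  have hev : (fun x => mulAct (fun l => Complex.exp (F.logVec (g x) l)) (g x)) =ᶠ[nhds u]
      F.globalSlice b ∘ fun x => F.proj (g x) := by
    filter_upwards [hb, hg.continuousAt.preimage_mem_nhds (F.isOpen_slit.mem_nhds hslit)]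
      with x hx hxs
    exact F.mulAct_logVec (fun i => (F.complexMoment_mulAct hζ _ i).trans (hx i))
      (F.marked_ne_zero_of_slit hxs)
  have hLHS := hτ.congr_of_eventuallyEq hev
  -- Minus the derivative of `logVec ∘ g` in the direction `v`.
  let A : Fin N → ℂ := fun l => ∑ i, ((F.vec i).1 l : ℂ) * (-(c' v i))
  have hA : A ∈ complexLie K := F.vec_combination_mem _
  have hgv : g' v = infMul A (g u) := by
    funext l
    have h1 := hasFDerivAt_pi'.1 hg l
    have h2 := (hL l).cexp
    have hne := Complex.exp_ne_zero (F.logVec (g u) l)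
    have h4 := hasFDerivAt_pi'.1 hLHS l
    have hAl : ∑ i, ((F.vec i).1 l : ℂ) * c' v i = -A l := by
      simp only [A, mul_neg, Finset.sum_neg_distrib, neg_neg]
    refine Prod.ext ?_ ?_
    · have h5 := DFunLike.congr_fun ((h1.fst.fun_mul h2).unique h4.fst) v
      simp [hv] at h5
      rw [hAl] at h5
      have h6 : Complex.exp (F.logVec (g u) l) * ((g' v l).1 - A l * (g u l).1) = 0 := by
        linear_combination h5
      exact sub_eq_zero.1 ((mul_eq_zero.1 h6).resolve_left hne)
    · have h3 : HasFDerivAt (fun x => (Complex.exp (F.logVec (g x) l))⁻¹) _ u :=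
        ((hasDerivAt_inv hne).hasFDerivAt.restrictScalars ℝ).comp u h2
      have h5 := DFunLike.congr_fun ((h1.snd.fun_mul h3).unique h4.snd) v
      simp [hv] at h5
      rw [hAl] at h5
      have h6 : (Complex.exp (F.logVec (g u) l))⁻¹ * ((g' v l).2 + A l * (g u l).2) = 0 := by
        field_simp at h5 ⊢
        linear_combination h5
      exact eq_neg_of_add_eq_zero_left ((mul_eq_zero.1 h6).resolve_left (inv_ne_zero hne))
  have hinj : coordEquiv (fderiv ℝ σ u v) = infMul A (coordEquiv (σ u)) := by
    have h1 : mulAct ζ (coordEquiv (fderiv ℝ σ u v)) = mulAct ζ (infMul A (coordEquiv (σ u))) := by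
      rw [mulAct_infMul]
      exact hgv
    funext l
    have h2 := congrFun h1 l
    have hl := hζ l
    exact Prod.ext (mul_right_cancel₀ hl (congrArg Prod.fst h2))
      (mul_right_cancel₀ (inv_ne_zero hl) (congrArg Prod.snd h2))
  obtain ⟨X, hX, Y, hY, h⟩ := infMul_coordEquiv hA (σ u)
  exact ⟨X, hX, Y, hY, coordEquiv.injective (hinj.trans h)⟩

theorem contDiffAt_proj_comp {E : Type*} [NormedAddCommGroup E]
    [NormedSpace ℝ E] {σ : E → HN N} {u : E} (hσ : ContDiffAt ℝ ∞ σ u) {ζ : Fin N → ℂ}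
    (hslit : mulAct ζ (coordEquiv (σ u)) ∈ F.slit) :
    ContDiffAt ℝ ∞ (fun x => F.proj (mulAct ζ (coordEquiv (σ x)))) u := by
  have h1 : ContDiffAt ℝ ∞ (fun x => mulAct ζ (coordEquiv (σ x))) u :=
    ((mulActL ζ).restrictScalars ℝ).contDiff.contDiffAt.comp u
      (coordEquiv.contDiff.contDiffAt.comp u hσ)
  exact ((F.contDiffAt_proj hslit).restrict_scalars ℝ).comp u h1

/-- The normalization of a map which is holomorphic modulo `k p + I₁ k p` is holomorphic. -/
theorem differentiableAt_proj_comp {E : Type*} [NormedAddCommGroup E]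
    [NormedSpace ℂ E] {σ : E → HN N} {u : E} (hσ : DifferentiableAt ℝ σ u)
    (hh : IsHolomorphicMod K 0 σ u) {ζ : Fin N → ℂ}
    (hslit : mulAct ζ (coordEquiv (σ u)) ∈ F.slit) :
    DifferentiableAt ℂ (fun x => F.proj (mulAct ζ (coordEquiv (σ x)))) u := by
  have hg : HasFDerivAt (fun x => mulAct ζ (coordEquiv (σ x)))
      (((mulActL ζ).restrictScalars ℝ).comp
        ((coordEquiv (N := N)).toContinuousLinearMap.comp (fderiv ℝ σ u))) u :=
    ((mulActL ζ).restrictScalars ℝ).hasFDerivAt.comp u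
      ((coordEquiv (N := N)).toContinuousLinearMap.hasFDerivAt.comp u hσ.hasFDerivAt)
  have hQ := (((F.contDiffAt_proj hslit).differentiableAt
    (by simp)).hasFDerivAt.restrictScalars ℝ).comp u hg
  have hQ' : HasFDerivAt (fun x => F.proj (mulAct ζ (coordEquiv (σ x)))) _ u := hQ
  rw [differentiableAt_iff_restrictScalars ℝ hQ'.differentiableAt, hQ'.fderiv]
  set D := fderiv ℂ F.proj (mulAct ζ (coordEquiv (σ u))) with hD
  set T : E →L[ℝ] F.Slice := (D.restrictScalars ℝ).comp (((mulActL ζ).restrictScalars ℝ).comp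
        ((coordEquiv (N := N)).toContinuousLinearMap.comp (fderiv ℝ σ u))) with hT
  have hTv : ∀ v, T v = D (mulActL ζ (coordEquiv (fderiv ℝ σ u v))) := fun v => rfl
  -- The failure of `dσ` to be complex linear is an orbit direction, which the derivative of `proj`
  -- kills.
  have hI : ∀ v, T (Complex.I • v) = Complex.I • T v := by
    intro v
    obtain ⟨X, hX, Y, hY, h⟩ := hh v
    obtain ⟨A, hA, h'⟩ := coordEquiv_infAct_add hX hY (σ u)
    have h1 : fderiv ℝ σ u (Complex.I • v) = complexStr 0 (fderiv ℝ σ u v) +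
        (infAct X (σ u) + complexStr 0 (infAct Y (σ u))) := by
      rw [← h]
      abel
    rw [hTv, hTv, h1, map_add, h', coordEquiv_complexStr, map_add, map_smul, map_add, map_smul,
      mulActL_apply ζ (infMul A _), mulAct_infMul, F.fderiv_proj_infMul hslit hA, add_zero]
  refine ⟨⟨⟨⟨T, map_add T⟩, ?_⟩, T.continuous⟩, ?_⟩
  · intro c v
    have h1 : c • v = c.re • v + c.im • Complex.I • v := by
      conv_lhs => rw [← Complex.re_add_im c]
      rw [add_smul, mul_smul]
      rfl
    change T (c • v) = c • T v
    rw [h1, map_add, map_smul, map_smul, hI]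
    conv_rhs => rw [← Complex.re_add_im c]
    rw [add_smul, mul_smul]
    rfl
  · exact ContinuousLinearMap.ext fun v => rfl

end Frame

/-! ### Local normal forms -/

theorem mulAct_mulAct (ζ ζ' : Fin N → ℂ) (p : Fin N → ℂ × ℂ) :
    mulAct ζ (mulAct ζ' p) = mulAct (fun l => ζ' l * ζ l) p := by
  funext l
  refine Prod.ext ?_ ?_ <;> simp [mulAct] <;> ring

theorem ne_zero_of_mem_complexification {K : Subgroup (Fin N → Circle)} {ζ : Fin N → ℂ}
    (hζ : ζ ∈ complexification K) (l : Fin N) : ζ l ≠ 0 := by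
  obtain ⟨κ, -, X, -, h⟩ := hζ
  rw [h]
  exact mul_ne_zero (Circle.coe_ne_zero _) (Complex.ofReal_ne_zero.2 (Real.exp_ne_zero _))

theorem circle_mul_mem_complexification {K : Subgroup (Fin N → Circle)} {ζ : Fin N → ℂ}
    (hζ : ζ ∈ complexification K) {κ : Fin N → Circle} (hκ : κ ∈ K) :
    (fun l => (κ l : ℂ) * ζ l) ∈ complexification K := by
  obtain ⟨κ', hκ', X, hX, h⟩ := hζ
  refine ⟨κ * κ', K.mul_mem hκ hκ', X, hX, fun l => ?_⟩
  simp [h, mul_assoc]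

theorem coordEquiv_torusAct (κ : Fin N → Circle) (ξ : HN N) :
    coordEquiv (torusAct κ ξ) = mulAct (fun l => (κ l : ℂ)) (coordEquiv ξ) := by
  rw [← complexAct_circle 0, coordEquiv_complexAct]

/-- Any point at which the coordinates span `k*` admits a frame whose chosen coordinates do not
vanish there. -/
theorem exists_frame_marked_ne_zero {K : Subgroup (Fin N → Circle)} {ξ : HN N}
    (h : coordSpan K (coordSupport ξ) = ⊤) :
    ∃ F : Frame K, ∀ i ∈ F.idx, F.marked (coordEquiv ξ) i ≠ 0 := by
  classical
  obtain ⟨F, hF, hz⟩ := exists_frame h fun i => decide (zCoord (ξ i) ≠ 0)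
  refine ⟨F, fun i hi => ?_⟩
  rw [Frame.marked, hz, coordEquiv_apply]
  by_cases h0 : zCoord (ξ i) = 0
  · simp only [h0, ne_eq, not_true_eq_false, decide_false, Bool.false_eq_true, if_false]
    intro hw
    refine hF i hi ?_
    rw [eq_zCoord_add_wCoord (ξ i), h0, hw]
    simp
  · simp [h0]

/-- Translation by `K_ℂ` puts both points of the `K`-orbit at the same point of the global slice.
The marked coordinates there are `1`, so the principal logarithm is holomorphic nearby and no branch
has to be chosen. -/
theorem exists_frame_slit {K : Subgroup (Fin N → Circle)} {b : Param K}
    (hb : b ∈ regularValues K) {ξ : HN N} (hξ : momentMap K ξ = b) {κ : Fin N → Circle}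
    (hκ : κ ∈ K) : ∃ F : Frame K, ∃ ζ ∈ complexification K, ∃ ζ' ∈ complexification K,
      mulAct ζ (coordEquiv ξ) = mulAct ζ' (coordEquiv (torusAct κ ξ)) ∧
        mulAct ζ (coordEquiv ξ) ∈ F.slit := by
  have hη : momentMap K (torusAct κ ξ) = b := (momentMap_torusAct K κ ξ).trans hξ
  obtain ⟨F, hF⟩ := exists_frame_marked_ne_zero (coordSpan_coordSupport_of_regular hb hη)
  have hζ' := exp_mem_complexification (F.logVec_mem (coordEquiv (torusAct κ ξ)))
  have heq := F.mulAct_logVec (F.forall_momentMap_eq_iff.1 fun l _ => congrFun hη l) hF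
  refine ⟨F, _, circle_mul_mem_complexification hζ' hκ, _, hζ', ?_, ?_⟩
  · rw [coordEquiv_torusAct, mulAct_mulAct]
  · rw [← mulAct_mulAct, ← coordEquiv_torusAct, heq]
    exact F.globalSlice_mem_slit _ _

namespace Frame

variable {K : Subgroup (Fin N → Circle)} (F : Frame K)

/-- The global slice as a map to `μ_ℂ⁻¹(β) ⊆ ℍᴺ`. -/
def lift (a : Param K) (u : F.Slice) : HN N :=
  coordEquiv.symm (F.globalSlice (F.paramCoord a) u)

theorem coordEquiv_lift (a : Param K) (u : F.Slice) :
    coordEquiv (F.lift a u) = F.globalSlice (F.paramCoord a) u := coordEquiv.apply_symm_apply _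

theorem momentMap_lift (a : Param K) (u : F.Slice) :
    ∀ l, l ≠ 0 → momentMap K (F.lift a u) l = a l := by
  refine F.forall_momentMap_eq_iff.2 fun i => ?_
  rw [coordEquiv_lift, F.complexMoment_globalSlice fun i hi => F.paramCoord_eq_zero a hi]

theorem lift_proj_mem_complexOrbit {a : Param K} {ξ : HN N}
    (hξ : ∀ l, l ≠ 0 → momentMap K ξ l = a l) {ζ : Fin N → ℂ} (hζ : ζ ∈ complexification K)
    (hm : ∀ i ∈ F.idx, F.marked (mulAct ζ (coordEquiv ξ)) i ≠ 0) :
    F.lift a (F.proj (mulAct ζ (coordEquiv ξ))) ∈ complexOrbit K 0 ξ := by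
  have h1 : complexAct 0 ζ ξ ∈ complexOrbit K 0 ξ := ⟨ζ, hζ, rfl⟩
  refine complexOrbit_trans h1 ⟨_, exp_mem_complexification
    (F.logVec_mem (mulAct ζ (coordEquiv ξ))), coordEquiv.injective ?_⟩
  rw [coordEquiv_lift, coordEquiv_complexAct, coordEquiv_complexAct,
    F.mulAct_logVec (b := F.paramCoord a) _ hm]
  intro i
  rw [F.complexMoment_mulAct (ne_zero_of_mem_complexification hζ)]
  exact F.forall_momentMap_eq_iff.1 hξ i

/-- Equal projections give one point of the global slice in both `K_ℂ`-orbits; on a regular level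
set this means the same `K`-orbit. -/
theorem exists_torusAct_of_proj_eq {b : Param K}
    (hb : b ∈ regularValues K) {ξ η : HN N} (hξ : momentMap K ξ = b) (hη : momentMap K η = b)
    {ζ ζ' : Fin N → ℂ} (hζ : ζ ∈ complexification K) (hζ' : ζ' ∈ complexification K)
    (hs : mulAct ζ (coordEquiv ξ) ∈ F.slit) (hs' : mulAct ζ' (coordEquiv η) ∈ F.slit)
    (h : F.proj (mulAct ζ (coordEquiv ξ)) = F.proj (mulAct ζ' (coordEquiv η))) :
    ∃ κ ∈ K, η = torusAct κ ξ := by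
  have h1 := F.lift_proj_mem_complexOrbit (fun l _ => congrFun hξ l) hζ
    (F.marked_ne_zero_of_slit hs)
  have h2 := F.lift_proj_mem_complexOrbit (fun l _ => congrFun hη l) hζ'
    (F.marked_ne_zero_of_slit hs')
  rw [← h] at h2
  exact exists_torusAct_of_mem_complexOrbit (j := 0) (coordSpan_coordSupport_of_regular hb hξ)
    (complexOrbit_trans h1 (complexOrbit_symm h2)) (by rw [hη, hξ])

end Frame

/-- The local data which compare two slices with a common value. -/
theorem exists_common_proj {K : Subgroup (Fin N → Circle)} {b : Param K}
    (hb : b ∈ regularValues K) {E : Type} [NormedAddCommGroup E] [NormedSpace ℝ E] {s t : Set E}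
    (hs : IsOpen s) (ht : IsOpen t) {φ ψ : E → Variety K b} {σ τ : E → HN N}
    (hσ : IsSlice K b s φ σ) (hτ : IsSlice K b t ψ τ) {u v : E} (hu : u ∈ s) (hv : v ∈ t)
    (huv : φ u = ψ v) :
    ∃ F : Frame K, ∃ ζ ζ' : Fin N → ℂ, ∃ s' t' : Set E, s' ⊆ s ∧ t' ⊆ t ∧ IsOpen s' ∧ IsOpen t' ∧
      u ∈ s' ∧ v ∈ t' ∧ (∀ x ∈ s', mulAct ζ (coordEquiv (σ x)) ∈ F.slit) ∧
      (∀ x ∈ t', mulAct ζ' (coordEquiv (τ x)) ∈ F.slit) ∧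
      F.proj (mulAct ζ (coordEquiv (σ u))) = F.proj (mulAct ζ' (coordEquiv (τ v))) ∧
      (∀ x ∈ s', ∀ y ∈ t', F.proj (mulAct ζ (coordEquiv (σ x))) =
        F.proj (mulAct ζ' (coordEquiv (τ y))) → φ x = ψ y) ∧
      (∀ x ∈ s', ∀ w, fderiv ℝ (fun x => F.proj (mulAct ζ (coordEquiv (σ x)))) x w = 0 → w = 0) ∧
      (∀ x ∈ t', ∀ w, fderiv ℝ (fun x => F.proj (mulAct ζ' (coordEquiv (τ x)))) x w = 0 →
        w = 0) := by
  obtain ⟨hu1, hu2⟩ := hσ.2.1 u hu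
  obtain ⟨hv1, hv2⟩ := hτ.2.1 v hv
  rw [hu2, hv2] at huv
  obtain ⟨κ, hκ, hκe⟩ := mk_eq_mk_iff.1 huv
  obtain ⟨F, ζ, hζ, ζ', hζ', heq, hslit⟩ := exists_frame_slit hb hu1 hκ
  have hκe' : τ v = torusAct κ (σ u) := hκe
  rw [← hκe'] at heq
  have open' : ∀ {s : Set E} {σ : E → HN N} (ζ : Fin N → ℂ), IsOpen s → ContDiffOn ℝ ∞ σ s →
      IsOpen (s ∩ (fun x => mulAct ζ (coordEquiv (σ x))) ⁻¹' F.slit) := by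
    intro s σ ζ hs hσ
    refine ContinuousOn.isOpen_inter_preimage ?_ hs F.isOpen_slit
    exact (mulActL ζ).continuous.comp_continuousOn
      (coordEquiv.continuous.comp_continuousOn hσ.continuousOn)
  -- A vector killed by the derivative of the projection is sent by `dσ` to an orbit direction, and
  -- slices are transverse to these.
  have inj' : ∀ {s : Set E} {φ : E → Variety K b} {σ : E → HN N} {ζ : Fin N → ℂ}, IsOpen s →
      IsSlice K b s φ σ → ζ ∈ complexification K → ∀ x ∈ s, mulAct ζ (coordEquiv (σ x)) ∈ F.slit →
      ∀ w, fderiv ℝ (fun x => F.proj (mulAct ζ (coordEquiv (σ x)))) x w = 0 → w = 0 := by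
    intro s φ σ ζ hs hσ hζ x hx hxs w hw
    refine hσ.isTransverse hb hs 0 hx w ?_
    refine F.exists_fderiv_eq_of_fderiv_proj_eq_zero (b := F.paramCoord b)
      ((hσ.1.contDiffAt (hs.mem_nhds hx)).differentiableAt (by simp))
      (ne_zero_of_mem_complexification hζ) hxs ?_ hw
    filter_upwards [hs.mem_nhds hx] with y hy
    exact F.forall_momentMap_eq_iff.1 fun l _ => congrFun (hσ.2.1 y hy).1 l
  refine ⟨F, ζ, ζ', _, _, Set.inter_subset_left, Set.inter_subset_left, open' ζ hs hσ.1,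
    open' ζ' ht hτ.1, ⟨hu, hslit⟩, ⟨hv, ?_⟩, fun x hx => hx.2, fun x hx => hx.2, ?_, ?_, ?_, ?_⟩
  · change mulAct ζ' (coordEquiv (τ v)) ∈ F.slit
    rwa [← heq]
  · rw [heq]
  · intro x hx y hy hxy
    obtain ⟨hx1, hx2⟩ := hσ.2.1 x hx.1
    obtain ⟨hy1, hy2⟩ := hτ.2.1 y hy.1
    rw [hx2, hy2]
    exact mk_eq_mk_iff.2 (F.exists_torusAct_of_proj_eq hb hx1 hy1 hζ hζ' hx.2 hy.2 hxy)
  · exact fun x hx => inj' hs hσ hζ x hx.1 hx.2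
  · exact fun x hx => inj' ht hτ hζ' x hx.1 hx.2

/-- Two slices with a common value differ by a local diffeomorphism. -/
theorem exists_transition {K : Subgroup (Fin N → Circle)} {b : Param K}
    (hb : b ∈ regularValues K) {E : Type} [NormedAddCommGroup E] [NormedSpace ℝ E]
    [FiniteDimensional ℝ E] (hE : Module.finrank ℝ E = 4 * quotDim K) {s t : Set E}
    (hs : IsOpen s) (ht : IsOpen t) {φ ψ : E → Variety K b} {σ τ : E → HN N}
    (hσ : IsSlice K b s φ σ) (hτ : IsSlice K b t ψ τ) {u v : E} (hu : u ∈ s) (hv : v ∈ t)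
    (huv : φ u = ψ v) :
    ∃ e : OpenPartialHomeomorph E E, u ∈ e.source ∧ e u = v ∧ e.source ⊆ s ∧ e.target ⊆ t ∧
      ContDiffOn ℝ ∞ e e.source ∧ ContDiffOn ℝ ∞ e.symm e.target ∧
      ∀ x ∈ e.source, φ x = ψ (e x) := by
  obtain ⟨F, ζ, ζ', s', t', hs's, ht't, hs', ht', hu', hv', hss, hts, h1, h2, h3, h4⟩ :=
    exists_common_proj hb hs ht hσ hτ hu hv huv
  obtain ⟨e, he1, he2, he3, he4, he5, he6, he7⟩ := exists_openPartialHomeomorph_comp (𝕜 := ℝ)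
    (F := F.Slice) (hE.trans F.finrank_real_slice.symm) hs' ht'
    (fun x hx => (F.contDiffAt_proj_comp (hσ.1.contDiffAt (hs.mem_nhds (hs's hx)))
      (hss x hx)).contDiffWithinAt)
    (fun x hx => (F.contDiffAt_proj_comp (hτ.1.contDiffAt (ht.mem_nhds (ht't hx)))
      (hts x hx)).contDiffWithinAt) h3 h4 hu' hv' h1
  exact ⟨e, he1, he2, he3.trans hs's, he4.trans ht't, he5, he6, fun x hx =>
    h2 x (he3 hx) _ (he4 (e.map_source hx)) (he7 x hx)⟩

/-- Two holomorphic slices with a common value differ by a local biholomorphic map. -/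
theorem exists_holomorphic_transition {K : Subgroup (Fin N → Circle)} {b : Param K}
    (hb : b ∈ regularValues K) {E : Type} [NormedAddCommGroup E] [NormedSpace ℂ E]
    [FiniteDimensional ℂ E] (hE : Module.finrank ℂ E = 2 * quotDim K) {s t : Set E}
    (hs : IsOpen s) (ht : IsOpen t) {φ ψ : E → Variety K b} {σ τ : E → HN N}
    (hσ : IsSlice K b s φ σ) (hτ : IsSlice K b t ψ τ) (hσ' : ∀ x ∈ s, IsHolomorphicMod K 0 σ x)
    (hτ' : ∀ x ∈ t, IsHolomorphicMod K 0 τ x) {u v : E} (hu : u ∈ s) (hv : v ∈ t)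
    (huv : φ u = ψ v) :
    ∃ e : OpenPartialHomeomorph E E, u ∈ e.source ∧ e u = v ∧ e.source ⊆ s ∧ e.target ⊆ t ∧
      ContDiffOn ℂ ∞ e e.source ∧ ContDiffOn ℂ ∞ e.symm e.target ∧
      ∀ x ∈ e.source, φ x = ψ (e x) := by
  obtain ⟨F, ζ, ζ', s', t', hs's, ht't, hs', ht', hu', hv', hss, hts, h1, h2, h3, h4⟩ :=
    exists_common_proj hb hs ht hσ hτ hu hv huv
  have hd : ∀ {s s' : Set E} {φ : E → Variety K b} {σ : E → HN N} {ζ : Fin N → ℂ}, IsOpen s →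
      IsSlice K b s φ σ → (∀ x ∈ s, IsHolomorphicMod K 0 σ x) → s' ⊆ s →
      (∀ x ∈ s', mulAct ζ (coordEquiv (σ x)) ∈ F.slit) → ∀ x ∈ s',
      DifferentiableAt ℂ (fun x => F.proj (mulAct ζ (coordEquiv (σ x)))) x := by
    intro s s' φ σ ζ hs hσ hσ' hs's hss x hx
    exact F.differentiableAt_proj_comp
      ((hσ.1.contDiffAt (hs.mem_nhds (hs's hx))).differentiableAt (by simp)) (hσ' x (hs's hx))
      (hss x hx)
  have hc : ∀ {s s' : Set E} {φ : E → Variety K b} {σ : E → HN N} {ζ : Fin N → ℂ}, IsOpen s →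
      IsSlice K b s φ σ → (∀ x ∈ s, IsHolomorphicMod K 0 σ x) → s' ⊆ s → IsOpen s' →
      (∀ x ∈ s', mulAct ζ (coordEquiv (σ x)) ∈ F.slit) →
      ContDiffOn ℂ ∞ (fun x => F.proj (mulAct ζ (coordEquiv (σ x)))) s' := by
    intro s s' φ σ ζ hs hσ hσ' hs's hs' hss
    -- The retraction behind a slice is only real smooth, so holomorphy is obtained from real
    -- smoothness together with complex differentiability of the projected map.
    exact ContDiffOn.complex_of_real hs'
      (fun x hx => (F.contDiffAt_proj_comp (hσ.1.contDiffAt (hs.mem_nhds (hs's hx)))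
        (hss x hx)).contDiffWithinAt)
      fun x hx => (hd hs hσ hσ' hs's hss x hx).differentiableWithinAt
  have hi : ∀ {f : E → F.Slice} {x : E}, DifferentiableAt ℂ f x →
      (∀ w, fderiv ℝ f x w = 0 → w = 0) → ∀ w, fderiv ℂ f x w = 0 → w = 0 := by
    intro f x hf h w hw
    refine h w ?_
    rw [(hf.hasFDerivAt.restrictScalars ℝ).fderiv]
    exact hw
  obtain ⟨e, he1, he2, he3, he4, he5, he6, he7⟩ := exists_openPartialHomeomorph_comp (𝕜 := ℂ)
    (F := F.Slice) (hE.trans F.finrank_slice.symm) hs' ht' (hc hs hσ hσ' hs's hs' hss)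
    (hc ht hτ hτ' ht't ht' hts) (fun x hx => hi (hd hs hσ hσ' hs's hss x hx) (h3 x hx))
    (fun x hx => hi (hd ht hτ hτ' ht't hts x hx) (h4 x hx)) hu' hv' h1
  exact ⟨e, he1, he2, he3.trans hs's, he4.trans ht't, he5, he6, fun x hx =>
    h2 x (he3 hx) _ (he4 (e.map_source hx)) (he7 x hx)⟩

/-! ### Natural morphisms in the charts -/

/-- A slice at `a` retracts to a slice at `b`. In charts a natural morphism therefore becomes a
change of slice over `b`, and no separate smoothness argument is needed. -/
theorem IsSlice.naturalMap {K : Subgroup (Fin N → Circle)} {j : Fin 3} {a b : Param K}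
    (ha : a ∈ regularValues K) (hb : b ∈ regularValues K)
    (h : semistable K j a ⊆ semistable K j b) {E : Type} [NormedAddCommGroup E] [NormedSpace ℝ E]
    {s : Set E} (hs : IsOpen s) {φ : E → Variety K a} {σ : E → HN N} (hσ : IsSlice K a s φ σ) :
    IsSlice K b s (ToricHK.naturalMap hb h ∘ φ) (fun x => retract K j (b j) (σ x)) := by
  refine isSlice_retract hb hs hσ.1
    (fun u hu => h (levelSet_subset_semistable K j a (hσ.2.1 u hu).1))
    (fun u hu => hσ.isTransverse ha hs j hu) fun u hu => ?_
  obtain ⟨hm, hφ⟩ := hσ.2.1 u hu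
  exact congrArg (ToricHK.naturalMap hb h) hφ

theorem liftsToCharts_naturalMap {K : Subgroup (Fin N → Circle)} {j : Fin 3} {a b : Param K}
    (ha : a ∈ regularValues K) (hb : b ∈ regularValues K)
    (h : semistable K j a ⊆ semistable K j b) {c : OrbifoldChart ℝ (4 * quotDim K) (Variety K a)}
    (hc : c ∈ smoothAtlas K a) {d : OrbifoldChart ℝ (4 * quotDim K) (Variety K b)}
    (hd : d ∈ smoothAtlas K b) : LiftsToCharts (naturalMap hb h) c d := by
  obtain ⟨σ, hσ⟩ := hc
  obtain ⟨τ, hτ⟩ := hd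
  intro u hu v hv huv
  exact exists_transition hb (by simp) c.isOpen_source d.isOpen_source
    (hσ.naturalMap ha hb h c.isOpen_source) hτ hu hv huv

theorem liftsToCharts_id {K : Subgroup (Fin N → Circle)} {b : Param K}
    (hb : b ∈ regularValues K) {c d : OrbifoldChart ℝ (4 * quotDim K) (Variety K b)}
    (hc : c ∈ smoothAtlas K b) (hd : d ∈ smoothAtlas K b) : LiftsToCharts id c d := by
  obtain ⟨σ, hσ⟩ := hc
  obtain ⟨τ, hτ⟩ := hd
  intro u hu v hv huv
  exact exists_transition hb (by simp) c.isOpen_source d.isOpen_source hσ hτ hu hv huv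

theorem liftsToCharts_holomorphic_naturalMap {K : Subgroup (Fin N → Circle)} {a b : Param K}
    (ha : a ∈ regularValues K) (hb : b ∈ regularValues K)
    (h : semistable K 0 a ⊆ semistable K 0 b) {c : OrbifoldChart ℂ (2 * quotDim K) (Variety K a)}
    (hc : c ∈ holomorphicAtlas K 0 a) {d : OrbifoldChart ℂ (2 * quotDim K) (Variety K b)}
    (hd : d ∈ holomorphicAtlas K 0 b) : LiftsToCharts (naturalMap hb h) c d := by
  obtain ⟨σ, hσ, hσ'⟩ := hc
  obtain ⟨τ, hτ, hτ'⟩ := hd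
  intro u hu v hv huv
  refine exists_holomorphic_transition hb (by simp) c.isOpen_source d.isOpen_source
    (hσ.naturalMap ha hb h c.isOpen_source) hτ (fun x hx => ?_) hτ' hu hv huv
  exact IsHolomorphicMod.retract (hσ' x hx)
    ((hσ.1.contDiffAt (c.isOpen_source.mem_nhds hx)).differentiableAt (by simp))
    (mem_retractDomain_of_semistable hb
      (h (levelSet_subset_semistable K 0 a (hσ.2.1 x hx).1)))

theorem liftsToCharts_holomorphic_id {K : Subgroup (Fin N → Circle)} {b : Param K}
    (hb : b ∈ regularValues K) {c d : OrbifoldChart ℂ (2 * quotDim K) (Variety K b)}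
    (hc : c ∈ holomorphicAtlas K 0 b) (hd : d ∈ holomorphicAtlas K 0 b) :
    LiftsToCharts id c d := by
  obtain ⟨σ, hσ, hσ'⟩ := hc
  obtain ⟨τ, hτ, hτ'⟩ := hd
  intro u hu v hv huv
  exact exists_holomorphic_transition hb (by simp) c.isOpen_source d.isOpen_source hσ hτ hσ' hτ'
    hu hv huv

/-! ### Finite isotropy groups -/

theorem torusExp_add (X Y : Fin N → ℝ) : torusExp (X + Y) = torusExp X * torusExp Y := by
  funext i
  simp [torusExp, mul_add, Circle.exp_add]

theorem torusExp_zero : torusExp (0 : Fin N → ℝ) = 1 := by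
  funext i
  simp [torusExp]

theorem torusExp_neg (X : Fin N → ℝ) : torusExp (-X) = (torusExp X)⁻¹ := by
  rw [eq_inv_iff_mul_eq_one, ← torusExp_add, neg_add_cancel, torusExp_zero]

theorem continuous_torusExp : Continuous (torusExp : (Fin N → ℝ) → Fin N → Circle) :=
  continuous_pi fun i => Circle.exp.continuous.comp (continuous_const.mul (continuous_apply i))

/-- The preimage of a subgroup under the exponential map. -/
def expPreimage (H : Subgroup (Fin N → Circle)) : AddSubgroup (Fin N → ℝ) where
  carrier := {X | torusExp X ∈ H}
  zero_mem' := by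
    change torusExp 0 ∈ H
    rw [torusExp_zero]
    exact H.one_mem
  add_mem' := by
    intro X Y hX hY
    change torusExp (X + Y) ∈ H
    rw [torusExp_add]
    exact H.mul_mem hX hY
  neg_mem' := by
    intro X hX
    change torusExp (-X) ∈ H
    rw [torusExp_neg]
    exact H.inv_mem hX

theorem isClosed_expPreimage {H : Subgroup (Fin N → Circle)}
    (hH : IsClosed (H : Set (Fin N → Circle))) :
    IsClosed (expPreimage H : Set (Fin N → ℝ)) := hH.preimage continuous_torusExp

/-- A closed subgroup with arbitrarily small logarithms has a nonzero Lie algebra. -/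
theorem exists_forall_le_norm {H : Subgroup (Fin N → Circle)}
    (hH : IsClosed (H : Set (Fin N → Circle))) (h0 : ∀ X ∈ lieAlg H, X = 0) :
    ∃ r : ℝ, 0 < r ∧ ∀ X ∈ expPreimage H, X ≠ 0 → r ≤ ‖X‖ := by
  by_contra! hcon
  choose X hX hX0 hXn using fun n : ℕ => hcon (1 / ((n : ℝ) + 1)) (by positivity)
  have hsph : ∀ n, (‖X n‖⁻¹ • X n) ∈ Metric.sphere (0 : Fin N → ℝ) 1 := by
    intro n
    rw [mem_sphere_zero_iff_norm, norm_smul, norm_inv, norm_norm,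
      inv_mul_cancel₀ (norm_ne_zero_iff.2 (hX0 n))]
  obtain ⟨Y, hY, φ, hφ, hlim⟩ := (isCompact_sphere (0 : Fin N → ℝ) 1).tendsto_subseq hsph
  have hlim0 : Filter.Tendsto (fun n => ‖X (φ n)‖) Filter.atTop (nhds 0) :=
    (squeeze_zero (fun n => norm_nonneg (X n)) (fun n => (hXn n).le)
      tendsto_one_div_add_atTop_nhds_zero_nat).comp hφ.tendsto_atTop
  have hmem : Y ∈ lieAlg H := by
    intro t
    -- Integer multiples of short logarithms approximate `t • Y` with error at most `‖X (φ n)‖`, so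
    -- the whole line through `Y` lies in the closed set of logarithms.
    have h1 : Filter.Tendsto (fun n => (⌊t / ‖X (φ n)‖⌋ : ℤ) • X (φ n)) Filter.atTop
        (nhds (t • Y)) := by
      have h2 : Filter.Tendsto (fun n => t • (‖X (φ n)‖⁻¹ • X (φ n)) -
          ((⌊t / ‖X (φ n)‖⌋ : ℤ) • X (φ n))) Filter.atTop (nhds 0) := by
        refine squeeze_zero_norm (fun n => ?_) hlim0
        have hpos := norm_pos_iff.2 (hX0 (φ n))
        have h3 : t • (‖X (φ n)‖⁻¹ • X (φ n)) - ((⌊t / ‖X (φ n)‖⌋ : ℤ) • X (φ n)) =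
            Int.fract (t / ‖X (φ n)‖) • X (φ n) := by
          rw [smul_smul, ← div_eq_mul_inv, ← Int.cast_smul_eq_zsmul ℝ, ← sub_smul]
          rfl
        rw [h3, norm_smul, Real.norm_of_nonneg (Int.fract_nonneg _)]
        exact mul_le_of_le_one_left hpos.le (Int.fract_lt_one _).le
      have h4 := (hlim.const_smul t).sub h2
      simpa using h4
    exact (isClosed_expPreimage hH).mem_of_tendsto h1
      (Filter.Eventually.of_forall fun n => (expPreimage H).zsmul_mem (hX (φ n)) _)
  rw [h0 Y hmem] at hY
  simp at hY

/-- The logarithms of `H` form a closed uniformly discrete set, which meets the unit cube in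
finitely many points, and every torus element has a logarithm in the cube. -/
theorem finite_of_lieAlg_eq_zero {H : Subgroup (Fin N → Circle)}
    (hH : IsClosed (H : Set (Fin N → Circle))) (h0 : ∀ X ∈ lieAlg H, X = 0) : Finite H := by
  obtain ⟨r, hr, h⟩ := exists_forall_le_norm hH h0
  have hd : IsDiscrete (expPreimage H : Set (Fin N → ℝ)) := by
    refine ⟨DiscreteTopology.of_forall_le_dist hr fun x y hxy => ?_⟩
    change r ≤ dist x y
    rw [Subtype.dist_eq, dist_eq_norm]
    exact h _ ((expPreimage H).sub_mem x.2 y.2) (sub_ne_zero.2 fun h => hxy (Subtype.ext h))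
  have hfin := Metric.finite_isBounded_inter_isClosed hd
    (Metric.isBounded_Icc (0 : Fin N → ℝ) 1) (isClosed_expPreimage hH)
  refine Set.Finite.to_subtype ((hfin.image torusExp).subset fun ζ hζ => ?_)
  have h1 : ∀ c : Circle, ∃ x ∈ Set.Icc (0 : ℝ) 1, Circle.exp (2 * Real.pi * x) = c := by
    intro c
    refine ⟨Int.fract (Complex.arg c / (2 * Real.pi)), ⟨Int.fract_nonneg _,
      (Int.fract_lt_one _).le⟩, ?_⟩
    have h2 : 2 * Real.pi * Int.fract (Complex.arg c / (2 * Real.pi)) =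
        Complex.arg c - ⌊Complex.arg c / (2 * Real.pi)⌋ * (2 * Real.pi) := by
      rw [Int.fract, mul_sub, mul_div_cancel₀ _ (by positivity)]
      ring
    rw [h2, Circle.periodic_exp.sub_int_mul_eq, Circle.exp_arg]
  choose f hf hfe using h1
  have h3 : torusExp (fun i => f (ζ i)) = ζ := funext fun i => hfe (ζ i)
  refine ⟨fun i => f (ζ i), ⟨⟨fun i => (hf (ζ i)).1, fun i => (hf (ζ i)).2⟩, ?_⟩, h3⟩
  change torusExp _ ∈ H
  rw [h3]
  exact hζ

theorem finite_coordStab {K : Subgroup (Fin N → Circle)}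
    (hK : IsClosed (K : Set (Fin N → Circle))) {S : Set (Fin N)} (hS : coordSpan K S = ⊤) :
    Finite (coordStab K S) := by
  refine finite_of_lieAlg_eq_zero ?_ fun X hX => ?_
  · have h : (coordStab K S : Set (Fin N → Circle)) =
        (K : Set (Fin N → Circle)) ∩ ⋂ i ∈ S, {ζ | ζ i = 1} := by
      ext ζ
      simp [coordStab]
    rw [h]
    exact hK.inter (isClosed_biInter fun i _ => isClosed_eq (continuous_apply i) continuous_const)
  · obtain ⟨h1, h2⟩ := mem_lieAlg_coordStab.1 hX
    exact congrArg Subtype.val (coordSpan_eq_top_iff.1 hS ⟨X, h1⟩ h2)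

/-! ### Orbifold charts -/

theorem zPart_ne_zero_iff {q : Quaternion ℝ} : zPart 0 q ≠ 0 ↔ zCoord q ≠ 0 := by
  rw [zPart_zero, not_iff_not]
  refine ⟨fun h => ?_, fun h => by rw [h]; simp⟩
  apply Complex.ext
  · exact congrArg (fun q : Quaternion ℝ => q.re) h
  · exact congrArg (fun q : Quaternion ℝ => q.imI) h

theorem wPart_ne_zero_iff {q : Quaternion ℝ} : wPart 0 q ≠ 0 ↔ wCoord q ≠ 0 := by
  rw [wPart_zero, not_iff_not]
  refine ⟨fun h => ?_, fun h => by rw [h]; simp⟩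
  apply Complex.ext
  · have h1 := congrArg (fun q : Quaternion ℝ => q.imJ) h
    simp [re_imUnit, imI_imUnit, imJ_imUnit, imK_imUnit] at h1
    exact h1
  · have h1 := congrArg (fun q : Quaternion ℝ => q.imK) h
    simp [re_imUnit, imI_imUnit, imJ_imUnit, imK_imUnit] at h1
    exact h1

namespace Frame

variable {K : Subgroup (Fin N → Circle)} (F : Frame K)

/-- The part of the global slice which lies in the semistable locus. -/
def dom (a : Param K) : Set F.Slice := {u | F.lift a u ∈ semistable K 0 a}

/-- The condition that the coefficients `c` are admissible at a point of the global slice. -/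
def coneDom (a : Param K) (c : Fin N → ℝ) : Set F.Slice :=
  {u | ∀ i, (0 < c i → (F.globalSlice (F.paramCoord a) u i).1 ≠ 0) ∧
    (c i < 0 → (F.globalSlice (F.paramCoord a) u i).2 ≠ 0)}

theorem mem_dom_iff {a : Param K} {u : F.Slice} :
    u ∈ F.dom a ↔ ∃ c, a 0 = ∑ i, c i • iotaStar K i ∧ u ∈ F.coneDom a c := by
  refine mem_semistable_iff.trans ⟨?_, ?_⟩
  · rintro ⟨-, c, hc, h⟩
    refine ⟨c, h, fun i => ?_⟩
    rw [← F.coordEquiv_lift, coordEquiv_apply]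
    exact ⟨fun h => zPart_ne_zero_iff.1 ((hc i).1 h), fun h => wPart_ne_zero_iff.1 ((hc i).2 h)⟩
  · rintro ⟨c, h, hc⟩
    refine ⟨F.momentMap_lift a u, c, fun i => ?_, h⟩
    have h1 := hc i
    rw [← F.coordEquiv_lift, coordEquiv_apply] at h1
    exact ⟨fun h => zPart_ne_zero_iff.2 (h1.1 h), fun h => wPart_ne_zero_iff.2 (h1.2 h)⟩

theorem isOpen_coneDom (a : Param K) (c : Fin N → ℝ) : IsOpen (F.coneDom a c) := by
  have hc : ∀ i, Continuous fun u => F.globalSlice (F.paramCoord a) u i := fun i =>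
    (continuous_apply i).comp (F.contDiff_globalSlice _).continuous
  have h : F.coneDom a c = ⋂ i, ({u | 0 < c i → (F.globalSlice (F.paramCoord a) u i).1 ≠ 0} ∩
      {u | c i < 0 → (F.globalSlice (F.paramCoord a) u i).2 ≠ 0}) := by
    ext u
    simp [coneDom]
  rw [h]
  refine isOpen_iInter_of_finite fun i => IsOpen.inter ?_ ?_
  · by_cases h : 0 < c i
    · simpa [h] using isOpen_ne_fun (continuous_fst.comp (hc i)) continuous_const
    · simp [h]
  · by_cases h : c i < 0
    · simpa [h] using isOpen_ne_fun (continuous_snd.comp (hc i)) continuous_const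
    · simp [h]

theorem isOpen_dom (a : Param K) : IsOpen (F.dom a) := by
  have h : F.dom a = ⋃ c ∈ {c : Fin N → ℝ | a 0 = ∑ i, c i • iotaStar K i}, F.coneDom a c := by
    ext u
    rw [F.mem_dom_iff]
    simp
  rw [h]
  exact isOpen_biUnion fun c _ => F.isOpen_coneDom a c

/-- Along a complex line, the coordinates of the global slice are polynomials. -/
theorem exists_polynomial_globalSlice (b : Fin N → ℂ) (u w : F.Slice) (i : Fin N) :
    ∃ P Q : Polynomial ℂ, ∀ t : ℂ, F.globalSlice b (u + t • w) i = (P.eval t, Q.eval t) := by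
  by_cases hi : i ∈ F.idx
  · let R : Polynomial ℂ := Polynomial.C (b i) - ∑ l : {l // l ∉ F.idx},
      Polynomial.C ((F.vec i).1 l.1 : ℂ) *
        ((Polynomial.C (u l).1 + Polynomial.X * Polynomial.C (w l).1) *
          (Polynomial.C (u l).2 + Polynomial.X * Polynomial.C (w l).2))
    have hR : ∀ t : ℂ, F.quad b (u + t • w) i = R.eval t := by
      intro t
      simp [R, quad, Polynomial.eval_finsetSum, mul_comm t]
    by_cases hz : F.isZ i
    · refine ⟨1, R, fun t => ?_⟩
      rw [F.globalSlice_of_mem b _ hi, hR]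
      simp [hz]
    · refine ⟨R, 1, fun t => ?_⟩
      rw [F.globalSlice_of_mem b _ hi, hR]
      simp [hz]
  · refine ⟨Polynomial.C (u ⟨i, hi⟩).1 + Polynomial.X * Polynomial.C (w ⟨i, hi⟩).1,
      Polynomial.C (u ⟨i, hi⟩).2 + Polynomial.X * Polynomial.C (w ⟨i, hi⟩).2, fun t => ?_⟩
    rw [F.globalSlice_of_notMem b _ ⟨i, hi⟩]
    refine Prod.ext ?_ ?_ <;> simp [mul_comm t]

theorem finite_line_coneDom {a : Param K} {c : Fin N → ℝ} {u : F.Slice} (hu : u ∈ F.coneDom a c)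
    (w : F.Slice) : {t : ℂ | u + t • w ∉ F.coneDom a c}.Finite := by
  choose P Q h using F.exists_polynomial_globalSlice (F.paramCoord a) u w
  have h0 : ∀ i, F.globalSlice (F.paramCoord a) u i = ((P i).eval 0, (Q i).eval 0) := by
    intro i
    rw [← h i 0]
    simp
  have hroot : ∀ {R : Polynomial ℂ}, R.eval 0 ≠ 0 → {t : ℂ | R.eval t = 0}.Finite := by
    intro R hR
    have hR0 : R ≠ 0 := by
      rintro rfl
      simp at hR
    refine R.roots.toFinset.finite_toSet.subset fun t ht => ?_
    have ht0 : R.eval t = 0 := ht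
    simp [hR0, ht0]
  refine ((Set.finite_iUnion fun i =>
    (Set.finite_iUnion fun hi : 0 < c i => hroot (R := P i) ?_).union
      (Set.finite_iUnion fun hi : c i < 0 => hroot (R := Q i) ?_))).subset ?_
  · have := (hu i).1 hi
    rwa [h0] at this
  · have := (hu i).2 hi
    rwa [h0] at this
  · intro t ht
    by_contra hcon
    refine ht fun i => ?_
    rw [h i t]
    simp only [Set.mem_iUnion, Set.mem_union, Set.mem_ofPred_eq, not_exists, not_or] at hcon
    exact ⟨fun hi => (hcon i).1 hi, fun hi => (hcon i).2 hi⟩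

/-- The complex line through two points of the domain leaves it at only finitely many parameters,
and the plane minus a finite set is connected. The coefficients admissible at `u` alone give the
finiteness. -/
theorem isPreconnected_dom (a : Param K) : IsPreconnected (F.dom a) := by
  refine isPreconnected_of_forall_pair fun u hu v hv => ?_
  let γ : ℂ → F.Slice := fun t => u + t • (v - u)
  obtain ⟨c, hc, huc⟩ := F.mem_dom_iff.1 hu
  have hfin : (γ ⁻¹' F.dom a)ᶜ.Finite := (F.finite_line_coneDom huc (v - u)).subset
    fun t ht h => ht (F.mem_dom_iff.2 ⟨c, hc, h⟩)
  have hconn : IsPreconnected (γ ⁻¹' F.dom a) := by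
    have h := (hfin.countable.isPathConnected_compl_of_one_lt_rank
      (Complex.rank_real_complex ▸ Nat.one_lt_ofNat)).isConnected.isPreconnected
    rwa [compl_compl] at h
  have hγ : Continuous γ := by fun_prop
  refine ⟨γ '' (γ ⁻¹' F.dom a), Set.image_preimage_subset _ _, ⟨0, ?_, ?_⟩, ⟨1, ?_, ?_⟩,
    hconn.image γ hγ.continuousOn⟩
  · simpa [γ] using hu
  · simp [γ]
  · simpa [γ] using hv
  · simp [γ]

/-- The action of a torus element on the coordinates outside of the frame. -/
def twist (g : Fin N → Circle) (u : F.Slice) : F.Slice :=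
  fun l => ((u l).1 * (g l : ℂ), (u l).2 * (g l : ℂ)⁻¹)

theorem twist_twist (g h : Fin N → Circle) (u : F.Slice) :
    F.twist g (F.twist h u) = F.twist (g * h) u := by
  funext l
  refine Prod.ext ?_ ?_ <;> simp [twist] <;> ring

theorem twist_one (u : F.Slice) : F.twist 1 u = u := by
  funext l
  refine Prod.ext ?_ ?_ <;> simp [twist]

theorem continuous_twist (g : Fin N → Circle) : Continuous (F.twist g) := by
  unfold twist
  fun_prop

/-- The action of the finite group of the elements of `K` which fix the frame. -/
def rep (𝕜 : Type) [NontriviallyNormedField 𝕜] [NormedAlgebra 𝕜 ℂ] :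
    coordStab K F.idx →* (F.Slice ≃L[𝕜] F.Slice) where
  toFun g :=
    { toFun := F.twist g
      invFun := F.twist (g⁻¹ : coordStab K F.idx)
      map_add' := fun u v => by
        funext l
        refine Prod.ext ?_ ?_ <;> simp [twist, add_mul]
      map_smul' := fun c u => by
        funext l
        refine Prod.ext ?_ ?_ <;> simp [twist]
      left_inv := fun u => by
        rw [F.twist_twist, Subgroup.coe_inv, inv_mul_cancel, F.twist_one]
      right_inv := fun u => by
        rw [F.twist_twist, Subgroup.coe_inv, mul_inv_cancel, F.twist_one]
      continuous_toFun := F.continuous_twist _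
      continuous_invFun := F.continuous_twist _ }
  map_one' := ContinuousLinearEquiv.ext (funext F.twist_one)
  map_mul' g h := ContinuousLinearEquiv.ext (funext fun u => (F.twist_twist g h u).symm)

/-- `g` is `1` on the frame, and `quad` depends only on the products `z_l w_l`, which are invariant.
-/
theorem globalSlice_twist (b : Fin N → ℂ) {g : Fin N → Circle} (hg : g ∈ coordStab K F.idx)
    (u : F.Slice) :
    F.globalSlice b (F.twist g u) = mulAct (fun l => (g l : ℂ)) (F.globalSlice b u) := by
  funext l
  by_cases hl : l ∈ F.idx
  · have hq : F.quad b (F.twist g u) l = F.quad b u l := by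
      simp only [quad]
      congr 1
      refine Finset.sum_congr rfl fun l' _ => ?_
      have := Circle.coe_ne_zero (g l')
      simp only [twist]
      field_simp
    have h1 : g l = 1 := hg.2 l hl
    rw [F.globalSlice_of_mem b _ hl, hq, mulAct, F.globalSlice_of_mem b _ hl, h1]
    simp
  · rw [F.globalSlice_of_notMem b _ ⟨l, hl⟩, mulAct, F.globalSlice_of_notMem b u ⟨l, hl⟩]
    rfl

theorem lift_twist (a : Param K) {g : Fin N → Circle} (hg : g ∈ coordStab K F.idx)
    (u : F.Slice) : F.lift a (F.twist g u) = torusAct g (F.lift a u) := by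
  apply coordEquiv.injective
  rw [F.coordEquiv_lift, F.globalSlice_twist _ hg, coordEquiv_torusAct, F.coordEquiv_lift]

theorem lift_twist_mem_complexOrbit (a : Param K) {g : Fin N → Circle}
    (hg : g ∈ coordStab K F.idx) (u : F.Slice) :
    F.lift a (F.twist g u) ∈ complexOrbit K 0 (F.lift a u) := by
  rw [F.lift_twist a hg]
  exact torusAct_mem_complexOrbit K 0 _ hg.1

/-- Two points of the global slice in the same `K_ℂ`-orbit differ by an element of the finite
group. -/
theorem exists_twist_of_mem_complexOrbit {a : Param K} {u v : F.Slice}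
    (h : F.lift a v ∈ complexOrbit K 0 (F.lift a u)) : ∃ g : coordStab K F.idx, F.twist g u = v := by
  obtain ⟨ζ, ⟨κ, hκ, X, hX, hζ⟩, he⟩ := h
  have he' : F.globalSlice (F.paramCoord a) v = mulAct ζ (F.globalSlice (F.paramCoord a) u) := by
    rw [← F.coordEquiv_lift, he, coordEquiv_complexAct, F.coordEquiv_lift]
  -- Marked coordinates equal `1` at both points. Taking norms then kills the real part of `ζ`, and
  -- what remains is an element of `K` fixing the frame.
  have h1 : ∀ i ∈ F.idx, ζ i = 1 := by
    intro i hi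
    have h2 := congrFun he' i
    rw [mulAct, F.globalSlice_of_mem _ _ hi, F.globalSlice_of_mem _ _ hi] at h2
    by_cases hz : F.isZ i
    · simpa [hz] using (congrArg Prod.fst h2).symm
    · simpa [hz] using (congrArg Prod.snd h2).symm
  have hX0 : X = 0 := by
    refine congrArg Subtype.val (coordSpan_eq_top_iff.1 F.coordSpan_idx ⟨X, hX⟩ fun i hi => ?_)
    have h2 := congrArg norm (h1 i hi)
    rw [hζ, norm_mul, Circle.norm_coe, one_mul, Complex.norm_real, norm_one,
      Real.norm_of_nonneg (Real.exp_pos _).le, Real.exp_eq_one_iff] at h2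
    simpa [Real.pi_ne_zero] using h2
  have hζκ : ∀ i, ζ i = κ i := by
    intro i
    rw [hζ, hX0]
    simp
  have hg : κ ∈ coordStab K F.idx := by
    refine ⟨hκ, fun i hi => ?_⟩
    have h2 := h1 i hi
    rw [hζκ] at h2
    exact Subtype.ext h2
  refine ⟨⟨κ, hg⟩, funext fun l => ?_⟩
  have h2 := congrFun he' l
  rw [mulAct, F.globalSlice_of_notMem, F.globalSlice_of_notMem, hζκ] at h2
  exact h2.symm

open Classical in
/-- The map to `X(a)` induced by the global slice. Outside of its domain it is constant. -/
def toVariety {a : Param K} (ha : a ∈ regularValues K) {u₀ : F.Slice} (h₀ : u₀ ∈ F.dom a)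
    (u : F.Slice) : Variety K a :=
  if h : u ∈ F.dom a then
    Quotient.mk (orbitSetoid K a) ⟨retract K 0 (a 0) (F.lift a u),
      momentMap_retract_of_semistable ha h⟩
  else Quotient.mk (orbitSetoid K a) ⟨retract K 0 (a 0) (F.lift a u₀),
      momentMap_retract_of_semistable ha h₀⟩

variable {F} {a : Param K} (ha : a ∈ regularValues K) {u₀ : F.Slice} (h₀ : u₀ ∈ F.dom a)

theorem toVariety_of_mem {u : F.Slice} (h : u ∈ F.dom a) :
    F.toVariety ha h₀ u = Quotient.mk (orbitSetoid K a) ⟨retract K 0 (a 0) (F.lift a u),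
      momentMap_retract_of_semistable ha h⟩ := dif_pos h

theorem contDiff_lift (a : Param K) : ContDiff ℝ ∞ (F.lift a) :=
  coordEquiv.symm.contDiff.comp ((F.contDiff_globalSlice _).restrict_scalars ℝ)

theorem continuousOn_toVariety : ContinuousOn (F.toVariety ha h₀) (F.dom a) := by
  rw [continuousOn_iff_continuous_domRestrict]
  have h1 : ContinuousOn (fun u => retract K 0 (a 0) (F.lift a u)) (F.dom a) :=
    (contDiffOn_retract K 0 (a 0)).continuousOn.comp (F.contDiff_lift a).continuous.continuousOn
      fun u hu => mem_retractDomain_of_semistable ha hu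
  have h2 : (F.dom a).domRestrict (F.toVariety ha h₀) = fun u : F.dom a =>
      Quotient.mk (orbitSetoid K a) ⟨retract K 0 (a 0) (F.lift a u.1),
        momentMap_retract_of_semistable ha u.2⟩ :=
    funext fun u => toVariety_of_mem ha h₀ u.2
  rw [h2]
  exact (isOpenQuotientMap_mk K a).continuous.comp
    ((continuousOn_iff_continuous_domRestrict.1 h1).subtype_mk _)

/-- A point of the global slice in the `K_ℂ`-orbit of a point of the level set. -/
theorem toVariety_eq_mk {ξ : HN N} (hξ : momentMap K ξ = a) {u : F.Slice}
    (h : F.lift a u ∈ complexOrbit K 0 ξ) :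
    u ∈ F.dom a ∧ F.toVariety ha h₀ u = Quotient.mk (orbitSetoid K a) ⟨ξ, hξ⟩ := by
  have hu : u ∈ F.dom a := mem_semistable_of_mem_complexOrbit h
    (levelSet_subset_semistable K 0 a hξ)
  have hm : momentMap K (retract K 0 (a 0) (F.lift a u)) 0 = momentMap K ξ 0 := by
    rw [momentMap_retract_of_semistable ha hu, hξ]
  have h1 := exists_torusAct_of_mem_complexOrbit (j := 0)
    (coordSpan_coordSupport_of_regular ha hξ)
    (complexOrbit_trans h (retract_mem_complexOrbit K 0 (a 0) _)) hm
  exact ⟨hu, (toVariety_of_mem ha h₀ hu).trans (mk_eq_mk_iff.2 h1).symm⟩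

/-- Normalization is a continuous local inverse: for `η` near `ξ` in the level set, `proj (ζ η)`
lies in `V` and represents the class of `η`. -/
theorem isOpen_image_toVariety {V : Set F.Slice} (hV : V ⊆ F.dom a) (hVo : IsOpen V) :
    IsOpen (F.toVariety ha h₀ '' V) := by
  rw [← (isOpenQuotientMap_mk K a).isQuotientMap.isOpen_preimage, isOpen_iff_mem_nhds]
  rintro ⟨ξ, hξ⟩ ⟨u, hu, hux⟩
  rw [toVariety_of_mem ha h₀ (hV hu)] at hux
  obtain ⟨κ, hκ, hκe⟩ := mk_eq_mk_iff.1 hux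
  have hκe' : ξ = torusAct κ (retract K 0 (a 0) (F.lift a u)) := hκe
  have horb : F.lift a u ∈ complexOrbit K 0 ξ := by
    rw [hκe']
    exact complexOrbit_symm (complexOrbit_trans (retract_mem_complexOrbit K 0 (a 0) _)
      (torusAct_mem_complexOrbit K 0 _ hκ))
  obtain ⟨ζ, hζ, hζe⟩ := horb
  have h1 : mulAct ζ (coordEquiv ξ) = F.globalSlice (F.paramCoord a) u := by
    rw [← coordEquiv_complexAct, ← hζe, F.coordEquiv_lift]
  have hslit : mulAct ζ (coordEquiv ξ) ∈ F.slit := by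
    rw [h1]
    exact F.globalSlice_mem_slit _ _
  have hproj : F.proj (mulAct ζ (coordEquiv ξ)) = u := by rw [h1, F.proj_globalSlice]
  have hc : Continuous fun η : HN N => mulAct ζ (coordEquiv η) :=
    (mulActL ζ).continuous.comp coordEquiv.continuous
  have hc' : ContinuousAt (fun η : HN N => F.proj (mulAct ζ (coordEquiv η))) ξ :=
    ContinuousAt.comp (g := F.proj) (F.contDiffAt_proj hslit).continuousAt hc.continuousAt
  have hev : ∀ᶠ η in nhds ξ, mulAct ζ (coordEquiv η) ∈ F.slit ∧
      F.proj (mulAct ζ (coordEquiv η)) ∈ V := by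
    refine Filter.Eventually.and
      (hc.continuousAt.preimage_mem_nhds (F.isOpen_slit.mem_nhds hslit))
      (hc'.preimage_mem_nhds (hVo.mem_nhds ?_))
    rwa [hproj]
  filter_upwards [continuous_subtype_val.continuousAt.preimage_mem_nhds hev] with η hη
  exact ⟨_, hη.2, (toVariety_eq_mk ha h₀ η.2 (F.lift_proj_mem_complexOrbit
    (fun l _ => congrFun η.2 l) hζ (F.marked_ne_zero_of_slit hη.1))).2⟩

theorem twist_mem_dom {g : Fin N → Circle} (hg : g ∈ coordStab K F.idx) {u : F.Slice}
    (hu : u ∈ F.dom a) : F.twist g u ∈ F.dom a :=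
  mem_semistable_of_mem_complexOrbit (F.lift_twist_mem_complexOrbit a hg u) hu

theorem toVariety_eq_iff {u v : F.Slice} (hu : u ∈ F.dom a) (hv : v ∈ F.dom a) :
    F.toVariety ha h₀ u = F.toVariety ha h₀ v ↔ ∃ g : coordStab K F.idx, F.twist g u = v := by
  rw [toVariety_of_mem ha h₀ hu, toVariety_of_mem ha h₀ hv, mk_eq_mk_iff]
  constructor
  · rintro ⟨κ, hκ, h⟩
    have h' : retract K 0 (a 0) (F.lift a v) = torusAct κ (retract K 0 (a 0) (F.lift a u)) := h
    refine F.exists_twist_of_mem_complexOrbit (a := a) (complexOrbit_trans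
      (retract_mem_complexOrbit K 0 (a 0) _) (complexOrbit_trans
        (torusAct_mem_complexOrbit K 0 _ hκ) ?_))
    rw [← h']
    exact complexOrbit_symm (retract_mem_complexOrbit K 0 (a 0) _)
  · rintro ⟨g, rfl⟩
    exact exists_retract_eq_torusAct ha hu (F.lift_twist_mem_complexOrbit a g.2 u)

theorem hasFDerivAt_globalSlice (b : Fin N → ℂ) (u : F.Slice) :
    HasFDerivAt (F.globalSlice b) (fderiv ℂ (F.globalSlice b) u) u :=
  ((F.contDiff_globalSlice b).differentiable (by simp) u).hasFDerivAt

theorem fderiv_lift (a : Param K) (u v : F.Slice) :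
    fderiv ℝ (F.lift a) u v =
      coordEquiv.symm (fderiv ℂ (F.globalSlice (F.paramCoord a)) u v) := by
  have h : HasFDerivAt (F.lift a) _ u := coordEquiv.symm.hasFDerivAt.comp u
    ((hasFDerivAt_globalSlice (F.paramCoord a) u).restrictScalars ℝ)
  rw [h.fderiv]
  rfl

/-- `proj` is a left inverse of the global slice, and its derivative kills the orbit directions. -/
theorem isTransverse_lift (a : Param K) (u : F.Slice) : IsTransverse K 0 (F.lift a) u := by
  rintro v ⟨X, hX, Y, hY, h⟩
  obtain ⟨A, hA, h'⟩ := coordEquiv_infAct_add hX hY (F.lift a u)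
  rw [← h, fderiv_lift, coordEquiv.apply_symm_apply, coordEquiv_lift] at h'
  have hs := F.globalSlice_mem_slit (F.paramCoord a) u
  have h1 : HasFDerivAt (F.proj ∘ F.globalSlice (F.paramCoord a)) _ u :=
    (((F.contDiffAt_proj hs).differentiableAt (by simp)).hasFDerivAt).comp u
      (hasFDerivAt_globalSlice (F.paramCoord a) u)
  have h2 : F.proj ∘ F.globalSlice (F.paramCoord a) = id :=
    funext fun u => F.proj_globalSlice _ u
  rw [h2] at h1
  have h3 := DFunLike.congr_fun (h1.unique (hasFDerivAt_id u)) v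
  rw [ContinuousLinearMap.comp_apply, h', F.fderiv_proj_infMul hs hA] at h3
  exact h3.symm

theorem isHolomorphicMod_lift (a : Param K) (u : F.Slice) : IsHolomorphicMod K 0 (F.lift a) u := by
  intro v
  refine ⟨0, Submodule.zero_mem _, 0, Submodule.zero_mem _, ?_⟩
  rw [infAct_zero, complexStr_zero, add_zero, sub_eq_zero]
  apply coordEquiv.injective
  rw [coordEquiv_complexStr, fderiv_lift, fderiv_lift, coordEquiv.apply_symm_apply,
    coordEquiv.apply_symm_apply, map_smul]

theorem isSlice_toVariety : IsSlice K a (F.dom a) (F.toVariety ha h₀)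
    (fun u => retract K 0 (a 0) (F.lift a u)) :=
  isSlice_retract ha (F.isOpen_dom a) (F.contDiff_lift a).contDiffOn (fun _ hu => hu)
    (fun u _ => isTransverse_lift a u) fun _ hu => toVariety_of_mem ha h₀ hu

/-- The orbifold chart of a frame. -/
def chart (hK : IsClosed (K : Set (Fin N → Circle))) {𝕜 : Type} [NontriviallyNormedField 𝕜]
    [CompleteSpace 𝕜] [NormedAlgebra 𝕜 ℂ] {m : ℕ} (L : (Fin m → 𝕜) ≃L[𝕜] F.Slice) :
    OrbifoldChart 𝕜 m (Variety K a) :=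
  haveI := finite_coordStab hK F.coordSpan_idx
  OrbifoldChart.ofLinearAction L (F.isOpen_dom a) ⟨⟨u₀, h₀⟩, F.isPreconnected_dom a⟩ (F.rep 𝕜)
    (fun g _ hu => twist_mem_dom g.2 hu) (continuousOn_toVariety ha h₀)
    (fun _ hV hVo => isOpen_image_toVariety ha h₀ hV hVo)
    fun _ hu _ hv => toVariety_eq_iff ha h₀ hu hv

end Frame

/-! ### Orbifold atlases from frames -/

theorem IsSlice.comp_equiv {K : Subgroup (Fin N → Circle)} {a : Param K} {E E' : Type}
    [NormedAddCommGroup E] [NormedSpace ℝ E] [NormedAddCommGroup E'] [NormedSpace ℝ E']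
    {s : Set E} {φ : E → Variety K a} {σ : E → HN N} (h : IsSlice K a s φ σ) (L : E' ≃L[ℝ] E) :
    IsSlice K a (L ⁻¹' s) (φ ∘ L) (σ ∘ L) := by
  refine ⟨h.1.comp L.contDiff.contDiffOn fun _ hx => hx, fun u hu => h.2.1 (L u) hu, ?_⟩
  rintro u hu v ⟨X, hX, hv⟩
  rw [L.comp_right_fderiv] at hv
  exact (map_eq_zero_iff L L.injective).1 (h.2.2 (L u) hu (L v) ⟨X, hX, hv⟩)

/-- A complex linear isomorphism as a real linear isomorphism. -/
def realEquiv {E E' : Type} [NormedAddCommGroup E] [NormedSpace ℂ E] [NormedAddCommGroup E']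
    [NormedSpace ℂ E'] (L : E' ≃L[ℂ] E) : E' ≃L[ℝ] E where
  toLinearEquiv := L.toLinearEquiv.restrictScalars ℝ
  continuous_toFun := L.continuous
  continuous_invFun := L.symm.continuous

theorem IsHolomorphicMod.comp_equiv {K : Subgroup (Fin N → Circle)} {j : Fin 3} {E E' : Type}
    [NormedAddCommGroup E] [NormedSpace ℂ E] [NormedAddCommGroup E'] [NormedSpace ℂ E']
    {σ : E → HN N} (L : E' ≃L[ℂ] E) {u : E'} (h : IsHolomorphicMod K j σ (L u)) :
    IsHolomorphicMod K j (σ ∘ L) u := by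
  intro v
  have h1 : ∀ w, fderiv ℝ (σ ∘ L) u w = fderiv ℝ σ (L u) (L w) := fun w =>
    DFunLike.congr_fun ((realEquiv L).comp_right_fderiv (f := σ) (x := u)) w
  rw [h1, h1, map_smul]
  exact h (L v)

/-- Every point of `X(a)` lies in the image of the global slice of a frame. -/
theorem exists_frame_toVariety_eq {K : Subgroup (Fin N → Circle)} {a : Param K}
    (ha : a ∈ regularValues K) (x : Variety K a) :
    ∃ (F : Frame K) (u : F.Slice) (hu : u ∈ F.dom a), F.toVariety ha hu u = x := by
  obtain ⟨⟨ξ, hξ⟩⟩ := x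
  obtain ⟨F, hF⟩ := exists_frame_marked_ne_zero (coordSpan_coordSupport_of_regular ha hξ)
  have h1 : mulAct (fun _ => (1 : ℂ)) (coordEquiv ξ) = coordEquiv ξ := by
    funext l
    simp [mulAct]
  have h2 : (fun _ => (1 : ℂ)) ∈ complexification K :=
    ⟨1, K.one_mem, 0, Submodule.zero_mem _, fun i => by simp⟩
  have h3 := F.lift_proj_mem_complexOrbit (fun l _ => congrFun hξ l) h2 (by rwa [h1])
  have hu : F.proj (mulAct (fun _ => (1 : ℂ)) (coordEquiv ξ)) ∈ F.dom a :=
    mem_semistable_of_mem_complexOrbit h3 (levelSet_subset_semistable K 0 a hξ)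
  exact ⟨F, _, hu, (Frame.toVariety_eq_mk ha hu hξ h3).2⟩

theorem isOrbifold_smoothAtlas {K : Subgroup (Fin N → Circle)}
    (hK : IsClosed (K : Set (Fin N → Circle))) {a : Param K} (ha : a ∈ regularValues K) :
    IsOrbifold (smoothAtlas K a) where
  t2 := t2Space_variety hK a
  secondCountable := secondCountableTopology_variety K a
  covers := by
    intro x
    obtain ⟨F, u, hu, rfl⟩ := exists_frame_toVariety_eq ha x
    let L : (Fin (4 * quotDim K) → ℝ) ≃L[ℝ] F.Slice :=
      ContinuousLinearEquiv.ofFinrankEq (by rw [F.finrank_real_slice]; simp)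
    refine ⟨Frame.chart ha hu hK L, ⟨_, (Frame.isSlice_toVariety ha hu).comp_equiv L⟩, L.symm u,
      ?_, ?_⟩
    · change L (L.symm u) ∈ F.dom a
      rwa [L.apply_symm_apply]
    · change F.toVariety ha hu (L (L.symm u)) = _
      rw [L.apply_symm_apply]
  compatible := fun _ hc _ hd => liftsToCharts_id ha hc hd

theorem isOrbifold_holomorphicAtlas {K : Subgroup (Fin N → Circle)}
    (hK : IsClosed (K : Set (Fin N → Circle))) {a : Param K} (ha : a ∈ regularValues K) :
    IsOrbifold (holomorphicAtlas K 0 a) where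
  t2 := t2Space_variety hK a
  secondCountable := secondCountableTopology_variety K a
  covers := by
    intro x
    obtain ⟨F, u, hu, rfl⟩ := exists_frame_toVariety_eq ha x
    let L : (Fin (2 * quotDim K) → ℂ) ≃L[ℂ] F.Slice :=
      ContinuousLinearEquiv.ofFinrankEq (by rw [F.finrank_slice]; simp)
    refine ⟨Frame.chart ha hu hK L, ⟨_, (Frame.isSlice_toVariety ha hu).comp_equiv
      (realEquiv L), fun v hv => ?_⟩, L.symm u, ?_, ?_⟩
    · exact ((Frame.isHolomorphicMod_lift a (L v)).retract
        ((F.contDiff_lift a).differentiable (by simp) (L v))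
        (mem_retractDomain_of_semistable ha hv)).comp_equiv L
    · change L (L.symm u) ∈ F.dom a
      rwa [L.apply_symm_apply]
    · change F.toVariety ha hu (L (L.symm u)) = _
      rw [L.apply_symm_apply]
  compatible := fun _ hc _ hd => liftsToCharts_holomorphic_id ha hc hd

/-! ### Variation of the semistable locus -/

theorem mem_regularValues_of_update {K : Subgroup (Fin N → Circle)} {j : Fin 3} {a : Param K}
    (h : Function.update a j 0 ∈ regularValues K) : a ∈ regularValues K := by
  refine mem_regularValues_iff.2 fun S hS => mem_regularValues_iff.1 h S fun l => ?_
  by_cases hl : l = j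
  · subst hl
    rw [Function.update_self]
    exact Submodule.zero_mem _
  · rw [Function.update_of_ne hl]
    exact hS l

/-- When the parameter with `j`-th component `0` is regular, the indices with both parts of `ξ i`
nonzero already span `k*`. Coefficients there may have either sign, so every value of `a j` lies in
the cone. -/
theorem mem_semistable_iff_of_update {K : Subgroup (Fin N → Circle)} {j : Fin 3} {a : Param K}
    (h : Function.update a j 0 ∈ regularValues K) {ξ : HN N} :
    ξ ∈ semistable K j a ↔ ∀ l, l ≠ j → momentMap K ξ l = a l := by
  refine ⟨fun h => h.1, fun h1 => mem_semistable_iff.2 ⟨h1, ?_⟩⟩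
  have h2 := coordSpan_of_semistable h (j := j) (ξ := ξ) (c := 0)
    (fun l hl => by rw [h1 l hl, Function.update_of_ne hl]) (by simp)
  obtain ⟨c, hc, hac⟩ := mem_coordSpan_iff.1 (h2 ▸ Submodule.mem_top : a j ∈ coordSpan K _)
  refine ⟨c, fun i => ?_, hac⟩
  by_cases hi : zPart j (ξ i) ≠ 0 ∧ wPart j (ξ i) ≠ 0
  · exact ⟨fun _ => hi.1, fun _ => hi.2⟩
  · rw [hc i fun h => hi (h.resolve_left (by simp))]
    exact ⟨fun h => absurd h (lt_irrefl _), fun h => absurd h (lt_irrefl _)⟩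

theorem semistable_eq_of_update {K : Subgroup (Fin N → Circle)} {j : Fin 3} {a b : Param K}
    (h : Function.update a j 0 ∈ regularValues K) (hab : ∀ l, l ≠ j → a l = b l) :
    semistable K j a = semistable K j b := by
  have h' : Function.update b j 0 = Function.update a j 0 := by
    funext l
    by_cases hl : l = j
    · subst hl
      simp
    · simp [hl, hab l hl]
  ext ξ
  rw [mem_semistable_iff_of_update h, mem_semistable_iff_of_update (h' ▸ h)]
  exact forall_congr' fun l => imp_congr_right fun hl => by rw [hab l hl]

/-! ### Cones of weights and their chambers -/

/-- Coefficients with prescribed signs. -/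
def signSet (p q : Set (Fin N)) : Set (Fin N → ℝ) :=
  {c | ∀ i, (0 < c i → i ∈ p) ∧ (c i < 0 → i ∈ q)}

theorem isClosed_signSet (p q : Set (Fin N)) : IsClosed (signSet p q) := by
  have h : signSet p q = ⋂ i, ({c : Fin N → ℝ | i ∉ p → c i ≤ 0} ∩ {c | i ∉ q → 0 ≤ c i}) := by
    ext c
    simp only [signSet, Set.mem_iInter, Set.mem_inter_iff, Set.mem_ofPred_eq]
    refine forall_congr' fun i => and_congr ?_ ?_
    · rw [← not_imp_not, not_lt]
    · rw [← not_imp_not, not_lt]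
  rw [h]
  refine isClosed_iInter fun i => IsClosed.inter ?_ ?_
  · by_cases hi : i ∈ p
    · simp [hi]
    · simpa [hi] using isClosed_le (continuous_apply i) continuous_const
  · by_cases hi : i ∈ q
    · simp [hi]
    · simpa [hi] using isClosed_le continuous_const (continuous_apply i)

/-- Every vector of a cone is a combination of linearly independent generators with the same
signs. -/
theorem exists_linearIndepOn_signSet {V : Type*} [AddCommGroup V] [Module ℝ V] (f : Fin N → V)
    {p q : Set (Fin N)} {c : Fin N → ℝ} (hc : c ∈ signSet p q) :
    ∃ d ∈ signSet p q, ∑ i, d i • f i = ∑ i, c i • f i ∧ LinearIndepOn ℝ f {i | d i ≠ 0} := by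
  classical
  induction hn : (Finset.univ.filter fun i => c i ≠ 0).card using Nat.strong_induction_on
    generalizing c with
  | _ n ih =>
    by_cases hli : LinearIndepOn ℝ f {i | c i ≠ 0}
    · exact ⟨c, hc, rfl, hli⟩
    obtain ⟨g, hg0, hgs, hg1⟩ : ∃ g : Fin N → ℝ, (∀ i, c i = 0 → g i = 0) ∧
        ∑ i, g i • f i = 0 ∧ ∃ i, g i ≠ 0 := by
      simp only [linearIndepOn_iff, not_forall] at hli
      obtain ⟨g, hg, hg0, hne⟩ := hli
      refine ⟨g, fun i hi => ?_, ?_, Finsupp.ne_iff.1 hne⟩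
      · by_contra h
        exact (Finsupp.mem_supported ℝ g).1 hg (Finsupp.mem_support_iff.2 h) hi
      · rw [← hg0, Finsupp.linearCombination_apply, Finsupp.sum_fintype _ _ (by simp)]
    have hne : (Finset.univ.filter fun i => g i ≠ 0).Nonempty := by
      obtain ⟨i, hi⟩ := hg1
      exact ⟨i, by simp [hi]⟩
    obtain ⟨i₀, hi₀, hmin⟩ := Finset.exists_min_image _ (fun i => |c i / g i|) hne
    have hgi₀ : g i₀ ≠ 0 := by simpa using hi₀
    -- Carathéodory's reduction: subtracting the multiple of the relation `g` with the smallest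
    -- ratio `|c i / g i|` kills the index `i₀` and reverses no sign.
    let d : Fin N → ℝ := fun i => c i - c i₀ / g i₀ * g i
    have hd0 : d i₀ = 0 := by
      simp [d, hgi₀]
    have hdc : ∀ i, c i = 0 → d i = 0 := fun i hi => by simp [d, hi, hg0 i hi]
    have habs : ∀ i, |c i₀ / g i₀ * g i| ≤ |c i| := by
      intro i
      by_cases hgi : g i = 0
      · simp [hgi]
      · have h1 := hmin i (by simp [hgi])
        rw [abs_mul]
        calc |c i₀ / g i₀| * |g i| ≤ |c i / g i| * |g i| := by gcongr
          _ = |c i| := by rw [← abs_mul, div_mul_cancel₀ _ hgi]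
    have hds : d ∈ signSet p q := by
      intro i
      have h1 := abs_le.1 (habs i)
      constructor
      · intro h2
        refine (hc i).1 ?_
        by_contra! h3
        rw [abs_of_nonpos h3] at h1
        simp only [d] at h2
        linarith
      · intro h2
        refine (hc i).2 ?_
        by_contra! h3
        rw [abs_of_nonneg h3] at h1
        simp only [d] at h2
        linarith
    have hsum : ∑ i, d i • f i = ∑ i, c i • f i := by
      simp only [d, sub_smul, mul_smul, Finset.sum_sub_distrib, ← Finset.smul_sum, hgs, smul_zero,
        sub_zero]
    have hci₀ : c i₀ ≠ 0 := fun h => hgi₀ (hg0 i₀ h)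
    have hlt : (Finset.univ.filter fun i => d i ≠ 0).card < n := by
      rw [← hn]
      refine Finset.card_lt_card ⟨fun i hi => ?_, fun h => ?_⟩
      · have : d i ≠ 0 := by simpa using hi
        simpa using fun h => this (hdc i h)
      · have := h (show i₀ ∈ _ by simp [hci₀])
        simp [hd0] at this
    obtain ⟨e, he, hes, hel⟩ := ih _ hlt hds rfl
    exact ⟨e, he, hes.trans hsum, hel⟩

/-- The combinations of the weights `ι*u_i` with prescribed signs. -/
def coneSet (K : Subgroup (Fin N → Circle)) (p q : Set (Fin N)) : Set (kDual K) :=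
  {v | ∃ c ∈ signSet p q, v = ∑ i, c i • iotaStar K i}

/-- By Carathéodory the cone is the finite union, over independent sets of weights, of images of
closed sets under injective linear maps, and these are closed embeddings. -/
theorem isClosed_coneSet (K : Subgroup (Fin N → Circle)) (p q : Set (Fin N)) :
    IsClosed (coneSet K p q) := by
  classical
  let T : (Fin N → ℝ) →ₗ[ℝ] kDual K := Fintype.linearCombination ℝ (iotaStar K)
  have hT : ∀ c, T c = ∑ i, c i • iotaStar K i := fun c => rfl
  let W : Set (Fin N) → Submodule ℝ (Fin N → ℝ) := fun S => Submodule.pi Sᶜ fun _ => ⊥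
  have hW : ∀ S c, c ∈ W S ↔ ∀ i, i ∉ S → c i = 0 := fun S c => by
    simp [W, Submodule.mem_pi]
  have h : coneSet K p q = ⋃ S ∈ {S : Set (Fin N) | LinearIndepOn ℝ (iotaStar K) S},
      T '' (signSet p q ∩ W S) := by
    ext v
    simp only [Set.mem_iUnion, Set.mem_image, exists_prop]
    constructor
    · rintro ⟨c, hc, rfl⟩
      obtain ⟨d, hd, hds, hdl⟩ := exists_linearIndepOn_signSet (iotaStar K) hc
      refine ⟨_, hdl, d, ⟨hd, (hW _ d).2 fun i hi => ?_⟩, hds⟩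
      simpa using hi
    · rintro ⟨S, -, c, hc, rfl⟩
      exact ⟨c, hc.1, rfl⟩
  rw [h]
  refine Set.Finite.isClosed_biUnion (Set.toFinite _) fun S hS => ?_
  have hinj : Function.Injective (T.domRestrict (W S)) := by
    refine (injective_iff_map_eq_zero _).2 fun c hc => Subtype.ext ?_
    have h1 := linearIndepOn_iff.1 hS (Finsupp.equivFunOnFinite.symm c.1)
      ((Finsupp.mem_supported ℝ _).2 fun i hi => by
        by_contra hiS
        exact Finsupp.mem_support_iff.1 hi ((hW S c.1).1 c.2 i hiS))
      (by
        rw [Finsupp.linearCombination_apply, Finsupp.sum_fintype _ _ (by simp)]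
        exact hc)
    exact funext fun i => DFunLike.congr_fun h1 i
  have h1 := (LinearMap.isClosedEmbedding_of_injective (LinearMap.ker_eq_bot.2 hinj)).isClosedMap _
    ((isClosed_signSet p q).preimage (continuous_subtype_val (p := fun c => c ∈ W S)))
  convert h1 using 1
  ext v
  constructor
  · rintro ⟨c, hc, rfl⟩
    exact ⟨⟨c, hc.2⟩, hc.1, rfl⟩
  · rintro ⟨c, hc, rfl⟩
    exact ⟨c.1, ⟨hc, c.2⟩, rfl⟩

/-- Nonzero coefficients keep their sign under small changes, and those with index in `p ∩ q` have
no sign condition. Varying only these is enough, since their weights span and a surjective linear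
map is open. The mask `m` freezes the other coefficients at zero. -/
theorem coneSet_mem_nhds {K : Subgroup (Fin N → Circle)} {p q : Set (Fin N)} {c : Fin N → ℝ}
    (hc : c ∈ signSet p q) (hs : coordSpan K {i | c i ≠ 0 ∨ (i ∈ p ∧ i ∈ q)} = ⊤) :
    coneSet K p q ∈ nhds (∑ i, c i • iotaStar K i) := by
  classical
  let m : Fin N → ℝ := fun i => if c i ≠ 0 ∨ (i ∈ p ∧ i ∈ q) then 1 else 0
  let T : (Fin N → ℝ) →ₗ[ℝ] kDual K := Fintype.linearCombination ℝ fun i => m i • iotaStar K i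
  have hT : ∀ d, T d = ∑ i, (d i * m i) • iotaStar K i := fun d => by
    simp [T, Fintype.linearCombination_apply, mul_smul]
  have hsurj : Function.Surjective T := by
    intro v
    obtain ⟨d, hd, rfl⟩ := mem_coordSpan_iff.1 (hs ▸ Submodule.mem_top : v ∈ coordSpan K _)
    refine ⟨d, ?_⟩
    rw [hT]
    refine Finset.sum_congr rfl fun i _ => ?_
    by_cases hi : c i ≠ 0 ∨ (i ∈ p ∧ i ∈ q)
    · simp [m, hi]
    · simp [hd i hi]
  have hTc : T c = ∑ i, c i • iotaStar K i := by
    rw [hT]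
    refine Finset.sum_congr rfl fun i _ => ?_
    by_cases hi : c i = 0
    · simp [hi]
    · simp [m, hi]
  let U : Set (Fin N → ℝ) := {d | ∀ i, (0 < c i → 0 < d i) ∧ (c i < 0 → d i < 0)}
  have hU : U ∈ nhds c := by
    refine Filter.eventually_all.2 fun i => Filter.Eventually.and ?_ ?_
    · by_cases h : 0 < c i
      · simpa [h] using (continuous_apply i).continuousAt.eventually (lt_mem_nhds h)
      · simp [h]
    · by_cases h : c i < 0
      · simpa [h] using (continuous_apply i).continuousAt.eventually (gt_mem_nhds h)
      · simp [h]
  have hopen := (T.isOpenMap_of_finiteDimensional hsurj).image_mem_nhds hU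
  rw [hTc] at hopen
  refine Filter.mem_of_superset hopen ?_
  rintro _ ⟨d, hd, rfl⟩
  refine ⟨fun i => d i * m i, fun i => ?_, hT d⟩
  by_cases hi : i ∈ p ∧ i ∈ q
  · exact ⟨fun _ => hi.1, fun _ => hi.2⟩
  · rcases lt_trichotomy (c i) 0 with h | h | h
    · have h1 := (hd i).2 h
      simp only [m, h.ne, ne_eq, not_false_eq_true, true_or, if_true, mul_one]
      exact ⟨fun h2 => absurd h2 h1.not_gt, fun _ => (hc i).2 h⟩
    · simp [m, h, hi]
    · have h1 := (hd i).1 h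
      simp only [m, h.ne', ne_eq, not_false_eq_true, true_or, if_true, mul_one]
      exact ⟨fun _ => (hc i).1 h, fun h2 => absurd h2 h1.not_gt⟩

/-- The semistable locus is locally constant at a regular parameter. -/
theorem eventually_semistable_eq {K : Subgroup (Fin N → Circle)} {j : Fin 3} {a : Param K}
    (ha : a ∈ regularValues K) :
    ∀ᶠ v in nhds (a j), semistable K j (Function.update a j v) = semistable K j a := by
  -- Semistability of `ξ` depends only on which of its parts vanish, so there are finitely many
  -- cones to control. A cone of an actual point that contains `a j` is a neighbourhood of it by
  -- regularity; a cone that misses `a j` is closed.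
  have key : ∀ pq : Set (Fin N) × Set (Fin N), ∀ᶠ v in nhds (a j), ∀ ξ : HN N,
      (∀ l, l ≠ j → momentMap K ξ l = a l) → {i | zPart j (ξ i) ≠ 0} = pq.1 →
      {i | wPart j (ξ i) ≠ 0} = pq.2 → (v ∈ coneSet K pq.1 pq.2 ↔ a j ∈ coneSet K pq.1 pq.2) := by
    rintro ⟨p, q⟩
    by_cases hmem : a j ∈ coneSet K p q
    · by_cases hex : ∃ ξ : HN N, (∀ l, l ≠ j → momentMap K ξ l = a l) ∧
          {i | zPart j (ξ i) ≠ 0} = p ∧ {i | wPart j (ξ i) ≠ 0} = q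
      · obtain ⟨ξ, h1, h2, h3⟩ := hex
        obtain ⟨c, hc, hac⟩ := hmem
        have h4 := coordSpan_of_semistable ha h1 hac
        have h5 : coneSet K p q ∈ nhds (a j) := by
          rw [hac]
          refine coneSet_mem_nhds hc ?_
          rw [← h2, ← h3]
          exact h4
        filter_upwards [h5] with v hv ξ _ _ _
        exact iff_of_true hv ⟨c, hc, hac⟩
      · exact Filter.Eventually.of_forall fun v ξ h1 h2 h3 => absurd ⟨ξ, h1, h2, h3⟩ hex
    · filter_upwards [(isClosed_coneSet K p q).isOpen_compl.mem_nhds hmem] with v hv ξ _ _ _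
      exact iff_of_false hv hmem
  filter_upwards [Filter.eventually_all.2 key] with v hv
  ext ξ
  rw [mem_semistable_iff, mem_semistable_iff, Function.update_self]
  have h0 : (∀ l, l ≠ j → momentMap K ξ l = Function.update a j v l) ↔
      ∀ l, l ≠ j → momentMap K ξ l = a l :=
    forall_congr' fun l => imp_congr_right fun hl => by rw [Function.update_of_ne hl]
  rw [h0]
  exact and_congr_right fun h1 => hv (_, _) ξ h1 rfl rfl

/-! ### Generic parameters -/

/-- The vector lies on none of the walls. -/
def IsGeneric (K : Subgroup (Fin N → Circle)) (v : kDual K) : Prop :=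
  ∀ S : Set (Fin N), v ∈ coordSpan K S → coordSpan K S = ⊤

theorem exists_isGeneric (K : Subgroup (Fin N → Circle)) : ∃ v, IsGeneric K v := by
  by_contra! h
  have h1 : ⋃ S : {S : Set (Fin N) // coordSpan K S ≠ ⊤}, (coordSpan K S.1 : Set (kDual K)) =
      Set.univ := by
    refine Set.eq_univ_of_forall fun v => ?_
    have h2 := h v
    simp only [IsGeneric, not_forall] at h2
    obtain ⟨S, hS, hS'⟩ := h2
    exact Set.mem_iUnion.2 ⟨⟨S, hS'⟩, hS⟩
  obtain ⟨S, hS⟩ := Subspace.exists_eq_top_of_iUnion_eq_univ h1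
  exact S.2 hS

/-- A line through `v` in a generic direction meets each of the finitely many proper spans at most
once. -/
theorem exists_isGeneric_mem {K : Subgroup (Fin N → Circle)} {v : kDual K} {U : Set (kDual K)}
    (hU : U ∈ nhds v) : ∃ w ∈ U, IsGeneric K w := by
  obtain ⟨η, hη⟩ := exists_isGeneric K
  have hc : Continuous fun t : ℝ => v + t • η := by fun_prop
  have h1 : (fun t : ℝ => v + t • η) ⁻¹' U ∈ nhds (0 : ℝ) :=
    hc.continuousAt.preimage_mem_nhds (by simpa using hU)
  have h2 : {t : ℝ | ¬IsGeneric K (v + t • η)}.Finite := by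
    refine (Set.finite_iUnion fun S : {S : Set (Fin N) // coordSpan K S ≠ ⊤} =>
      Set.Subsingleton.finite (s := {t : ℝ | v + t • η ∈ coordSpan K S.1}) ?_).subset ?_
    · intro t ht t' ht'
      by_contra hne
      refine S.2 (hη S.1 ?_)
      have h3 := Submodule.sub_mem (coordSpan K S.1) ht ht'
      rw [add_sub_add_left_eq_sub, ← sub_smul] at h3
      exact (Submodule.smul_mem_iff _ (sub_ne_zero.2 hne)).1 h3
    · intro t ht
      simp only [IsGeneric, not_forall, Set.mem_ofPred_eq] at ht
      obtain ⟨S, hS, hS'⟩ := ht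
      exact Set.mem_iUnion.2 ⟨⟨S, hS'⟩, hS⟩
  obtain ⟨t, ht, ht'⟩ := ((infinite_of_mem_nhds (0 : ℝ) h1).sdiff h2).nonempty
  exact ⟨_, ht, not_not.1 ht'⟩

theorem mem_regularValues_of_isGeneric {K : Subgroup (Fin N → Circle)} {a : Param K} {l : Fin 3}
    (h : IsGeneric K (a l)) : a ∈ regularValues K :=
  mem_regularValues_iff.2 fun S hS => h S (hS l)

/-! ### Compositions of natural morphisms -/

/-- The quotients are diffeomorphic by a composition of natural morphisms and their inverses. -/
def NaturallyIso (K : Subgroup (Fin N → Circle)) (a b : Param K) : Prop :=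
  ∃ e : Variety K a ≃ₜ Variety K b,
    IsNaturalComposite K e ∧ IsOrbifoldIso (smoothAtlas K a) (smoothAtlas K b) e

theorem NaturallyIso.symm {K : Subgroup (Fin N → Circle)} {a b : Param K}
    (h : NaturallyIso K a b) : NaturallyIso K b a := by
  obtain ⟨e, h1, h2⟩ := h
  exact ⟨e.symm, .symm e h1, h2.symm⟩

theorem NaturallyIso.trans {K : Subgroup (Fin N → Circle)} {a b c : Param K}
    (h : NaturallyIso K a b) (h' : NaturallyIso K b c) : NaturallyIso K a c := by
  obtain ⟨e, h1, h2⟩ := h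
  obtain ⟨f, h3, h4⟩ := h'
  exact ⟨e.trans f, .trans e f h1 h3, h2.trans h4⟩

theorem naturallyIso_of_semistable_eq {K : Subgroup (Fin N → Circle)}
    (hK : IsClosed (K : Set (Fin N → Circle))) {j : Fin 3} {a b : Param K}
    (ha : a ∈ regularValues K) (hb : b ∈ regularValues K) (hab : ∀ l, l ≠ j → a l = b l)
    (h : semistable K j a = semistable K j b) : NaturallyIso K a b := by
  have hiso : IsOrbifoldIso (smoothAtlas K a) (smoothAtlas K b) (naturalHomeomorph ha hb h) :=
    ⟨isOrbifold_smoothAtlas hK ha, isOrbifold_smoothAtlas hK hb, Homeomorph.isHomeomorph _,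
      fun _ hc _ hd => liftsToCharts_naturalMap ha hb h.subset hc hd⟩
  exact ⟨naturalHomeomorph ha hb h,
    .natural j _ (isNaturalMorphism_naturalMap hab hb h.subset) hiso, hiso⟩

/-- The generic component `l` keeps the parameter regular for every value of the component `j`,
including `0`, so the semistable locus for `I_j` does not depend on that component. -/
theorem naturallyIso_update {K : Subgroup (Fin N → Circle)}
    (hK : IsClosed (K : Set (Fin N → Circle))) {a : Param K} {j l : Fin 3} (hjl : l ≠ j)
    (h : IsGeneric K (a l)) (v : kDual K) : NaturallyIso K a (Function.update a j v) := by
  have h1 : ∀ w, Function.update a j w ∈ regularValues K := fun w =>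
    mem_regularValues_of_isGeneric (l := l) (by rwa [Function.update_of_ne hjl])
  have hab : ∀ l, l ≠ j → a l = Function.update a j v l := fun l hl =>
    (Function.update_of_ne hl _ _).symm
  exact naturallyIso_of_semistable_eq hK (mem_regularValues_of_isGeneric h) (h1 v) hab
    (semistable_eq_of_update (h1 0) hab)

/-- The component `0` is first moved to a generic value within its chamber. Then the components `1`,
`2`, `0` are set to `η` in turn; at each move another component is generic. -/
theorem naturallyIso_const {K : Subgroup (Fin N → Circle)}
    (hK : IsClosed (K : Set (Fin N → Circle))) {a : Param K} (ha : a ∈ regularValues K)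
    {η : kDual K} (hη : IsGeneric K η) : NaturallyIso K a fun _ => η := by
  obtain ⟨w, hw, hwg⟩ := exists_isGeneric_mem (eventually_semistable_eq (j := 0) ha)
  have h0 : NaturallyIso K a (Function.update a 0 w) :=
    naturallyIso_of_semistable_eq (j := 0) hK ha
      (mem_regularValues_of_isGeneric (l := 0) (by rwa [Function.update_self]))
      (fun l hl => (Function.update_of_ne hl _ _).symm) (Eq.symm hw)
  have h1 := naturallyIso_update hK (a := Function.update a 0 w) (j := 1) (l := 0) (by decide)
    (by rwa [Function.update_self]) η
  have h2 := naturallyIso_update hK (a := Function.update (Function.update a 0 w) 1 η) (j := 2)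
    (l := 1) (by decide) (by rwa [Function.update_self]) η
  have h3 := naturallyIso_update hK
    (a := Function.update (Function.update (Function.update a 0 w) 1 η) 2 η) (j := 0)
    (l := 2) (by decide) (by rwa [Function.update_self]) η
  have h4 : Function.update (Function.update (Function.update (Function.update a 0 w) 1 η) 2 η) 0 η
      = fun _ => η := by
    funext l
    fin_cases l <;> rfl
  rw [h4] at h3
  exact h0.trans (h1.trans (h2.trans h3))

theorem naturallyIso {K : Subgroup (Fin N → Circle)}
    (hK : IsClosed (K : Set (Fin N → Circle))) {a b : Param K} (ha : a ∈ regularValues K)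
    (hb : b ∈ regularValues K) : NaturallyIso K a b := by
  obtain ⟨η, hη⟩ := exists_isGeneric K
  exact (naturallyIso_const hK ha hη).trans (naturallyIso_const hK hb hη).symm

/-- The natural morphism `π₁` is biholomorphic. -/
theorem exists_biholomorphic_naturalMorphism {K : Subgroup (Fin N → Circle)}
    (hK : IsClosed (K : Set (Fin N → Circle))) {a : Param K}
    (h0 : Function.update a 0 0 ∈ regularValues K) :
    ∃ p : Variety K a → Variety K (Function.update a 0 0),
      IsNaturalMorphism K 0 p ∧ (∀ p', IsNaturalMorphism K 0 p' → p' = p) ∧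
      IsOrbifoldIso (holomorphicAtlas K 0 a) (holomorphicAtlas K 0 (Function.update a 0 0)) p := by
  have ha := mem_regularValues_of_update h0
  have hab : ∀ l, l ≠ 0 → a l = Function.update a 0 0 l := fun l hl =>
    (Function.update_of_ne hl _ _).symm
  have h := semistable_eq_of_update h0 hab
  exact ⟨naturalMap h0 h.subset, isNaturalMorphism_naturalMap hab h0 h.subset,
    fun p' hp' => eq_naturalMap hK h0 h.subset hp', isOrbifold_holomorphicAtlas hK ha,
    isOrbifold_holomorphicAtlas hK h0, (naturalHomeomorph ha h0 h).isHomeomorph,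
    fun _ hc _ hd => liftsToCharts_holomorphic_naturalMap ha h0 h.subset hc hd⟩

end ToricHK
end

theorem mainTheorem3 (N : ℕ) (K : Subgroup (Fin N → Circle))
    (hK_closed : IsClosed (K : Set (Fin N → Circle)))
    (hK_connected : IsConnected (K : Set (Fin N → Circle))) :
    -- (1) the regular values
    (regularValues K =
      Set.univ \ ⋃ H ∈ oneDimIsotropy K, {a : Param K | ∀ j, a j ∈ wall K H}) ∧
    -- (2) the quotient is an orbifold
    (∀ a ∈ regularValues K, IsOrbifold (smoothAtlas K a)) ∧
    -- (3) the natural morphism is well defined and biholomorphic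
    (∀ a : Param K, Function.update a 0 0 ∈ regularValues K →
      ∃ p : Variety K a → Variety K (Function.update a 0 0),
        IsNaturalMorphism K 0 p ∧ (∀ p', IsNaturalMorphism K 0 p' → p' = p) ∧
        IsOrbifoldIso (holomorphicAtlas K 0 a) (holomorphicAtlas K 0 (Function.update a 0 0)) p) ∧
    -- (4) the orbits are closed, and the categorical quotient is geometric
    (∀ a ∈ regularValues K,
      (∀ ξ ∈ semistable K 0 a,
        IsClosed ((↑) ⁻¹' complexOrbit K 0 ξ : Set (semistable K 0 a))) ∧
      IsHomeomorph (orbitSpaceToGIT K 0 a)) ∧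
    -- (5) all quotients are diffeomorphic through compositions of natural morphisms
    (∀ a ∈ regularValues K, ∀ b ∈ regularValues K,
      ∃ e : Variety K a ≃ₜ Variety K b,
        IsNaturalComposite K e ∧ IsOrbifoldIso (smoothAtlas K a) (smoothAtlas K b) e) := by
  exact ⟨regularValues_eq K, fun a ha => isOrbifold_smoothAtlas hK_closed ha,
    fun a h0 => exists_biholomorphic_naturalMorphism hK_closed h0,
    fun a ha => ⟨fun ξ hξ => isClosed_complexOrbit hK_closed ha hξ,
      isHomeomorph_orbitSpaceToGIT hK_closed ha⟩,
    fun a ha b hb => naturallyIso hK_closed ha hb⟩
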